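/- **Setting.** $\mathcal L$ is a recursive first-order language with equality that contains the language $0,S,+,\cdot,2^x$ of arithmetic, has finitely many further function symbols and recursively many further relation symbols, and does not contain the unary predicate symbol $\mathrm T$. $\mathrm{I}\Delta_0+\exp$ is Robinson's arithmetic with the recursion equations of $2^x$ and induction for bounded arithmetical formulas. $\mathsf S$ is a set of sentences of $\mathcal L$ that proves $\mathrm{I}\Delta_0+\exp$. $\mathcal L^+$ is $\mathcal L$ with new predicate symbols $P^i_j$ of arity $i$ ($i,j<\omega$) and a propositional constant $\epsilon$; fix a standard Gödel coding of $\mathcal L^+$ with the terms $\dot=,\dot\vee,\dot\neg,\dot\forall$ and the arithmetical formulas $\mathrm{Sent}(x)$ ($x$ codes a sentence of $\mathcal L^+$), $w=x[z/y]$ ($y$ codes a variable, $z$ codes a closed term, and $w$ codes the result of substituting $z$ for the free occurrences of $y$ in the formula coded by $x$), $\dot d(x)\le y$ (the formula coded by $x$ has logical complexity at most $y$, atomic formulas having complexity $0$), $\mathrm{eq}(r,s)$ ($\forall x\forall y(\mathrm{val}(r,x)\wedge\mathrm{val}(s,y)\to x=y)$, where $\mathrm{val}(r,x)$ says that the closed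 term of $\mathcal L$ coded by $r$ has value $x$). **The calculus $\mathsf{CT}^*[\mathsf S]$** derives sequents $\Gamma\Rightarrow\Delta$ of finite sets of formulas of $\mathcal L\cup\{\mathrm T\}$, built with $=,\neg,\vee,\forall$. Below, $r,s,t,\phi,\psi,\psi_0,\psi_1$ are terms of $\mathcal L$. * Initial sequents: $\Gamma\Rightarrow\Delta,\varphi$ for $\varphi$ an axiom of $\mathsf S$; the initial sequents $\Gamma,\alpha\Rightarrow\Delta,\alpha$, $\ \Gamma\Rightarrow\Delta,t=t$ and $\Gamma,r=s,\alpha(r)\Rightarrow\Delta,\alpha(s)$ of first-order logic with equality for formulas $\alpha$ of $\mathcal L$; $\Gamma,r=s,\mathrm Tr\Rightarrow\Delta,\mathrm Ts$; and $\Gamma,\mathrm Tr\Rightarrow\Delta,\mathrm{Sent}(r)$. * Arithmetical rules: the usual left and right rules for $\forall,\vee,\neg$, and cut on formulas of $\mathcal L$. $\Gamma\Rightarrow^*\Delta$ means that $\Gamma\Rightarrow\Delta$ is derivable from the initial sequents by arithmetical rules alone. * Truth rules (premises / conclusion): * $(\vee_{\mathrm T}\mathrm R)$: $\ \Gamma\Rightarrow\Delta,\mathrm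 T\psi_0,\mathrm T\psi_1$ / $\Gamma,\mathrm{Sent}\,\psi,\psi=\psi_0\dot\vee\psi_1\Rightarrow\Delta,\mathrm T\psi$; * $(\vee_{\mathrm T}\mathrm L)$: $\ \Gamma,\mathrm T\psi_0\Rightarrow\Delta$ and $\Gamma,\mathrm T\psi_1\Rightarrow\Delta$ / $\Gamma,\psi=\psi_0\dot\vee\psi_1,\mathrm T\psi\Rightarrow\Delta$; * $(\forall_{\mathrm T}\mathrm R)$: $\ \Gamma,w=\psi_0[v/s]\Rightarrow\Delta,\mathrm Tw$ with eigenvariables $v,w$ / $\Gamma,\mathrm{Sent}\,\psi,\psi=\dot\forall s\psi_0\Rightarrow\Delta,\mathrm T\psi$; * $(\forall_{\mathrm T}\mathrm L)$: $\ \Gamma,\mathrm Tu\Rightarrow\Delta$ / $\Gamma,u=\psi_0[t/s],\psi=\dot\forall s\psi_0,\mathrm T\psi\Rightarrow\Delta$, for any terms $t,u$; * $(\neg_{\mathrm T}\mathrm R)$: $\ \Gamma,\mathrm T\psi_0\Rightarrow\Delta$ / $\Gamma,\mathrm{Sent}\,\psi,\psi=\dot\neg\psi_0\Rightarrow\Delta,\mathrm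 T\psi$; * $(\neg_{\mathrm T}\mathrm L)$: $\ \Gamma\Rightarrow\Delta,\mathrm T\psi_0$ / $\Gamma,\mathrm{Sent}\,\psi,\psi=\dot\neg\psi_0,\mathrm T\psi\Rightarrow\Delta$; * $(=_{\mathrm T}\mathrm R)$: $\ \Gamma\Rightarrow\Delta,\mathrm{eq}(r,s)$ / $\Gamma,\mathrm{Sent}\,\psi,\psi=(r\,\dot=\,s)\Rightarrow\Delta,\mathrm T\psi$; * $(=_{\mathrm T}\mathrm L)$: $\ \Gamma,\mathrm{eq}(r,s)\Rightarrow\Delta$ / $\Gamma,\psi=(r\,\dot=\,s),\mathrm T\psi\Rightarrow\Delta$. * Bounded $\mathrm T$-cuts $(\mathrm{Cut}^k_{\mathrm T})$, $k<\omega$: from $\Gamma,\mathrm T\phi\Rightarrow\Delta$, $\ \Gamma\Rightarrow\Delta,\mathrm T\phi$ and $\Gamma,\mathrm{Sent}\,\phi\Rightarrow^*\dot d(\phi)\le\bar k$ infer $\Gamma\Rightarrow\Delta$. A derivation has *rank* $(a,r)$ if every path through it contains at most $a$ truth rules, $\mathrm T$-cuts included, and $k<r$ for every $(\mathrm{Cut}^k_{\mathrm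 T})$ that occurs in it. **Lemma (Cut elimination for $\mathsf{CT}^*$).** 1. For all $a,r<\omega$: if $\Gamma\Rightarrow\Delta$ is derivable in $\mathsf{CT}^*[\mathsf S]$ with rank $(a,r+1)$, then it is derivable with rank $(3^a,r)$. 2. Hence every sequent derivable in $\mathsf{CT}^*[\mathsf S]$ with some rank $(a,r)$ is derivable with rank $(b,0)$ for some $b$, that is, without $\mathrm T$-cuts. 3. $\mathsf{CT}^*[\mathsf S]$ is a conservative extension of $\mathsf S$: for every formula $\alpha$ of $\mathcal L$, the sequent $\emptyset\Rightarrow\alpha$ is derivable in $\mathsf{CT}^*[\mathsf S]$ if and only if $\mathsf S\vdash\alpha$. -/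

import Mathlib

universe u v

namespace CompTruth

/-! ### Syntax

`E` lists the non-logical symbols that the language `L` has besides those of arithmetic, so `L` is
the language `0, S, +, ·, 2^x` together with the symbols of `E`. `Fml E` is the set of formulas of
`L ∪ {T}`. Bound variables are de Bruijn indices: the quantifier `all` binds index `0`. -/

/-- Terms of `L`; `exp t` is `2 ^ t`. -/
inductive Tm (E : FirstOrder.Language.{u, v}) : Type u
  | var (i : ℕ) : Tm E
  | zero : Tm E
  | succ (t : Tm E) : Tm E
  | add (s t : Tm E) : Tm E
  | mul (s t : Tm E) : Tm E
  | exp (t : Tm E) : Tm E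
  | fn {n : ℕ} (f : E.Functions n) (ts : Fin n → Tm E) : Tm E

/-- Formulas of `L ∪ {T}`; `tr t` is the atomic formula `T t`. -/
inductive Fml (E : FirstOrder.Language.{u, v}) : Type (max u v)
  | eq (s t : Tm E) : Fml E
  | rel {n : ℕ} (R : E.Relations n) (ts : Fin n → Tm E) : Fml E
  | tr (t : Tm E) : Fml E
  | neg (φ : Fml E) : Fml E
  | or (φ ψ : Fml E) : Fml E
  | all (φ : Fml E) : Fml E

noncomputable instance (E : FirstOrder.Language.{u, v}) : DecidableEq (Fml E) := Classical.decEq _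

variable {E : FirstOrder.Language.{u, v}}

namespace Tm

/-- Simultaneous substitution. -/
def subst (σ : ℕ → Tm E) : Tm E → Tm E
  | var i => σ i
  | zero => zero
  | succ t => succ (t.subst σ)
  | add s t => add (s.subst σ) (t.subst σ)
  | mul s t => mul (s.subst σ) (t.subst σ)
  | exp t => exp (t.subst σ)
  | fn f ts => fn f fun i => (ts i).subst σ

/-- Raise all variables by `k` (for use below `k` further quantifiers). -/
def lift (k : ℕ) (t : Tm E) : Tm E := t.subst fun i => var (i + k)

/-- Terms of the language of arithmetic. -/
def Pure : Tm E → Prop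
  | var _ => True
  | zero => True
  | succ t => t.Pure
  | add s t => s.Pure ∧ t.Pure
  | mul s t => s.Pure ∧ t.Pure
  | exp t => t.Pure
  | fn _ _ => False

/-- Numerals. -/
def num : ℕ → Tm E
  | 0 => zero
  | k + 1 => succ (num k)

end Tm

open Tm

/-- The substitution `σ` moved below a quantifier. -/
def upSubst (σ : ℕ → Tm E) : ℕ → Tm E
  | 0 => var 0
  | i + 1 => (σ i).lift 1

namespace Fml

/-- Simultaneous (capture-free) substitution for the free variables. -/
def subst : (ℕ → Tm E) → Fml E → Fml E
  | σ, eq s t => eq (s.subst σ) (t.subst σ)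
  | σ, rel R ts => rel R fun i => (ts i).subst σ
  | σ, tr t => tr (t.subst σ)
  | σ, neg φ => neg (φ.subst σ)
  | σ, or φ ψ => or (φ.subst σ) (ψ.subst σ)
  | σ, all φ => all (φ.subst (upSubst σ))

def lift (k : ℕ) (φ : Fml E) : Fml E := φ.subst fun i => var (i + k)

/-- Replace variable `0` by `t` and lower the other variables: if `φ` is the scope of a quantifier,
then this is the instance `φ(t)`. -/
def inst (φ : Fml E) (t : Tm E) : Fml E :=
  φ.subst fun i => match i with
    | 0 => t
    | j + 1 => var j

/-- Arithmetical formulas: the formulas of `L`, in which `T` does not occur. -/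
def Arith : Fml E → Prop
  | eq _ _ => True
  | rel _ _ => True
  | tr _ => False
  | neg φ => φ.Arith
  | or φ ψ => φ.Arith ∧ ψ.Arith
  | all φ => φ.Arith

/-- Formulas in the language of arithmetic, without symbols from `E` and without `T`. -/
def Pure : Fml E → Prop
  | eq s t => s.Pure ∧ t.Pure
  | rel _ _ => False
  | tr _ => False
  | neg φ => φ.Pure
  | or φ ψ => φ.Pure ∧ ψ.Pure
  | all φ => φ.Pure

/-- Sentences: formulas without free variables. -/
def Closed (φ : Fml E) : Prop := ∀ σ, φ.subst σ = φ

def and (φ ψ : Fml E) : Fml E := neg (or (neg φ) (neg ψ))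
def imp (φ ψ : Fml E) : Fml E := or (neg φ) ψ
def iff (φ ψ : Fml E) : Fml E := and (imp φ ψ) (imp ψ φ)
def ex (φ : Fml E) : Fml E := neg (all (neg φ))
def bot : Fml E := neg (eq zero zero)

/-- A block of `n` existential quantifiers; it binds the indices `0, …, n - 1`, the outermost
quantifier being index `n - 1`. -/
def exs : ℕ → Fml E → Fml E
  | 0, φ => φ
  | n + 1, φ => ex (exs n φ)

/-- A block of `n` universal quantifiers, with the same convention. -/
def alls : ℕ → Fml E → Fml E
  | 0, φ => φ
  | n + 1, φ => all (alls n φ)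

/-- Finite disjunctions. -/
def ors : List (Fml E) → Fml E
  | [] => bot
  | φ :: l => or φ (ors l)

/-- `s ≤ t` -/
def le (s t : Tm E) : Fml E := ex (eq (add (var 0) (s.lift 1)) (t.lift 1))

/-- `s < t` -/
def lt (s t : Tm E) : Fml E := le (succ s) t

end Fml

open Fml

/-- All free variables of the formulas of `Γ` raised by `k`, which makes the variables
`0, …, k - 1` fresh for `Γ`. -/
noncomputable def liftS (k : ℕ) (Γ : Finset (Fml E)) : Finset (Fml E) := Γ.image (Fml.lift k)

/-! ### The arithmetical rules -/

/-- Sequents derivable from the initial sequents `Ini` by the arithmetical rules, the cut rule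
being confined to formulas of `L`. The eigenvariable of the right rule for `∀` is the variable `0`,
made fresh by the shift of the side formulas. -/
inductive LK (Ini : Finset (Fml E) → Finset (Fml E) → Prop) :
    Finset (Fml E) → Finset (Fml E) → Prop
  | init {Γ Δ} : Ini Γ Δ → LK Ini Γ Δ
  | allR {Γ Δ} (α : Fml E) : LK Ini (liftS 1 Γ) (insert α (liftS 1 Δ)) →
      LK Ini Γ (insert (all α) Δ)
  | allL {Γ Δ} (α : Fml E) (s : Tm E) : LK Ini (insert (α.inst s) Γ) Δ →
      LK Ini (insert (all α) Γ) Δ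
  | orR {Γ Δ} (α β : Fml E) : LK Ini Γ (insert α (insert β Δ)) →
      LK Ini Γ (insert (or α β) Δ)
  | orL {Γ Δ} (α β : Fml E) : LK Ini (insert α Γ) Δ → LK Ini (insert β Γ) Δ →
      LK Ini (insert (or α β) Γ) Δ
  | negR {Γ Δ} (α : Fml E) : LK Ini (insert α Γ) Δ → LK Ini Γ (insert (neg α) Δ)
  | negL {Γ Δ} (α : Fml E) : LK Ini Γ (insert α Δ) → LK Ini (insert (neg α) Γ) Δ
  | cut {Γ Δ} (α : Fml E) : α.Arith → LK Ini (insert α Γ) Δ → LK Ini Γ (insert α Δ) →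
      LK Ini Γ Δ

/-- Initial sequents for the axioms of `S` and for first-order logic with equality in `L`. -/
inductive BaseInit (S : Set (Fml E)) : Finset (Fml E) → Finset (Fml E) → Prop
  | ax {Γ Δ} (φ : Fml E) : φ ∈ S → BaseInit S Γ (insert φ Δ)
  | id {Γ Δ} (α : Fml E) : α.Arith → BaseInit S (insert α Γ) (insert α Δ)
  | refl {Γ Δ} (t : Tm E) : BaseInit S Γ (insert (eq t t) Δ)
  | repl {Γ Δ} (α : Fml E) (r s : Tm E) : α.Arith →
      BaseInit S (insert (eq r s) (insert (α.inst r) Γ)) (insert (α.inst s) Δ)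

/-- `S ⊢ α` in first-order logic with equality: there is a derivation of `∅ ⇒ α` from the axioms of
`S` that consists of formulas of `L` only. (A derivation whose initial sequents and cut formulas
are in `L` has only formulas of `L`.) -/
def Provable (S : Set (Fml E)) (α : Fml E) : Prop :=
  LK (fun Γ Δ => BaseInit S Γ Δ ∧ (∀ φ ∈ Γ, φ.Arith) ∧ ∀ φ ∈ Δ, φ.Arith) ∅ {α}

/-! ### The theory `IΔ₀ + exp` -/

/-- Bounded formulas of the language of arithmetic; the bounded quantifier is
`∀ x (x ≤ t → φ)`, where `x` does not occur in `t`. -/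
inductive Delta0 : Fml E → Prop
  | eq (s t : Tm E) : s.Pure → t.Pure → Delta0 (eq s t)
  | neg (φ : Fml E) : Delta0 φ → Delta0 (neg φ)
  | or (φ ψ : Fml E) : Delta0 φ → Delta0 ψ → Delta0 (or φ ψ)
  | ball (t : Tm E) (φ : Fml E) : t.Pure → Delta0 φ →
      Delta0 (all (imp (le (var 0) (t.lift 1)) φ))

/-- Axioms of `IΔ₀ + exp`: Robinson's arithmetic, the recursion equations of `x ↦ 2 ^ x`, and
induction for bounded formulas (with parameters). Free variables are read universally. -/
inductive IDexp (E : FirstOrder.Language.{u, v}) : Fml E → Prop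
  | succ_ne_zero : IDexp E (neg (eq (succ (var 0)) zero))
  | succ_inj : IDexp E (imp (eq (succ (var 0)) (succ (var 1))) (eq (var 0) (var 1)))
  | zero_or_succ : IDexp E (or (eq (var 0) zero) (ex (eq (var 1) (succ (var 0)))))
  | add_zero : IDexp E (eq (add (var 0) zero) (var 0))
  | add_succ : IDexp E (eq (add (var 0) (succ (var 1))) (succ (add (var 0) (var 1))))
  | mul_zero : IDexp E (eq (mul (var 0) zero) zero)
  | mul_succ : IDexp E (eq (mul (var 0) (succ (var 1))) (add (mul (var 0) (var 1)) (var 0)))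
  | exp_zero : IDexp E (eq (exp zero) (succ zero))
  | exp_succ : IDexp E (eq (exp (succ (var 0))) (add (exp (var 0)) (exp (var 0))))
  | induction (φ : Fml E) : Delta0 φ → IDexp E
      (imp (and (φ.inst zero)
          (all (imp φ (φ.subst fun i => match i with
            | 0 => succ (var 0)
            | j + 1 => var (j + 1)))))
        (all φ))

/-! ### The language `L⁺` and its Gödel coding

`L⁺` is `L` with new predicate symbols `P i j` (of arity `i`) and a propositional constant `ε`. Its
formulas are built with `=`, `¬`, `∨`, `∀` and have named variables `v_0, v_1, …`. -/

/-- What the coding needs to know about the recursive language `L`: a finite list of the function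
symbols of `E`, codes for the relation symbols of `E`, and a formula of arithmetic (its variables
`0` and `1` standing for `q` and `n`) that decides in `IΔ₀ + exp` whether `q` is the code of a
relation symbol of arity `n`. -/
structure Coding (E : FirstOrder.Language.{u, v}) where
  fns : List (Σ n, E.Functions n)
  fns_nodup : fns.Nodup
  fns_complete : ∀ f, f ∈ fns
  relCode : (Σ n, E.Relations n) → ℕ
  relCode_injective : Function.Injective relCode
  relF : Fml E
  relF_pure : relF.Pure
  relF_pos : ∀ R : Σ n, E.Relations n, Provable {φ | IDexp E φ}
    (relF.subst fun i => match i with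
      | 0 => num (relCode R)
      | 1 => num R.1
      | _ => zero)
  relF_neg : ∀ q n : ℕ, (¬ ∃ R : E.Relations n, relCode ⟨n, R⟩ = q) → Provable {φ | IDexp E φ}
    (neg (relF.subst fun i => match i with
      | 0 => num q
      | 1 => num n
      | _ => zero))

/-- The injective pairing `⟨x, y⟩ = (x + y)² + x + 1`, which exceeds `x` and `y`. -/
def pr (x y : Tm E) : Tm E := succ (add (mul (add x y) (add x y)) x)

/-- Finite sequences of codes: `[] = 0`, `x :: l = ⟨x, l⟩`. -/
def seqTm : List (Tm E) → Tm E
  | [] => zero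
  | x :: l => pr x (seqTm l)

/-- The variable `v_i` -/
def cVar (i : Tm E) : Tm E := pr (num 0) i
/-- The term `f(t₁, …, t_n)`, with `q` the code of `f` and `l` that of `[t₁, …, t_n]` -/
def cFn (q l : Tm E) : Tm E := pr (num 1) (pr q l)
/-- `s =̇ t` -/
def cEq (s t : Tm E) : Tm E := pr (num 2) (pr s t)
/-- The atomic formula `Q(t₁, …, t_n)` for the relation symbol `Q` of `E` with code `q` -/
def cRel (q l : Tm E) : Tm E := pr (num 3) (pr q l)
/-- The atomic formula `P i j (t₁, …, t_i)`; the arity `i` is the length of `l` -/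
def cP (j l : Tm E) : Tm E := pr (num 4) (pr j l)
/-- `ε` -/
def cEps : Tm E := pr (num 5) zero
/-- `x ∨̇ y` -/
def cOr (x y : Tm E) : Tm E := pr (num 6) (pr x y)
/-- `¬̇ x` -/
def cNeg (x : Tm E) : Tm E := pr (num 7) x
/-- `∀̇ y x`, with `y` the code of the bound variable -/
def cAll (y x : Tm E) : Tm E := pr (num 8) (pr y x)

/-- `i ∈ c`: the binary expansion of `c` has digit `1` at place `i`, that is,
`c = a · 2 ^ (i + 1) + 2 ^ i + b` for some `a` and some `b < 2 ^ i`. Finite sets are coded so. -/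
def mem (i c : Tm E) : Fml E :=
  exs 2 (and
    (eq (c.lift 2) (add (add (mul (var 1) (exp (succ (i.lift 2)))) (exp (i.lift 2))) (var 0)))
    (lt (var 0) (exp (i.lift 2))))

/-- A function symbol of `L`: its code, its arity and the terms it forms. -/
structure FnSym (E : FirstOrder.Language.{u, v}) where
  code : ℕ
  arity : ℕ
  form : (Fin arity → Tm E) → Tm E

/-- All function symbols of `L`. -/
def fnSyms (P : Coding E) : List (FnSym E) :=
  [⟨0, 0, fun _ => zero⟩, ⟨1, 1, fun a => succ (a 0)⟩, ⟨2, 2, fun a => add (a 0) (a 1)⟩,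
    ⟨3, 2, fun a => mul (a 0) (a 1)⟩, ⟨4, 1, fun a => exp (a 0)⟩] ++
  P.fns.zipIdx.map fun p => ⟨5 + p.2, p.1.1, fun a => fn p.1.2 a⟩

/-- `q` is the code of a function symbol of arity `n`. -/
def isFn (P : Coding E) (q n : Tm E) : Fml E :=
  ors ((fnSyms P).map fun f => and (eq q (num f.code)) (eq n (num f.arity)))

/-- `q` is the code of a relation symbol of `E` of arity `n`. -/
def isRel (P : Coding E) (q n : Tm E) : Fml E :=
  P.relF.subst fun i => match i with
    | 0 => q
    | 1 => n
    | _ => zero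

/-- `x` is the code of a term all whose variables have codes in the set `e`. There are a finite set
`c ∋ x` of terms and a finite set `b` of pairs (sequence, length), both closed under taking
immediate constituents. -/
def termIn (P : Coding E) (x e : Tm E) : Fml E :=
  -- c = 1, b = 0
  exs 2 (and (mem (x.lift 2) (var 1)) (and
    -- u = 0, b = 1, c = 2
    (all (imp (mem (var 0) (var 2)) (or
      (and (mem (var 0) (e.lift 3)) (ex (eq (var 1) (cVar (var 0)))))
      -- q = 2, n = 1, l = 0, u = 3, b = 4
      (exs 3 (and (isFn P (var 2) (var 1)) (and (mem (pr (var 0) (var 1)) (var 4))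
        (eq (var 3) (cFn (var 2) (var 0)))))))))
    -- p = 0, b = 1, c = 2
    (all (imp (mem (var 0) (var 1)) (or
      (eq (var 0) (pr zero zero))
      -- t = 2, l = 1, n = 0, p = 3, b = 4, c = 5
      (exs 3 (and (mem (var 2) (var 5)) (and (mem (pr (var 1) (var 0)) (var 4))
        (eq (var 3) (pr (pr (var 2) (var 1)) (succ (var 0)))))))))) ))

/-- `l` is the code of a sequence of `n` terms all whose variables have codes in `e`. -/
def listIn (P : Coding E) (l n e : Tm E) : Fml E :=
  -- b = 0
  ex (and (mem (pr (l.lift 1) (n.lift 1)) (var 0))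
    -- p = 0, b = 1
    (all (imp (mem (var 0) (var 1)) (or
      (eq (var 0) (pr zero zero))
      -- t = 2, m = 1, k = 0, p = 3, b = 4
      (exs 3 (and (termIn P (var 2) (e.lift 5)) (and (mem (pr (var 1) (var 0)) (var 4))
        (eq (var 3) (pr (pr (var 2) (var 1)) (succ (var 0)))))))))))

/-- `x` is the code of an atomic formula of `L⁺` all whose variables have codes in `e`. -/
def atomIn (P : Coding E) (x e : Tm E) : Fml E :=
  or
    (exs 2 (and (termIn P (var 1) (e.lift 2)) (and (termIn P (var 0) (e.lift 2))
      (eq (x.lift 2) (cEq (var 1) (var 0))))))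
  (or
    -- q = 2, n = 1, l = 0
    (exs 3 (and (isRel P (var 2) (var 1)) (and (listIn P (var 0) (var 1) (e.lift 3))
      (eq (x.lift 3) (cRel (var 2) (var 0))))))
  (or
    -- j = 2, n = 1, l = 0
    (exs 3 (and (listIn P (var 0) (var 1) (e.lift 3)) (eq (x.lift 3) (cP (var 2) (var 0)))))
    (eq x cEps)))

/-- `x` is the code of a formula of `L⁺` all whose free variables have codes in `e`: there is a
finite set `c ∋ ⟨x, e⟩` of such pairs that is closed under taking immediate constituents, where
below `∀ v` the set of admitted free variables becomes `e ∪ {v}`. -/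
def formIn (P : Coding E) (x e : Tm E) : Fml E :=
  -- c = 0
  ex (and (mem (pr (x.lift 1) (e.lift 1)) (var 0))
    -- u = 1, d = 0, c = 2
    (alls 2 (imp (mem (pr (var 1) (var 0)) (var 2)) (or
      (atomIn P (var 1) (var 0))
    (or
      -- y = 0, d = 1, u = 2, c = 3
      (ex (and (eq (var 2) (cNeg (var 0))) (mem (pr (var 0) (var 1)) (var 3))))
    (or
      -- y = 1, z = 0, d = 2, u = 3, c = 4
      (exs 2 (and (eq (var 3) (cOr (var 1) (var 0)))
        (and (mem (pr (var 1) (var 2)) (var 4)) (mem (pr (var 0) (var 2)) (var 4)))))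
      -- i = 2, y = 1, d' = 0, d = 3, u = 4, c = 5
      (exs 3 (and (eq (var 4) (cAll (cVar (var 2)) (var 1))) (and
        (mem (pr (var 1) (var 0)) (var 5))
        (all (iff (mem (var 0) (var 1))
          (or (mem (var 0) (var 4)) (eq (var 0) (cVar (var 3)))))))))))))))

/-- `x` is the code of a closed term. -/
def termF (P : Coding E) (x : Tm E) : Fml E := termIn P x zero

/-- `x` is the code of a sentence of `L⁺`. -/
def sentF (P : Coding E) (x : Tm E) : Fml E := formIn P x zero

/-- The result of replacing the variable with code `y` by the term with code `z` in the sequence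
or term coded by the first component of a pair is the second component; `c` and `b` are finite
sets of such pairs, for terms and for sequences, closed under taking immediate constituents. -/
def substClosed (y z c b : Tm E) : Fml E :=
  and
    -- u = 1, w = 0
    (alls 2 (imp (mem (pr (var 1) (var 0)) (c.lift 2)) (or
      (and (eq (var 1) (y.lift 2)) (eq (var 0) (z.lift 2)))
    (or
      (and (neg (eq (var 1) (y.lift 2))) (and (eq (var 0) (var 1))
        (ex (eq (var 2) (cVar (var 0))))))
      -- q = 2, l = 1, m = 0, u = 4, w = 3
      (exs 3 (and (eq (var 4) (cFn (var 2) (var 1))) (and (eq (var 3) (cFn (var 2) (var 0)))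
        (mem (pr (var 1) (var 0)) (b.lift 5)))))))))
    -- l = 1, m = 0
    (alls 2 (imp (mem (pr (var 1) (var 0)) (b.lift 2)) (or
      (and (eq (var 1) zero) (eq (var 0) zero))
      -- t = 3, t' = 2, k = 1, k' = 0, l = 5, m = 4
      (exs 4 (and (eq (var 5) (pr (var 3) (var 1))) (and (eq (var 4) (pr (var 2) (var 0)))
        (and (mem (pr (var 3) (var 2)) (c.lift 6)) (mem (pr (var 1) (var 0)) (b.lift 6)))))))))

/-- Replacing `y` by `z` in the term `x` gives `w`. -/
def substTerm (x y z w : Tm E) : Fml E :=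
  exs 2 (and (mem (pr (x.lift 2) (w.lift 2)) (var 1))
    (substClosed (y.lift 2) (z.lift 2) (var 1) (var 0)))

/-- Replacing `y` by `z` in the sequence of terms `x` gives `w`. -/
def substList (x y z w : Tm E) : Fml E :=
  exs 2 (and (mem (pr (x.lift 2) (w.lift 2)) (var 0))
    (substClosed (y.lift 2) (z.lift 2) (var 1) (var 0)))

/-- Replacing `y` by `z` in the atomic formula `x` gives `w`. -/
def substAtom (x y z w : Tm E) : Fml E :=
  or
    -- s = 3, s' = 2, t = 1, t' = 0
    (exs 4 (and (eq (x.lift 4) (cEq (var 3) (var 1))) (and (eq (w.lift 4) (cEq (var 2) (var 0)))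
      (and (substTerm (var 3) (y.lift 4) (z.lift 4) (var 2))
        (substTerm (var 1) (y.lift 4) (z.lift 4) (var 0))))))
  (or
    -- q = 2, l = 1, m = 0
    (exs 3 (and (eq (x.lift 3) (cRel (var 2) (var 1))) (and (eq (w.lift 3) (cRel (var 2) (var 0)))
      (substList (var 1) (y.lift 3) (z.lift 3) (var 0)))))
  (or
    (exs 3 (and (eq (x.lift 3) (cP (var 2) (var 1))) (and (eq (w.lift 3) (cP (var 2) (var 0)))
      (substList (var 1) (y.lift 3) (z.lift 3) (var 0)))))
    (and (eq x cEps) (eq w cEps))))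

/-- `w ≐ x[z/y]`: the number `y` is the code of a variable, `z` that of a closed term, and `w` is the
code of the result of replacing in the formula with code `x` every free occurrence of `y` by `z`. -/
def subF (P : Coding E) (x y z w : Tm E) : Fml E :=
  and (ex (eq (y.lift 1) (cVar (var 0)))) (and (termF P z)
    -- c = 0
    (ex (and (mem (pr (x.lift 1) (w.lift 1)) (var 0))
      -- u = 1, u' = 0, c = 2
      (alls 2 (imp (mem (pr (var 1) (var 0)) (var 2)) (or
        (substAtom (var 1) (y.lift 3) (z.lift 3) (var 0))
      (or
        -- a = 1, a' = 0, u = 3, u' = 2, c = 4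
        (exs 2 (and (eq (var 3) (cNeg (var 1))) (and (eq (var 2) (cNeg (var 0)))
          (mem (pr (var 1) (var 0)) (var 4)))))
      (or
        -- a = 3, a' = 2, d = 1, d' = 0, u = 5, u' = 4, c = 6
        (exs 4 (and (eq (var 5) (cOr (var 3) (var 1))) (and (eq (var 4) (cOr (var 2) (var 0)))
          (and (mem (pr (var 3) (var 2)) (var 6)) (mem (pr (var 1) (var 0)) (var 6))))))
      (or
        -- i = 2, a = 1, a' = 0, u = 4, u' = 3, c = 5
        (exs 3 (and (neg (eq (var 2) (y.lift 6))) (and (eq (var 4) (cAll (var 2) (var 1)))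
          (and (eq (var 3) (cAll (var 2) (var 0))) (mem (pr (var 1) (var 0)) (var 5))))))
        -- a = 0, u = 2, u' = 1
        (ex (and (eq (var 2) (cAll (y.lift 4) (var 0))) (eq (var 1) (var 2)))))))))))))

/-- `ḋ(x) = n`: the logical complexity of the formula with code `x` is `n`, atomic formulas having
complexity `0`. (A number that is not a negation, disjunction or quantification gets `0`.) -/
def depthF (x n : Tm E) : Fml E :=
  -- c = 0
  ex (and (mem (pr (x.lift 1) (n.lift 1)) (var 0))
    -- u = 1, m = 0, c = 2
    (alls 2 (imp (mem (pr (var 1) (var 0)) (var 2)) (or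
      (and (eq (var 0) zero) (neg (or (ex (eq (var 2) (cNeg (var 0))))
        (or (exs 2 (eq (var 3) (cOr (var 1) (var 0))))
          (exs 2 (eq (var 3) (cAll (var 1) (var 0))))))))
    (or
      -- y = 1, k = 0, u = 3, m = 2, c = 4
      (exs 2 (and (eq (var 3) (cNeg (var 1))) (and (eq (var 2) (succ (var 0)))
        (mem (pr (var 1) (var 0)) (var 4)))))
    (or
      -- y = 3, k = 2, y' = 1, k' = 0, u = 5, m = 4, c = 6
      (exs 4 (and (eq (var 5) (cOr (var 3) (var 1)))
        (and (and (mem (pr (var 3) (var 2)) (var 6)) (mem (pr (var 1) (var 0)) (var 6)))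
          (or (and (le (var 2) (var 0)) (eq (var 4) (succ (var 0))))
            (and (le (var 0) (var 2)) (eq (var 4) (succ (var 2))))))))
      -- i = 2, y = 1, k = 0, u = 4, m = 3, c = 5
      (exs 3 (and (eq (var 4) (cAll (var 2) (var 1))) (and (eq (var 3) (succ (var 0)))
        (mem (pr (var 1) (var 0)) (var 5)))))))))))

/-- `ḋ(x) ≤ k` -/
def depthLe (x k : Tm E) : Fml E := ex (and (depthF (x.lift 1) (var 0)) (le (var 0) (k.lift 1)))

/-- `v` is the value of the function symbol `f` at the arguments in the sequence coded by `m`. -/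
def applyF (f : FnSym E) (m v : Tm E) : Fml E :=
  exs f.arity (and
    (eq (m.lift f.arity) (seqTm (List.ofFn fun i : Fin f.arity => var i)))
    (eq (v.lift f.arity) (f.form fun i => var i)))

/-- `val(x, v)`: the closed term of `L` with code `x` has the value `v`. There are finite sets `c`
of pairs (term, value) and `b` of pairs (sequence of terms, sequence of their values), closed under
taking immediate constituents. -/
def valF (P : Coding E) (x v : Tm E) : Fml E :=
  -- c = 1, b = 0
  exs 2 (and (mem (pr (x.lift 2) (v.lift 2)) (var 1)) (and
    -- u = 1, w = 0, b = 2, c = 3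
    (alls 2 (imp (mem (pr (var 1) (var 0)) (var 3))
      -- l = 1, m = 0, u = 3, w = 2, b = 4, c = 5
      (ors ((fnSyms P).map fun f => exs 2 (and (eq (var 3) (cFn (num f.code) (var 1)))
        (and (mem (pr (var 1) (var 0)) (var 4)) (applyF f (var 0) (var 2))))))))
    -- l = 1, m = 0, b = 2, c = 3
    (alls 2 (imp (mem (pr (var 1) (var 0)) (var 2)) (or
      (and (eq (var 1) zero) (eq (var 0) zero))
      -- t = 3, w = 2, k = 1, k' = 0, l = 5, m = 4, b = 6, c = 7
      (exs 4 (and (eq (var 5) (pr (var 3) (var 1))) (and (eq (var 4) (pr (var 2) (var 0)))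
        (and (mem (pr (var 3) (var 2)) (var 7)) (mem (pr (var 1) (var 0)) (var 6)))))))))))

/-- `eq(r, s)`: `∀ x ∀ y (val(r, x) ∧ val(s, y) → x = y)`. -/
def eqF (P : Coding E) (r s : Tm E) : Fml E :=
  alls 2 (imp (and (valF P (r.lift 2) (var 1)) (valF P (s.lift 2) (var 0)))
    (eq (var 1) (var 0)))

/-! ### The calculus `CT*[S]` -/

/-- Initial sequents of `CT*[S]`. -/
inductive Init (P : Coding E) (S : Set (Fml E)) : Finset (Fml E) → Finset (Fml E) → Prop
  | base {Γ Δ} : BaseInit S Γ Δ → Init P S Γ Δ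
  | tr_repl {Γ Δ} (r s : Tm E) : Init P S (insert (eq r s) (insert (tr r) Γ)) (insert (tr s) Δ)
  | tr_sent {Γ Δ} (r : Tm E) : Init P S (insert (tr r) Γ) (insert (sentF P r) Δ)

/-- `Γ ⇒* Δ`: derivability by the axioms and the arithmetical rules alone. -/
def Star (P : Coding E) (S : Set (Fml E)) : Finset (Fml E) → Finset (Fml E) → Prop := LK (Init P S)

/-- `Der P S a r Γ Δ`: the sequent `Γ ⇒ Δ` has a derivation in `CT*[S]` with rank `(a, r)`, that is,
with at most `a` truth rules (`T`-cuts included) on every path, and with `m < r` for each of its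
`T`-cuts of index `m`. A term `ψ₀[t/s]` below `T` is expressed by a term `u` together with
the side formula `u ≐ ψ₀[t/s]`. -/
inductive Der (P : Coding E) (S : Set (Fml E)) :
    ℕ → ℕ → Finset (Fml E) → Finset (Fml E) → Prop
  | init {a r Γ Δ} : Init P S Γ Δ → Der P S a r Γ Δ
  -- arithmetical rules
  | allR {a r Γ Δ} (α : Fml E) : Der P S a r (liftS 1 Γ) (insert α (liftS 1 Δ)) →
      Der P S a r Γ (insert (all α) Δ)
  | allL {a r Γ Δ} (α : Fml E) (s : Tm E) : Der P S a r (insert (α.inst s) Γ) Δ →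
      Der P S a r (insert (all α) Γ) Δ
  | orR {a r Γ Δ} (α β : Fml E) : Der P S a r Γ (insert α (insert β Δ)) →
      Der P S a r Γ (insert (or α β) Δ)
  | orL {a r Γ Δ} (α β : Fml E) : Der P S a r (insert α Γ) Δ → Der P S a r (insert β Γ) Δ →
      Der P S a r (insert (or α β) Γ) Δ
  | negR {a r Γ Δ} (α : Fml E) : Der P S a r (insert α Γ) Δ → Der P S a r Γ (insert (neg α) Δ)
  | negL {a r Γ Δ} (α : Fml E) : Der P S a r Γ (insert α Δ) → Der P S a r (insert (neg α) Γ) Δ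
  | cut {a r Γ Δ} (α : Fml E) : α.Arith → Der P S a r (insert α Γ) Δ →
      Der P S a r Γ (insert α Δ) → Der P S a r Γ Δ
  -- truth rules
  | trOrR {a r Γ Δ} (ψ ψ₀ ψ₁ : Tm E) :
      Der P S a r Γ (insert (tr ψ₀) (insert (tr ψ₁) Δ)) →
      Der P S (a + 1) r (insert (sentF P ψ) (insert (eq ψ (cOr ψ₀ ψ₁)) Γ)) (insert (tr ψ) Δ)
  | trOrL {a r Γ Δ} (ψ ψ₀ ψ₁ : Tm E) :
      Der P S a r (insert (tr ψ₀) Γ) Δ → Der P S a r (insert (tr ψ₁) Γ) Δ →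
      Der P S (a + 1) r (insert (eq ψ (cOr ψ₀ ψ₁)) (insert (tr ψ) Γ)) Δ
  -- the eigenvariables are `v = var 1` and `u = var 0`
  | trAllR {a r Γ Δ} (ψ ψ₀ s : Tm E) :
      Der P S a r (insert (subF P (ψ₀.lift 2) (s.lift 2) (var 1) (var 0)) (liftS 2 Γ))
        (insert (tr (var 0)) (liftS 2 Δ)) →
      Der P S (a + 1) r (insert (sentF P ψ) (insert (eq ψ (cAll s ψ₀)) Γ)) (insert (tr ψ) Δ)
  | trAllL {a r Γ Δ} (ψ ψ₀ s t u : Tm E) :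
      Der P S a r (insert (tr u) Γ) Δ →
      Der P S (a + 1) r
        (insert (subF P ψ₀ s t u) (insert (eq ψ (cAll s ψ₀)) (insert (tr ψ) Γ))) Δ
  | trNegR {a r Γ Δ} (ψ ψ₀ : Tm E) :
      Der P S a r (insert (tr ψ₀) Γ) Δ →
      Der P S (a + 1) r (insert (sentF P ψ) (insert (eq ψ (cNeg ψ₀)) Γ)) (insert (tr ψ) Δ)
  | trNegL {a r Γ Δ} (ψ ψ₀ : Tm E) :
      Der P S a r Γ (insert (tr ψ₀) Δ) →
      Der P S (a + 1) r
        (insert (sentF P ψ) (insert (eq ψ (cNeg ψ₀)) (insert (tr ψ) Γ))) Δ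
  | trEqR {a r Γ Δ} (ψ s t : Tm E) :
      Der P S a r Γ (insert (eqF P s t) Δ) →
      Der P S (a + 1) r (insert (sentF P ψ) (insert (eq ψ (cEq s t)) Γ)) (insert (tr ψ) Δ)
  | trEqL {a r Γ Δ} (ψ s t : Tm E) :
      Der P S a r (insert (eqF P s t) Γ) Δ →
      Der P S (a + 1) r (insert (eq ψ (cEq s t)) (insert (tr ψ) Γ)) Δ
  -- bounded cuts on the truth predicate
  | trCut {a r Γ Δ} (k : ℕ) (φ : Tm E) : k < r →
      Der P S a r (insert (tr φ) Γ) Δ → Der P S a r Γ (insert (tr φ) Δ) →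
      Star P S (insert (sentF P φ) Γ) {depthLe φ (num k)} →
      Der P S (a + 1) r Γ Δ

end CompTruth

/-! Cut elimination for the theory `CT*[S]` of compositional truth over `S`, by reduction of the
truth cuts to their constituents.

**Arithmetic.** The rules for `T` are about codes, so the syntactic argument constantly needs facts
such as: `¬̇ x = y ∨̇ z` is contradictory, the components of a code are determined by it, equal codes
are codes of sentences alike, and constituents have smaller depth. None of them is derived formally.
They are verified in all models of `IΔ₀ + exp`, and the completeness of the arithmetical rules
(`completeness`, by a Henkin construction) together with `hI` makes them derivable
(`Valid.derivable`). A model of `IΔ₀ + exp` is a discretely ordered commutative semiring, because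
the semiring laws and the linearity of the order follow by bounded induction. Hence its pairing is injective
(`pair_injective`), and each finite subset `F` has the code `∑ a ∈ F, 2 ^ a`
(`exists_binary_code`). A formula, possibly nonstandard, whose depth is bounded by a standard `k` has
finitely many subformulas outside its atoms, so the existential quantifier over codes in
`ḋ(x) ≤ k` finds its witness: for standard `k` the formula means what it should
(`Str.IsModel.sat_depthLe`), and the depth decreases from a formula to its constituents and is not
raised by substitution.

**Traversal.** `RightRemoval.der` and `LeftRemoval.der` are inductions over derivations that remove
`T φ` from one side of all sequents, given what to do at the places where `T φ` is the main formula.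
Their instances are the replacement of equals below `T`, the inversion of the right truth rules,
and the reduction of a cut. On the left there is one difficulty: the arithmetical premise of a
`T`-cut on `χ` in the derivation may itself use `T φ`, and without `T φ` in the context it need no
longer be arithmetical. It still is a derivation of `ḋ(χ) ≤ k` in the calculus, so `ḋ(χ) ≤ k` is made
a hypothesis by a cut in the language of arithmetic, and then the arithmetical premise is trivial.

**Elimination.** From derivations of `Γ, T φ ⇒ Δ` and `Γ ⇒ Δ, T φ` with the bounds `a` and `b` on
the truth rules, where `ḋ(φ) ≤ r`, one obtains a derivation of `Γ ⇒ Δ` with the bound `b + 1 + 2 a`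
and `T`-cuts of index below `r` (`Der.reduce`). So the `T`-cuts of index `r` disappear at the cost
`g (a + 1) = 3 g a + 1`, which gives `g a = (3 ^ a - 1) / 2 ≤ 3 ^ a` (`Der.eliminate`). Iteration
removes all of them. In a derivation without `T`-cuts of a sequent in `L` the predicate `T` does not
occur at all, which yields the conservativity (`Der.lk_of_arith`). -/

namespace CompTruth

open Tm Fml

/-! ### Substitution -/

section Substitution

variable {E : FirstOrder.Language.{u, v}}

/-- The substitution `σ` moved below `n` quantifiers. -/
def upN (n : ℕ) (σ : ℕ → Tm E) (i : ℕ) : Tm E :=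
  if i < n then var i else (σ (i - n)).lift n

theorem Tm.subst_subst (t : Tm E) (σ τ : ℕ → Tm E) :
    (t.subst σ).subst τ = t.subst fun i => (σ i).subst τ := by
  induction t <;> simp_all [Tm.subst]

theorem Tm.subst_var (t : Tm E) : t.subst var = t := by
  induction t <;> simp_all [Tm.subst]

theorem Tm.lift_zero (t : Tm E) : t.lift 0 = t := Tm.subst_var t

theorem Tm.lift_lift (t : Tm E) (m n : ℕ) : (t.lift m).lift n = t.lift (m + n) := by
  simp [Tm.lift, Tm.subst_subst, Tm.subst, add_assoc]

theorem upSubst_eq_upN (σ : ℕ → Tm E) : upSubst σ = upN 1 σ := by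
  funext i
  cases i <;> simp [upSubst, upN]

theorem upN_zero (σ : ℕ → Tm E) : upN 0 σ = σ := by
  funext i
  simp [upN, Tm.lift_zero]

theorem upN_upN (m n : ℕ) (σ : ℕ → Tm E) : upN m (upN n σ) = upN (m + n) σ := by
  funext i
  by_cases h : i < m
  · simp [upN, h, Nat.lt_add_right n h]
  · by_cases h' : i - m < n
    · have h1 : i < m + n := by omega
      have h2 : i - m + m = i := by omega
      simp [upN, h, h', h1, h2, Tm.lift, Tm.subst]
    · have h1 : ¬ i < m + n := by omega
      have h2 : i - m - n = i - (m + n) := by omega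
      simp [upN, h, h', h1, h2, Tm.lift_lift, add_comm]

theorem Tm.lift_subst_upN (t : Tm E) (n : ℕ) (σ : ℕ → Tm E) :
    (t.lift n).subst (upN n σ) = (t.subst σ).lift n := by
  simp [Tm.lift, Tm.subst_subst, Tm.subst, upN]

theorem upN_var (n : ℕ) : upN n (var : ℕ → Tm E) = var := by
  funext i
  by_cases h : i < n
  · simp [upN, h]
  · simp [upN, h, Tm.lift, Tm.subst, Nat.sub_add_cancel (not_lt.1 h)]

theorem upN_comp (n : ℕ) (σ τ : ℕ → Tm E) :
    (fun i => (upN n σ i).subst (upN n τ)) = upN n fun i => (σ i).subst τ := by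
  funext i
  by_cases h : i < n
  · simp [upN, h, Tm.subst]
  · simp only [upN, h, if_false]
    exact Tm.lift_subst_upN _ _ _

theorem Fml.subst_subst (φ : Fml E) (σ τ : ℕ → Tm E) :
    (φ.subst σ).subst τ = φ.subst fun i => (σ i).subst τ := by
  induction φ generalizing σ τ <;>
    simp_all [Fml.subst, Tm.subst_subst, upSubst_eq_upN, upN_comp]

theorem Fml.subst_var (φ : Fml E) : φ.subst var = φ := by
  induction φ <;> simp_all [Fml.subst, Tm.subst_var, upSubst_eq_upN, upN_var]

theorem Fml.lift_subst_upN (φ : Fml E) (n : ℕ) (σ : ℕ → Tm E) :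
    (φ.lift n).subst (upN n σ) = (φ.subst σ).lift n := by
  simp [Fml.lift, Fml.subst_subst, Tm.subst, Tm.lift, upN]

theorem Fml.inst_subst (φ : Fml E) (s : Tm E) (σ : ℕ → Tm E) :
    (φ.inst s).subst σ = (φ.subst (upN 1 σ)).inst (s.subst σ) := by
  simp only [Fml.inst, Fml.subst_subst]
  congr 1
  funext i
  cases i with
  | zero => simp [upN, Tm.subst]
  | succ j => simp [upN, Tm.subst, Tm.lift, Tm.subst_subst, Tm.subst_var]

theorem Fml.subst_arith {φ : Fml E} (σ : ℕ → Tm E) : (φ.subst σ).Arith ↔ φ.Arith := by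
  induction φ generalizing σ <;> simp_all [Fml.subst, Fml.Arith]

theorem Tm.num_subst (k : ℕ) (σ : ℕ → Tm E) : (num k).subst σ = num k := by
  induction k <;> simp_all [num, Tm.subst]

/-! Substitution commutes with all operations that build formulas. -/

theorem Fml.and_subst (φ ψ : Fml E) (σ) : (and φ ψ).subst σ = and (φ.subst σ) (ψ.subst σ) := rfl
theorem Fml.imp_subst (φ ψ : Fml E) (σ) : (imp φ ψ).subst σ = imp (φ.subst σ) (ψ.subst σ) := rfl
theorem Fml.iff_subst (φ ψ : Fml E) (σ) : (iff φ ψ).subst σ = iff (φ.subst σ) (ψ.subst σ) := rfl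
theorem Fml.all_subst (φ : Fml E) (σ) : (all φ).subst σ = all (φ.subst (upN 1 σ)) := by
  simp [Fml.subst, upSubst_eq_upN]

theorem Fml.ex_subst (φ : Fml E) (σ) : (ex φ).subst σ = ex (φ.subst (upN 1 σ)) := by
  simp [ex, Fml.subst, upSubst_eq_upN]

theorem Fml.exs_subst (n : ℕ) (φ : Fml E) (σ) :
    (exs n φ).subst σ = exs n (φ.subst (upN n σ)) := by
  induction n generalizing σ with
  | zero => simp [exs, upN_zero]
  | succ n ih => simp [exs, ex_subst, ih, upN_upN]

theorem Fml.alls_subst (n : ℕ) (φ : Fml E) (σ) :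
    (alls n φ).subst σ = alls n (φ.subst (upN n σ)) := by
  induction n generalizing σ with
  | zero => simp [alls, upN_zero]
  | succ n ih => simp [alls, all_subst, ih, upN_upN]

theorem Fml.ors_subst (l : List (Fml E)) (σ) :
    (ors l).subst σ = ors (l.map fun φ => φ.subst σ) := by
  induction l with
  | nil => rfl
  | cons φ l ih => simp [ors, Fml.subst, ih]

theorem Fml.eq_subst (s t : Tm E) (σ) : (eq s t).subst σ = eq (s.subst σ) (t.subst σ) := rfl
theorem Fml.or_subst (φ ψ : Fml E) (σ) : (or φ ψ).subst σ = or (φ.subst σ) (ψ.subst σ) := rfl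
theorem Fml.neg_subst (φ : Fml E) (σ) : (neg φ).subst σ = neg (φ.subst σ) := rfl

theorem Fml.le_subst (s t : Tm E) (σ) : (le s t).subst σ = le (s.subst σ) (t.subst σ) := by
  simp [le, ex_subst, eq_subst, Tm.subst, Tm.lift_subst_upN, upN]

theorem Fml.lt_subst (s t : Tm E) (σ) : (lt s t).subst σ = lt (s.subst σ) (t.subst σ) :=
  le_subst _ _ _

theorem pr_subst (s t : Tm E) (σ) : (pr s t).subst σ = pr (s.subst σ) (t.subst σ) := rfl

theorem cVar_subst (s : Tm E) (σ) : (cVar s).subst σ = cVar (s.subst σ) := by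
  simp [cVar, pr_subst, Tm.num_subst]
theorem cFn_subst (s t : Tm E) (σ) : (cFn s t).subst σ = cFn (s.subst σ) (t.subst σ) := by
  simp [cFn, pr_subst, Tm.num_subst]
theorem cEq_subst (s t : Tm E) (σ) : (cEq s t).subst σ = cEq (s.subst σ) (t.subst σ) := by
  simp [cEq, pr_subst, Tm.num_subst]
theorem cRel_subst (s t : Tm E) (σ) : (cRel s t).subst σ = cRel (s.subst σ) (t.subst σ) := by
  simp [cRel, pr_subst, Tm.num_subst]
theorem cP_subst (s t : Tm E) (σ) : (cP s t).subst σ = cP (s.subst σ) (t.subst σ) := by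
  simp [cP, pr_subst, Tm.num_subst]
theorem cEps_subst (σ : ℕ → Tm E) : (cEps : Tm E).subst σ = cEps := by
  simp [cEps, pr_subst, Tm.num_subst, Tm.subst]
theorem cOr_subst (s t : Tm E) (σ) : (cOr s t).subst σ = cOr (s.subst σ) (t.subst σ) := by
  simp [cOr, pr_subst, Tm.num_subst]
theorem cNeg_subst (s : Tm E) (σ) : (cNeg s).subst σ = cNeg (s.subst σ) := by
  simp [cNeg, pr_subst, Tm.num_subst]
theorem cAll_subst (s t : Tm E) (σ) : (cAll s t).subst σ = cAll (s.subst σ) (t.subst σ) := by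
  simp [cAll, pr_subst, Tm.num_subst]

theorem Tm.subst_var_idx (i : ℕ) (σ : ℕ → Tm E) : (var i).subst σ = σ i := rfl
theorem Tm.subst_zero (σ : ℕ → Tm E) : (zero : Tm E).subst σ = zero := rfl
theorem Tm.subst_succ (t : Tm E) (σ : ℕ → Tm E) : (succ t).subst σ = succ (t.subst σ) := rfl
theorem Tm.subst_add (s t : Tm E) (σ) : (add s t).subst σ = add (s.subst σ) (t.subst σ) := rfl
theorem Tm.subst_mul (s t : Tm E) (σ) : (mul s t).subst σ = mul (s.subst σ) (t.subst σ) := rfl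
theorem Tm.subst_exp (t : Tm E) (σ) : (exp t).subst σ = exp (t.subst σ) := rfl

theorem upN_of_lt {i n : ℕ} (σ : ℕ → Tm E) (h : i < n) : upN n σ i = var i := by simp [upN, h]

theorem mem_subst (s t : Tm E) (σ) : (mem s t).subst σ = mem (s.subst σ) (t.subst σ) := by
  simp [mem, exs_subst, and_subst, eq_subst, lt_subst, Tm.lift_subst_upN, Tm.subst_var_idx,
    Tm.subst_add, Tm.subst_mul, Tm.subst_exp, Tm.subst_succ, upN_of_lt]

theorem isFn_subst (P : Coding E) (q n : Tm E) (σ) :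
    (isFn P q n).subst σ = isFn P (q.subst σ) (n.subst σ) := by
  simp [isFn, ors_subst, and_subst, eq_subst, Tm.num_subst, Function.comp_def]

theorem isRel_subst (P : Coding E) (q n : Tm E) (σ) :
    (isRel P q n).subst σ = isRel P (q.subst σ) (n.subst σ) := by
  simp only [isRel, Fml.subst_subst]
  congr 1
  funext i
  rcases i with _ | _ | i <;> rfl

theorem termIn_subst (P : Coding E) (x e : Tm E) (σ) :
    (termIn P x e).subst σ = termIn P (x.subst σ) (e.subst σ) := by
  simp [termIn, exs_subst, ex_subst, all_subst, and_subst, imp_subst, or_subst, eq_subst,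
    mem_subst, isFn_subst, pr_subst, cVar_subst, cFn_subst, Tm.lift_subst_upN, Tm.subst_var_idx,
    Tm.subst_succ, Tm.subst_zero, upN_of_lt, upN_upN]

theorem listIn_subst (P : Coding E) (l n e : Tm E) (σ) :
    (listIn P l n e).subst σ = listIn P (l.subst σ) (n.subst σ) (e.subst σ) := by
  simp [listIn, exs_subst, ex_subst, all_subst, and_subst, imp_subst, or_subst, eq_subst,
    mem_subst, termIn_subst, pr_subst, Tm.lift_subst_upN, Tm.subst_var_idx,
    Tm.subst_succ, Tm.subst_zero, upN_of_lt, upN_upN]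

theorem atomIn_subst (P : Coding E) (x e : Tm E) (σ) :
    (atomIn P x e).subst σ = atomIn P (x.subst σ) (e.subst σ) := by
  simp [atomIn, exs_subst, and_subst, or_subst, eq_subst, termIn_subst, listIn_subst, isRel_subst,
    cEq_subst, cRel_subst, cP_subst, cEps_subst, Tm.lift_subst_upN, Tm.subst_var_idx, upN_of_lt]

theorem formIn_subst (P : Coding E) (x e : Tm E) (σ) :
    (formIn P x e).subst σ = formIn P (x.subst σ) (e.subst σ) := by
  simp [formIn, exs_subst, alls_subst, ex_subst, all_subst, and_subst, imp_subst, iff_subst,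
    or_subst, eq_subst, mem_subst, atomIn_subst, pr_subst, cNeg_subst, cOr_subst, cAll_subst,
    cVar_subst, Tm.lift_subst_upN, Tm.subst_var_idx, upN_of_lt, upN_upN]

theorem sentF_subst (P : Coding E) (x : Tm E) (σ) :
    (sentF P x).subst σ = sentF P (x.subst σ) := formIn_subst P x zero σ

theorem substClosed_subst (y z c b : Tm E) (σ) : (substClosed y z c b).subst σ =
    substClosed (y.subst σ) (z.subst σ) (c.subst σ) (b.subst σ) := by
  simp [substClosed, exs_subst, alls_subst, ex_subst, and_subst, imp_subst, neg_subst,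
    or_subst, eq_subst, mem_subst, pr_subst, cFn_subst, cVar_subst, Tm.lift_subst_upN,
    Tm.subst_var_idx, Tm.subst_zero, upN_of_lt, upN_upN]

theorem substTerm_subst (x y z w : Tm E) (σ) : (substTerm x y z w).subst σ =
    substTerm (x.subst σ) (y.subst σ) (z.subst σ) (w.subst σ) := by
  simp [substTerm, exs_subst, and_subst, mem_subst, pr_subst, substClosed_subst,
    Tm.lift_subst_upN, Tm.subst_var_idx, upN_of_lt]

theorem substList_subst (x y z w : Tm E) (σ) : (substList x y z w).subst σ =
    substList (x.subst σ) (y.subst σ) (z.subst σ) (w.subst σ) := by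
  simp [substList, exs_subst, and_subst, mem_subst, pr_subst, substClosed_subst,
    Tm.lift_subst_upN, Tm.subst_var_idx, upN_of_lt]

theorem substAtom_subst (x y z w : Tm E) (σ) : (substAtom x y z w).subst σ =
    substAtom (x.subst σ) (y.subst σ) (z.subst σ) (w.subst σ) := by
  simp [substAtom, exs_subst, and_subst, or_subst, eq_subst, substTerm_subst, substList_subst,
    cEq_subst, cRel_subst, cP_subst, cEps_subst, Tm.lift_subst_upN, Tm.subst_var_idx, upN_of_lt]

theorem subF_subst (P : Coding E) (x y z w : Tm E) (σ) : (subF P x y z w).subst σ =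
    subF P (x.subst σ) (y.subst σ) (z.subst σ) (w.subst σ) := by
  simp [subF, termF, exs_subst, alls_subst, ex_subst, and_subst, imp_subst, neg_subst,
    or_subst, eq_subst, mem_subst, termIn_subst, substAtom_subst, pr_subst, cNeg_subst, cOr_subst,
    cAll_subst, cVar_subst, Tm.lift_subst_upN, Tm.subst_var_idx, Tm.subst_zero, upN_of_lt, upN_upN]

theorem depthF_subst (x n : Tm E) (σ) :
    (depthF x n).subst σ = depthF (x.subst σ) (n.subst σ) := by
  simp [depthF, exs_subst, alls_subst, ex_subst, and_subst, imp_subst, neg_subst,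
    or_subst, eq_subst, le_subst, mem_subst, pr_subst, cNeg_subst, cOr_subst, cAll_subst,
    Tm.lift_subst_upN, Tm.subst_var_idx, Tm.subst_zero, Tm.subst_succ, upN_of_lt, upN_upN]

theorem depthLe_subst (x k : Tm E) (σ) :
    (depthLe x k).subst σ = depthLe (x.subst σ) (k.subst σ) := by
  simp [depthLe, ex_subst, and_subst, le_subst, depthF_subst, Tm.lift_subst_upN,
    Tm.subst_var_idx, upN_of_lt]

theorem seqTm_subst (l : List (Tm E)) (σ) :
    (seqTm l).subst σ = seqTm (l.map fun t => t.subst σ) := by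
  induction l with
  | nil => rfl
  | cons t l ih => simp [seqTm, pr_subst, ih]

theorem form_subst {P : Coding E} {f : FnSym E} (hf : f ∈ fnSyms P) (a : Fin f.arity → Tm E)
    (σ) : (f.form a).subst σ = f.form fun i => (a i).subst σ := by
  simp only [fnSyms, List.mem_append, List.mem_cons, List.not_mem_nil, or_false,
    List.mem_map] at hf
  rcases hf with (rfl | rfl | rfl | rfl | rfl) | ⟨p, -, rfl⟩ <;> rfl

theorem applyF_subst {P : Coding E} {f : FnSym E} (hf : f ∈ fnSyms P) (m w : Tm E) (σ) :
    (applyF f m w).subst σ = applyF f (m.subst σ) (w.subst σ) := by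
  simp [applyF, exs_subst, and_subst, eq_subst, seqTm_subst, form_subst hf, Tm.lift_subst_upN,
    Tm.subst_var_idx, upN_of_lt, List.map_ofFn, Function.comp_def]

theorem valF_subst (P : Coding E) (x w : Tm E) (σ) :
    (valF P x w).subst σ = valF P (x.subst σ) (w.subst σ) := by
  have h : ∀ τ : ℕ → Tm E, (ors ((fnSyms P).map fun f =>
      exs 2 (and (eq (var 3) (cFn (num f.code) (var 1)))
        (and (mem (pr (var 1) (var 0)) (var 4)) (applyF f (var 0) (var 2)))))).subst (upN 4 τ) =
      ors ((fnSyms P).map fun f => exs 2 (and (eq (var 3) (cFn (num f.code) (var 1)))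
        (and (mem (pr (var 1) (var 0)) (var 4)) (applyF f (var 0) (var 2))))) := by
    intro τ
    rw [ors_subst, List.map_map]
    congr 1
    refine List.map_congr_left fun f hf => ?_
    simp [exs_subst, and_subst, eq_subst, mem_subst, applyF_subst hf, cFn_subst, pr_subst,
      Tm.num_subst, Tm.subst_var_idx, upN_of_lt, upN_upN]
  simp [valF, h, exs_subst, alls_subst, and_subst, imp_subst,
    or_subst, eq_subst, mem_subst, pr_subst,
    Tm.lift_subst_upN, Tm.subst_var_idx, Tm.subst_zero, upN_of_lt, upN_upN]

theorem eqF_subst (P : Coding E) (r s : Tm E) (σ) :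
    (eqF P r s).subst σ = eqF P (r.subst σ) (s.subst σ) := by
  simp [eqF, alls_subst, imp_subst, and_subst, eq_subst, valF_subst, Tm.lift_subst_upN,
    Tm.subst_var_idx, upN_of_lt]

end Substitution

/-! ### Structural properties of the arithmetical rules -/

section Structural

variable {E : FirstOrder.Language.{u, v}} {S : Set (Fml E)}

/-- All formulas of a finite set after the substitution `σ`. -/
noncomputable def substS (σ : ℕ → Tm E) (Γ : Finset (Fml E)) : Finset (Fml E) :=
  Γ.image (Fml.subst σ)

theorem substS_insert (σ : ℕ → Tm E) (φ : Fml E) (Γ) :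
    substS σ (insert φ Γ) = insert (φ.subst σ) (substS σ Γ) := Finset.image_insert _ _ _

theorem substS_singleton (σ : ℕ → Tm E) (φ : Fml E) : substS σ {φ} = {φ.subst σ} :=
  Finset.image_singleton _ _

theorem liftS_substS (k : ℕ) (σ : ℕ → Tm E) (Γ) :
    substS (upN k σ) (liftS k Γ) = liftS k (substS σ Γ) := by
  simp [substS, liftS, Finset.image_image, Function.comp_def, Fml.lift_subst_upN]

theorem substS_substS (σ τ : ℕ → Tm E) (Γ) :
    substS τ (substS σ Γ) = substS (fun i => (σ i).subst τ) Γ := by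
  simp [substS, Finset.image_image, Function.comp_def, Fml.subst_subst]

theorem substS_var (Γ : Finset (Fml E)) : substS var Γ = Γ := by
  have : Fml.subst (var : ℕ → Tm E) = id := funext Fml.subst_var
  simp [substS, this]

theorem liftS_eq_substS (k : ℕ) (Γ : Finset (Fml E)) :
    liftS k Γ = substS (fun i => var (i + k)) Γ := rfl

theorem liftS_insert (k : ℕ) (φ : Fml E) (Γ) :
    liftS k (insert φ Γ) = insert (φ.lift k) (liftS k Γ) := Finset.image_insert _ _ _

theorem liftS_mono {k : ℕ} {Γ Γ' : Finset (Fml E)} (h : Γ ⊆ Γ') :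
    liftS k Γ ⊆ liftS k Γ' := Finset.image_subset_image h

theorem LK.mono {I J : Finset (Fml E) → Finset (Fml E) → Prop} (h : ∀ Γ Δ, I Γ Δ → J Γ Δ)
    {Γ Δ} (d : LK I Γ Δ) : LK J Γ Δ := by
  induction d with
  | init hi => exact .init (h _ _ hi)
  | allR α _ ih => exact .allR α ih
  | allL α s _ ih => exact .allL α s ih
  | orR α β _ ih => exact .orR α β ih
  | orL α β _ _ ih ih' => exact .orL α β ih ih'
  | negR α _ ih => exact .negR α ih
  | negL α _ ih => exact .negL α ih
  | cut α hα _ _ ih ih' => exact .cut α hα ih ih'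

/-- Weakening holds for the arithmetical rules if it holds for the initial sequents. -/
theorem LK.weaken {I : Finset (Fml E) → Finset (Fml E) → Prop}
    (hI : ∀ Γ Δ Γ' Δ', I Γ Δ → Γ ⊆ Γ' → Δ ⊆ Δ' → I Γ' Δ')
    {Γ Δ Γ' Δ'} (d : LK I Γ Δ) (hΓ : Γ ⊆ Γ') (hΔ : Δ ⊆ Δ') : LK I Γ' Δ' := by
  induction d generalizing Γ' Δ' with
  | init hi => exact .init (hI _ _ _ _ hi hΓ hΔ)
  | allR α _ ih =>
    obtain ⟨hm, hΔ⟩ := Finset.insert_subset_iff.1 hΔ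
    rw [← Finset.insert_eq_of_mem hm]
    exact .allR α (ih (liftS_mono hΓ) (Finset.insert_subset_insert _ (liftS_mono hΔ)))
  | allL α s _ ih =>
    obtain ⟨hm, hΓ⟩ := Finset.insert_subset_iff.1 hΓ
    rw [← Finset.insert_eq_of_mem hm]
    exact .allL α s (ih (Finset.insert_subset_insert _ hΓ) hΔ)
  | orR α β _ ih =>
    obtain ⟨hm, hΔ⟩ := Finset.insert_subset_iff.1 hΔ
    rw [← Finset.insert_eq_of_mem hm]
    exact .orR α β (ih hΓ (Finset.insert_subset_insert _ (Finset.insert_subset_insert _ hΔ)))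
  | orL α β _ _ ih ih' =>
    obtain ⟨hm, hΓ⟩ := Finset.insert_subset_iff.1 hΓ
    rw [← Finset.insert_eq_of_mem hm]
    exact .orL α β (ih (Finset.insert_subset_insert _ hΓ) hΔ)
      (ih' (Finset.insert_subset_insert _ hΓ) hΔ)
  | negR α _ ih =>
    obtain ⟨hm, hΔ⟩ := Finset.insert_subset_iff.1 hΔ
    rw [← Finset.insert_eq_of_mem hm]
    exact .negR α (ih (Finset.insert_subset_insert _ hΓ) hΔ)
  | negL α _ ih =>
    obtain ⟨hm, hΓ⟩ := Finset.insert_subset_iff.1 hΓ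
    rw [← Finset.insert_eq_of_mem hm]
    exact .negL α (ih hΓ (Finset.insert_subset_insert _ hΔ))
  | cut α hα _ _ ih ih' =>
    exact .cut α hα (ih (Finset.insert_subset_insert _ hΓ) hΔ)
      (ih' hΓ (Finset.insert_subset_insert _ hΔ))

/-- Substitution holds for the arithmetical rules if it holds for the initial sequents. -/
theorem LK.subst {I : Finset (Fml E) → Finset (Fml E) → Prop}
    (hI : ∀ Γ Δ σ, I Γ Δ → I (substS σ Γ) (substS σ Δ))
    {Γ Δ} (d : LK I Γ Δ) (σ : ℕ → Tm E) : LK I (substS σ Γ) (substS σ Δ) := by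
  induction d generalizing σ with
  | init hi => exact .init (hI _ _ _ hi)
  | allR α _ ih =>
    rw [substS_insert, all_subst]
    refine .allR _ ?_
    simpa only [substS_insert, liftS_substS] using ih (upN 1 σ)
  | allL α s _ ih =>
    rw [substS_insert, all_subst]
    refine .allL _ (s.subst σ) ?_
    simpa only [substS_insert, inst_subst] using ih σ
  | orR α β _ ih =>
    rw [substS_insert, or_subst]
    refine .orR _ _ ?_
    simpa only [substS_insert] using ih σ
  | orL α β _ _ ih ih' =>
    rw [substS_insert, or_subst]
    refine .orL _ _ ?_ ?_
    · simpa only [substS_insert] using ih σ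
    · simpa only [substS_insert] using ih' σ
  | negR α _ ih =>
    rw [substS_insert, neg_subst]
    refine .negR _ ?_
    simpa only [substS_insert] using ih σ
  | negL α _ ih =>
    rw [substS_insert, neg_subst]
    refine .negL _ ?_
    simpa only [substS_insert] using ih σ
  | cut α hα _ _ ih ih' =>
    refine .cut (α.subst σ) ((subst_arith σ).2 hα) ?_ ?_
    · simpa only [substS_insert] using ih σ
    · simpa only [substS_insert] using ih' σ

theorem BaseInit.weaken {Γ Δ Γ' Δ'} (h : BaseInit S Γ Δ) (hΓ : Γ ⊆ Γ') (hΔ : Δ ⊆ Δ') :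
    BaseInit S Γ' Δ' := by
  cases h with
  | ax φ hφ =>
    rw [← Finset.insert_eq_of_mem (Finset.insert_subset_iff.1 hΔ).1]
    exact .ax φ hφ
  | id α hα =>
    rw [← Finset.insert_eq_of_mem (Finset.insert_subset_iff.1 hΔ).1,
      ← Finset.insert_eq_of_mem (Finset.insert_subset_iff.1 hΓ).1]
    exact .id α hα
  | refl t =>
    rw [← Finset.insert_eq_of_mem (Finset.insert_subset_iff.1 hΔ).1]
    exact .refl t
  | repl α r s hα =>
    obtain ⟨h1, h2⟩ := Finset.insert_subset_iff.1 hΓ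
    rw [← Finset.insert_eq_of_mem (Finset.insert_subset_iff.1 hΔ).1,
      ← Finset.insert_eq_of_mem h1,
      ← Finset.insert_eq_of_mem (Finset.insert_subset_iff.1 h2).1]
    exact .repl α r s hα

theorem BaseInit.subst (hS : ∀ φ ∈ S, φ.Closed) {Γ Δ} (σ : ℕ → Tm E) (h : BaseInit S Γ Δ) :
    BaseInit S (substS σ Γ) (substS σ Δ) := by
  cases h with
  | ax φ hφ =>
    rw [substS_insert, hS φ hφ σ]
    exact .ax φ hφ
  | id α hα =>
    rw [substS_insert, substS_insert]
    exact .id _ ((subst_arith σ).2 hα)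
  | refl t =>
    rw [substS_insert]
    exact .refl _
  | repl α r s hα =>
    simp only [substS_insert, inst_subst]
    exact .repl _ _ _ ((subst_arith _).2 hα)

end Structural

/-! ### Structures and completeness of the arithmetical rules -/

section Semantics

variable {E : FirstOrder.Language.{u, v}}

/-- Structures for the language `L`. -/
structure Str (E : FirstOrder.Language.{u, v}) (M : Type*) where
  zero : M
  succ : M → M
  add : M → M → M
  mul : M → M → M
  exp : M → M
  fn {n : ℕ} : E.Functions n → (Fin n → M) → M
  rel {n : ℕ} : E.Relations n → (Fin n → M) → Prop

/-- The valuation `e` moved up by one, with the new value `m` for variable `0`. -/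
def cons {M : Type*} (m : M) (e : ℕ → M) : ℕ → M
  | 0 => m
  | i + 1 => e i

namespace Str

variable {M : Type*} (A : Str E M)

/-- The value of a term. -/
def val (e : ℕ → M) : Tm E → M
  | .var i => e i
  | .zero => A.zero
  | .succ t => A.succ (val e t)
  | .add s t => A.add (val e s) (val e t)
  | .mul s t => A.mul (val e s) (val e t)
  | .exp t => A.exp (val e t)
  | .fn f ts => A.fn f fun i => val e (ts i)

/-- Satisfaction. It is meant for formulas of `L` only; formulas `T t` count as false. -/
def Sat : (ℕ → M) → Fml E → Prop
  | e, .eq s t => A.val e s = A.val e t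
  | e, .rel R ts => A.rel R fun i => A.val e (ts i)
  | _, .tr _ => False
  | e, .neg φ => ¬ Sat e φ
  | e, .or φ ψ => Sat e φ ∨ Sat e ψ
  | e, .all φ => ∀ m, Sat (cons m e) φ

theorem val_subst (e : ℕ → M) (t : Tm E) (σ : ℕ → Tm E) :
    A.val e (t.subst σ) = A.val (fun i => A.val e (σ i)) t := by
  induction t <;> simp_all [Tm.subst, val]

theorem val_lift_one (m : M) (e : ℕ → M) (t : Tm E) :
    A.val (cons m e) (t.lift 1) = A.val e t := by
  rw [Tm.lift, val_subst]
  rfl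

theorem val_upN_one (m : M) (e : ℕ → M) (σ : ℕ → Tm E) :
    (fun i => A.val (cons m e) (upN 1 σ i)) = cons m fun i => A.val e (σ i) := by
  funext i
  cases i with
  | zero => rfl
  | succ j =>
    simp only [upN, Nat.not_lt.2 (Nat.le_add_left 1 j), if_false, Nat.add_sub_cancel]
    exact A.val_lift_one m e _

theorem sat_subst (e : ℕ → M) (φ : Fml E) (σ : ℕ → Tm E) :
    A.Sat e (φ.subst σ) ↔ A.Sat (fun i => A.val e (σ i)) φ := by
  induction φ generalizing e σ <;>
    simp_all [Fml.subst, Sat, val_subst, upSubst_eq_upN, val_upN_one]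

end Str

/-- The formula `φ` has only free variables below `N`. -/
def Fml.BoundedBy (N : ℕ) (φ : Fml E) : Prop :=
  ∀ σ τ : ℕ → Tm E, (∀ i < N, σ i = τ i) → φ.subst σ = φ.subst τ

theorem Tm.exists_boundedBy (t : Tm E) :
    ∃ N, ∀ σ τ : ℕ → Tm E, (∀ i < N, σ i = τ i) → t.subst σ = t.subst τ := by
  induction t with
  | var i => exact ⟨i + 1, fun σ τ h => h i i.lt_succ_self⟩
  | zero => exact ⟨0, fun _ _ _ => rfl⟩
  | succ t ih | exp t ih =>
    obtain ⟨N, hN⟩ := ih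
    exact ⟨N, fun σ τ h => by simp [Tm.subst, hN σ τ h]⟩
  | add s t ih ih' | mul s t ih ih' =>
    obtain ⟨N, hN⟩ := ih
    obtain ⟨N', hN'⟩ := ih'
    exact ⟨max N N', fun σ τ h => by
      simp [Tm.subst, hN σ τ fun i hi => h i (lt_max_of_lt_left hi),
        hN' σ τ fun i hi => h i (lt_max_of_lt_right hi)]⟩
  | fn f ts ih =>
    choose N hN using ih
    refine ⟨Finset.univ.sup N, fun σ τ h => ?_⟩
    simp only [Tm.subst]
    congr 1
    funext i
    exact hN i σ τ fun j hj => h j (hj.trans_le (Finset.le_sup (Finset.mem_univ i)))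

theorem Fml.BoundedBy.mono {N N' : ℕ} (hN : N ≤ N') {φ : Fml E} (h : φ.BoundedBy N) :
    φ.BoundedBy N' := fun σ τ hστ => h σ τ fun i hi => hστ i (hi.trans_le hN)

theorem Fml.exists_boundedBy (φ : Fml E) : ∃ N, φ.BoundedBy N := by
  induction φ with
  | eq s t =>
    obtain ⟨N, hN⟩ := s.exists_boundedBy
    obtain ⟨N', hN'⟩ := t.exists_boundedBy
    exact ⟨max N N', fun σ τ h => by
      simp [Fml.subst, hN σ τ fun i hi => h i (lt_max_of_lt_left hi),
        hN' σ τ fun i hi => h i (lt_max_of_lt_right hi)]⟩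
  | rel R ts =>
    choose N hN using fun i => (ts i).exists_boundedBy
    refine ⟨Finset.univ.sup N, fun σ τ h => ?_⟩
    simp only [Fml.subst]
    congr 1
    funext i
    exact hN i σ τ fun j hj => h j (hj.trans_le (Finset.le_sup (Finset.mem_univ i)))
  | tr t =>
    obtain ⟨N, hN⟩ := t.exists_boundedBy
    exact ⟨N, fun σ τ h => by simp [Fml.subst, hN σ τ h]⟩
  | neg φ ih =>
    obtain ⟨N, hN⟩ := ih
    exact ⟨N, fun σ τ h => by simp [Fml.subst, hN σ τ h]⟩
  | or φ ψ ih ih' =>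
    obtain ⟨N, hN⟩ := ih
    obtain ⟨N', hN'⟩ := ih'
    exact ⟨max N N', fun σ τ h => by
      simp [Fml.subst, hN.mono (le_max_left N N') σ τ h, hN'.mono (le_max_right N N') σ τ h]⟩
  | all φ ih =>
    obtain ⟨N, hN⟩ := ih
    refine ⟨N, fun σ τ h => ?_⟩
    rw [all_subst, all_subst, hN (upN 1 σ) (upN 1 τ)]
    intro i hi
    by_cases h0 : i < 1
    · simp [upN, h0]
    · simp [upN, h0, h (i - 1) (by omega)]

theorem exists_boundedBy_finset (Γ : Finset (Fml E)) : ∃ N, ∀ φ ∈ Γ, φ.BoundedBy N := by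
  choose N hN using fun φ : Fml E => φ.exists_boundedBy
  exact ⟨Γ.sup N, fun φ hφ => (hN φ).mono (Finset.le_sup hφ)⟩

section Completeness

variable {S : Set (Fml E)}

/-- The right rule for `∀` with a named eigenvariable `y`, which does not occur in the conclusion. -/
theorem LK.all_of_fresh (hS : ∀ φ ∈ S, φ.Closed) {Γ Δ : Finset (Fml E)} {α : Fml E} {y : ℕ}
    (hΓ : ∀ φ ∈ Γ, φ.BoundedBy y) (hΔ : ∀ φ ∈ Δ, φ.BoundedBy y) (hα : α.BoundedBy y)
    (d : LK (BaseInit S) Γ (insert (α.inst (var y)) Δ)) :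
    LK (BaseInit S) Γ (insert (all α) Δ) := by
  -- rename `y` to `0` and make room for it
  let σ : ℕ → Tm E := fun i => if i = y then var 0 else var (i + 1)
  have hσ : ∀ Θ : Finset (Fml E), (∀ φ ∈ Θ, φ.BoundedBy y) → substS σ Θ = liftS 1 Θ := by
    intro Θ hΘ
    refine Finset.image_congr fun φ hφ => hΘ φ hφ _ _ fun i hi => ?_
    simp [σ, hi.ne]
  have hασ : (α.inst (var y)).subst σ = α := by
    rw [inst, Fml.subst_subst]
    refine (hα _ var fun i hi => ?_).trans α.subst_var
    cases i with
    | zero => simp [Tm.subst, σ]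
    | succ j => simp [Tm.subst, σ, show j ≠ y by omega]
  refine .allR α ?_
  have := d.subst (fun _ _ σ => BaseInit.subst hS σ) σ
  rwa [substS_insert, hσ Γ hΓ, hσ Δ hΔ, hασ] at this

/-- A sequent without derivation can be extended so as to decide the formula `φ`, with a witness if
`φ` is a refuted universal formula. -/
theorem exists_decide (hS : ∀ φ ∈ S, φ.Closed) {Γ Δ : Finset (Fml E)}
    (h : ¬ LK (BaseInit S) Γ Δ) (φ : Fml E) (hφ : φ.Arith) :
    ∃ Γ' Δ', ¬ LK (BaseInit S) Γ' Δ' ∧ Γ ⊆ Γ' ∧ Δ ⊆ Δ' ∧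
      (φ ∈ Γ' ∨ φ ∈ Δ' ∧ ∀ ψ, φ = all ψ → ∃ t, ψ.inst t ∈ Δ') := by
  by_cases hl : LK (BaseInit S) (insert φ Γ) Δ
  · have hr : ¬ LK (BaseInit S) Γ (insert φ Δ) := fun hr => h (.cut φ hφ hl hr)
    by_cases hall : ∃ ψ, φ = all ψ
    · obtain ⟨ψ, rfl⟩ := hall
      obtain ⟨N₁, h₁⟩ := exists_boundedBy_finset Γ
      obtain ⟨N₂, h₂⟩ := exists_boundedBy_finset (insert (all ψ) Δ)
      obtain ⟨N₃, h₃⟩ := ψ.exists_boundedBy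
      let y := max N₁ (max N₂ N₃)
      refine ⟨Γ, insert (ψ.inst (var y)) (insert (all ψ) Δ), fun hd => hr ?_, subset_rfl,
        (Finset.subset_insert _ _).trans (Finset.subset_insert _ _), .inr ⟨by simp, ?_⟩⟩
      · have := LK.all_of_fresh hS (y := y) (fun φ hφ => (h₁ φ hφ).mono (by simp [y]))
          (fun φ hφ => (h₂ φ hφ).mono (by simp [y])) (h₃.mono (by simp [y])) hd
        simpa using this
      · rintro ψ' hψ'
        obtain rfl : ψ = ψ' := by simpa using hψ'
        exact ⟨var y, by simp⟩
    · exact ⟨Γ, insert φ Δ, hr, subset_rfl, Finset.subset_insert _ _, .inr ⟨by simp,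
        fun ψ hψ => (hall ⟨ψ, hψ⟩).elim⟩⟩
  · exact ⟨insert φ Γ, Δ, hl, Finset.subset_insert _ _, subset_rfl, .inl (by simp)⟩

/-- A Henkin set `G`, with the set `H` of refuted formulas. -/
structure Henkin (S : Set (Fml E)) (G H : Set (Fml E)) : Prop where
  consistent : ∀ Γ Δ : Finset (Fml E), ↑Γ ⊆ G → ↑Δ ⊆ H → ¬ LK (BaseInit S) Γ Δ
  decides : ∀ φ : Fml E, φ.Arith → φ ∈ G ∨ φ ∈ H
  witness : ∀ ψ : Fml E, (all ψ).Arith → all ψ ∈ H → ∃ t, ψ.inst t ∈ H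

/-- A sequent without derivation extends to a Henkin set: decide all formulas one after the other. -/
theorem exists_henkin [Countable (Fml E)] (hS : ∀ φ ∈ S, φ.Closed) {Γ Δ : Finset (Fml E)}
    (h : ¬ LK (BaseInit S) Γ Δ) : ∃ G H, ↑Γ ⊆ G ∧ ↑Δ ⊆ H ∧ Henkin S G H := by
  have : Nonempty (Fml E) := ⟨bot⟩
  obtain ⟨enum, henum⟩ := exists_surjective_nat (Fml E)
  let Q := {p : Finset (Fml E) × Finset (Fml E) // ¬ LK (BaseInit S) p.1 p.2}
  have step : ∀ (p : Q) (φ : Fml E), ∃ q : Q, p.1.1 ⊆ q.1.1 ∧ p.1.2 ⊆ q.1.2 ∧ (φ.Arith →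
      φ ∈ q.1.1 ∨ φ ∈ q.1.2 ∧ ∀ ψ, φ = all ψ → ∃ t, ψ.inst t ∈ q.1.2) := by
    intro p φ
    by_cases hφ : φ.Arith
    · obtain ⟨Γ', Δ', h', h1, h2, h3⟩ := exists_decide hS p.2 φ hφ
      exact ⟨⟨(Γ', Δ'), h'⟩, h1, h2, fun _ => h3⟩
    · exact ⟨p, subset_rfl, subset_rfl, fun h => (hφ h).elim⟩
  choose next hl hr hd using step
  let c : ℕ → Q := fun n => n.rec ⟨(Γ, Δ), h⟩ fun n p => next p (enum n)
  have ml : Monotone fun n => (c n).1.1 := monotone_nat_of_le_succ fun n => hl (c n) (enum n)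
  have mr : Monotone fun n => (c n).1.2 := monotone_nat_of_le_succ fun n => hr (c n) (enum n)
  have fin : ∀ (f : ℕ → Finset (Fml E)), Monotone f → ∀ Θ : Finset (Fml E),
      (Θ : Set (Fml E)) ⊆ {φ | ∃ n, φ ∈ f n} → ∃ n, Θ ⊆ f n := by
    intro f hf Θ hΘ
    induction Θ using Finset.induction_on with
    | empty => exact ⟨0, by simp⟩
    | insert φ Θ _ ih =>
      rw [Finset.coe_insert, Set.insert_subset_iff] at hΘ
      obtain ⟨⟨m, hm⟩, hΘ⟩ := hΘ
      obtain ⟨n, hn⟩ := ih hΘ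
      exact ⟨max m n, Finset.insert_subset (hf (le_max_left m n) hm)
        (hn.trans (hf (le_max_right m n)))⟩
  refine ⟨{φ | ∃ n, φ ∈ (c n).1.1}, {φ | ∃ n, φ ∈ (c n).1.2}, fun φ hφ => ⟨0, hφ⟩,
    fun φ hφ => ⟨0, hφ⟩, ?_, ?_, ?_⟩
  · intro Γ₀ Δ₀ h1 h2 d
    obtain ⟨m, hm⟩ := fin _ ml Γ₀ h1
    obtain ⟨n, hn⟩ := fin _ mr Δ₀ h2
    exact (c (max m n)).2 (d.weaken (fun _ _ _ _ => BaseInit.weaken)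
      (hm.trans (ml (le_max_left m n))) (hn.trans (mr (le_max_right m n))))
  · intro φ hφ
    obtain ⟨n, rfl⟩ := henum φ
    rcases hd (c n) (enum n) hφ with h | ⟨h, -⟩
    · exact .inl ⟨n + 1, h⟩
    · exact .inr ⟨n + 1, h⟩
  · rintro ψ hψ ⟨k, hk⟩
    obtain ⟨n, hn⟩ := henum (all ψ)
    rcases hd (c n) (enum n) (hn ▸ hψ) with h | ⟨-, h⟩
    · refine ((c (max (n + 1) k)).2 (.init ?_)).elim
      have h1 : all ψ ∈ (c (max (n + 1) k)).1.1 := ml (le_max_left (n + 1) k) (hn ▸ h)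
      have h2 : all ψ ∈ (c (max (n + 1) k)).1.2 := mr (le_max_right (n + 1) k) hk
      exact (BaseInit.id (Γ := ∅) (Δ := ∅) (all ψ) hψ).weaken (by simpa using h1)
        (by simpa using h2)
    · obtain ⟨t, ht⟩ := h ψ hn
      exact ⟨t, n + 1, ht⟩

namespace Henkin

variable {G H : Set (Fml E)}

theorem mem_of_derivable (hG : Henkin S G H) {Γ : Finset (Fml E)} {φ : Fml E} (hφ : φ.Arith)
    (hΓ : ↑Γ ⊆ G) (d : LK (BaseInit S) Γ {φ}) : φ ∈ G := by
  refine (hG.decides φ hφ).resolve_right fun h => hG.consistent Γ {φ} hΓ (by simpa using h) d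

theorem notMem (hG : Henkin S G H) {φ : Fml E} (hφ : φ.Arith) : φ ∈ H ↔ φ ∉ G := by
  refine ⟨fun h h' => hG.consistent {φ} {φ} (by simpa using h') (by simpa using h) ?_,
    (hG.decides φ hφ).resolve_left⟩
  exact .init (.id (Γ := ∅) (Δ := ∅) φ hφ)

theorem eq_refl (hG : Henkin S G H) (t : Tm E) : eq t t ∈ G :=
  hG.mem_of_derivable (Γ := ∅) trivial (by simp) (.init (.refl (Δ := ∅) t))

theorem eq_repl (hG : Henkin S G H) {r s : Tm E} (α : Fml E) (hα : α.Arith) (h : eq r s ∈ G)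
    (hr : α.inst r ∈ G) : α.inst s ∈ G :=
  hG.mem_of_derivable (Γ := {eq r s, α.inst r}) ((subst_arith _).2 hα)
    (by simp [Set.insert_subset_iff, h, hr]) (.init (.repl (Γ := ∅) (Δ := ∅) α r s hα))

/-- Formulas are invariant under termwise provably equal substitutions. -/
theorem congr_subst (hG : Henkin S G H) {σ τ : ℕ → Tm E} (h : ∀ i, eq (σ i) (τ i) ∈ G)
    (α : Fml E) (hα : α.Arith) (hσ : α.subst σ ∈ G) : α.subst τ ∈ G := by
  -- replace one variable after the other
  have key : ∀ k, α.subst (fun i => if i < k then τ i else σ i) ∈ G := by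
    intro k
    induction k with
    | zero => simpa using hσ
    | succ k ih =>
      let β := α.subst fun i =>
        if i = k then var 0 else (if i < k then τ i else σ i : Tm E).lift 1
      have hβ : ∀ t, β.inst t =
          α.subst fun i => if i = k then t else if i < k then τ i else σ i := by
        intro t
        simp only [β, inst, Fml.subst_subst]
        congr 1
        funext i
        by_cases hi : i = k
        · simp [hi, Tm.subst]
        · simp only [hi, if_false, Tm.lift, Tm.subst_subst]
          exact Tm.subst_var _
      have := hG.eq_repl β ((subst_arith _).2 hα) (h k) (by
        rw [hβ]
        convert ih using 3 with i
        by_cases hi : i = k <;> simp [hi])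
      rw [hβ] at this
      convert this using 3 with i
      rcases lt_trichotomy i k with hi | hi | hi
      · simp [hi, hi.ne, hi.trans k.lt_succ_self]
      · simp [hi]
      · simp [hi.ne', hi.not_gt, show ¬ i < k + 1 by omega]
  obtain ⟨N, hN⟩ := α.exists_boundedBy
  rw [hN τ (fun i => if i < N then τ i else σ i) fun i hi => by simp [hi]]
  exact key N

theorem congr_tm (hG : Henkin S G H) {σ τ : ℕ → Tm E} (h : ∀ i, eq (σ i) (τ i) ∈ G)
    (t : Tm E) : eq (t.subst σ) (t.subst τ) ∈ G := by
  -- the odd variables keep the values under `σ`, the even ones change from `σ` to `τ`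
  have := hG.congr_subst (σ := fun j => σ (j / 2))
    (τ := fun j => if j % 2 = 0 then τ (j / 2) else σ (j / 2))
    (by intro j; split_ifs; exacts [h _, hG.eq_refl _])
    (eq (t.subst fun i => var (2 * i + 1)) (t.subst fun i => var (2 * i))) trivial
    (by
      have h1 : ∀ i : ℕ, (2 * i + 1) / 2 = i := by omega
      simpa [Fml.subst, Tm.subst_subst, Tm.subst, h1] using hG.eq_refl _)
  have h1 : ∀ i : ℕ, (2 * i + 1) / 2 = i := by omega
  simpa [Fml.subst, Tm.subst_subst, Tm.subst, h1, Nat.add_mod] using this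

theorem eq_symm (hG : Henkin S G H) {r s : Tm E} (h : eq r s ∈ G) : eq s r ∈ G := by
  have := hG.congr_subst (σ := fun _ => r) (τ := fun i => if i = 0 then s else r)
    (by intro i; split_ifs; exacts [h, hG.eq_refl r]) (eq (var 0) (var 1)) trivial
    (hG.eq_refl r)
  simpa [Fml.subst, Tm.subst] using this

theorem eq_trans (hG : Henkin S G H) {r s t : Tm E} (h : eq r s ∈ G) (h' : eq s t ∈ G) :
    eq r t ∈ G := by
  have := hG.congr_subst (σ := fun i => if i = 0 then r else s)
    (τ := fun i => if i = 0 then r else t)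
    (by intro i; split_ifs; exacts [hG.eq_refl r, h']) (eq (var 0) (var 1)) trivial
    (by simpa [Fml.subst, Tm.subst] using h)
  simpa [Fml.subst, Tm.subst] using this

/-- Provable equality of terms. -/
def setoid (hG : Henkin S G H) : Setoid (Tm E) where
  r s t := eq s t ∈ G
  iseqv := ⟨hG.eq_refl, hG.eq_symm, hG.eq_trans⟩

/-- The term model. -/
noncomputable def str (hG : Henkin S G H) : Str E (Quotient hG.setoid) where
  zero := Quotient.mk _ .zero
  succ a := Quotient.mk _ (.succ a.out)
  add a b := Quotient.mk _ (.add a.out b.out)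
  mul a b := Quotient.mk _ (.mul a.out b.out)
  exp a := Quotient.mk _ (.exp a.out)
  fn f a := Quotient.mk _ (.fn f fun i => (a i).out)
  rel R a := Fml.rel R (fun i => (a i).out) ∈ G

theorem out_eq (hG : Henkin S G H) (t : Tm E) : eq (Quotient.mk hG.setoid t).out t ∈ G :=
  Quotient.exact (Quotient.out_eq (Quotient.mk hG.setoid t))

theorem val_str (hG : Henkin S G H) (σ : ℕ → Tm E) (t : Tm E) :
    hG.str.val (fun i => Quotient.mk _ (σ i)) t = Quotient.mk _ (t.subst σ) := by
  induction t with
  | var i => rfl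
  | zero => rfl
  | succ t ih =>
    rw [Str.val, ih]
    exact Quotient.sound (hG.congr_tm (fun _ => hG.out_eq (t.subst σ)) (Tm.succ (Tm.var 0)))
  | exp t ih =>
    rw [Str.val, ih]
    exact Quotient.sound (hG.congr_tm (fun _ => hG.out_eq (t.subst σ)) (Tm.exp (Tm.var 0)))
  | add s t ih ih' =>
    rw [Str.val, ih, ih']
    exact Quotient.sound (hG.congr_tm (fun i => hG.out_eq (if i = 0 then s.subst σ else t.subst σ))
      (Tm.add (Tm.var 0) (Tm.var 1)))
  | mul s t ih ih' =>
    rw [Str.val, ih, ih']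
    exact Quotient.sound (hG.congr_tm (fun i => hG.out_eq (if i = 0 then s.subst σ else t.subst σ))
      (Tm.mul (Tm.var 0) (Tm.var 1)))
  | @fn n f ts ih =>
    simp only [Str.val, ih]
    have := hG.congr_tm (fun i => hG.out_eq (if h : i < n then (ts ⟨i, h⟩).subst σ else zero))
      (Tm.fn f fun i : Fin n => Tm.var i)
    simp only [Tm.subst, Fin.is_lt, dif_pos, Fin.eta] at this
    exact Quotient.sound this

/-- The truth lemma for the term model, in which the formulas of `G` hold. -/
theorem sat_str (hG : Henkin S G H) (φ : Fml E) (hφ : φ.Arith) (σ : ℕ → Tm E) :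
    hG.str.Sat (fun i => Quotient.mk _ (σ i)) φ ↔ φ.subst σ ∈ G := by
  induction φ generalizing σ with
  | eq s t =>
    rw [Str.Sat, hG.val_str, hG.val_str]
    exact Quotient.eq (r := hG.setoid)
  | @rel n R ts =>
    simp only [Str.Sat, hG.val_str]
    have h1 := fun i => hG.out_eq (if h : i < n then (ts ⟨i, h⟩).subst σ else zero)
    have h2 := hG.congr_subst h1 (Fml.rel R fun i : Fin n => Tm.var i) trivial
    have h3 := hG.congr_subst (fun i => hG.eq_symm (h1 i))
      (Fml.rel R fun i : Fin n => Tm.var i) trivial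
    simp only [Fml.subst, Tm.subst, Fin.is_lt, dif_pos, Fin.eta] at h2 h3
    exact ⟨h2, h3⟩
  | tr t => exact hφ.elim
  | neg φ ih =>
    rw [Str.Sat, ih hφ, Fml.subst]
    have ha : (φ.subst σ).Arith := (subst_arith σ).2 hφ
    constructor
    · intro h
      refine (hG.decides (neg (φ.subst σ)) ha).resolve_right fun h' => ?_
      refine hG.consistent ∅ {neg (φ.subst σ), φ.subst σ} (by simp) ?_
        (.negR _ (.init (.id (Γ := ∅) (Δ := ∅) _ ha)))
      simpa [Set.insert_subset_iff, h'] using (hG.notMem ha).2 h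
    · intro h h'
      refine hG.consistent {neg (φ.subst σ), φ.subst σ} ∅ ?_ (by simp)
        (.negL _ (.init (.id (Γ := ∅) (Δ := ∅) _ ha)))
      simp [Set.insert_subset_iff, h, h']
  | or φ ψ ih ih' =>
    rw [Str.Sat, ih hφ.1, ih' hφ.2, Fml.subst]
    have ha : (φ.subst σ).Arith := (subst_arith σ).2 hφ.1
    have hb : (ψ.subst σ).Arith := (subst_arith σ).2 hφ.2
    have w : ∀ {Γ Δ} (α : Fml E), α.Arith → α ∈ Γ → α ∈ Δ → LK (BaseInit S) Γ Δ :=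
      fun α hα h1 h2 => .init ((BaseInit.id (Γ := ∅) (Δ := ∅) α hα).weaken (by simpa using h1)
        (by simpa using h2))
    constructor
    · intro h
      rcases h with h | h
      · exact hG.mem_of_derivable (Γ := {φ.subst σ}) ⟨ha, hb⟩ (by simpa using h)
          (.orR (Δ := ∅) _ _ (w _ ha (by simp) (by simp)))
      · exact hG.mem_of_derivable (Γ := {ψ.subst σ}) ⟨ha, hb⟩ (by simpa using h)
          (.orR (Δ := ∅) _ _ (w _ hb (by simp) (by simp)))
    · intro h
      by_contra hc
      rw [not_or, ← hG.notMem ha, ← hG.notMem hb] at hc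
      refine hG.consistent {or (φ.subst σ) (ψ.subst σ)} {φ.subst σ, ψ.subst σ} (by simpa using h)
        (by simp [Set.insert_subset_iff, hc]) (.orL (Γ := ∅) _ _ ?_ ?_)
      · exact w _ ha (by simp) (by simp)
      · exact w _ hb (by simp) (by simp)
  | all φ ih =>
    have hc : ∀ t : Tm E, cons (Quotient.mk hG.setoid t) (fun i => Quotient.mk hG.setoid (σ i)) =
        fun i => Quotient.mk hG.setoid (cons t σ i) := by
      intro t
      funext i
      cases i <;> rfl
    have hi : ∀ t : Tm E, (φ.subst (upN 1 σ)).inst t = φ.subst (cons t σ) := by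
      intro t
      rw [inst, Fml.subst_subst]
      congr 1
      funext i
      cases i with
      | zero => rfl
      | succ j => simp [upN, Tm.lift, Tm.subst_subst, Tm.subst, Tm.subst_var, cons]
    have hφ' : φ.Arith := hφ
    have ha' : (φ.subst (upN 1 σ)).Arith := (subst_arith (upN 1 σ)).2 hφ'
    have ha : (all (φ.subst (upN 1 σ))).Arith := ha'
    have hia : ∀ t, ((φ.subst (upN 1 σ)).inst t).Arith := fun t => (subst_arith _).2 ha'
    have hsat : hG.str.Sat (fun i => Quotient.mk _ (σ i)) (all φ) ↔
        ∀ t : Tm E, (φ.subst (upN 1 σ)).inst t ∈ G := by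
      simp only [hi]
      refine ⟨fun h t => (ih hφ' _).1 (hc t ▸ h (Quotient.mk _ t)), fun h m => ?_⟩
      obtain ⟨t, rfl⟩ := Quotient.exists_rep m
      exact hc t ▸ (ih hφ' _).2 (h t)
    rw [hsat, all_subst]
    constructor
    · intro h
      by_contra hn
      obtain ⟨t, ht⟩ := hG.witness _ ha ((hG.notMem ha).2 hn)
      exact (hG.notMem (hia t)).1 ht (h t)
    · intro h t
      exact hG.mem_of_derivable (Γ := {all (φ.subst (upN 1 σ))}) (hia t)
        (by simpa using h) (.allL (Γ := ∅) _ t (.init (.id (Δ := ∅) _ (hia t))))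

end Henkin

/-- Completeness of the arithmetical rules, for the formulas of `L` in a sequent. -/
theorem completeness [Countable (Fml E)] (hS : ∀ φ ∈ S, φ.Closed) {Γ Δ : Finset (Fml E)}
    (h : ∀ (M : Type u) (A : Str E M),
      (∀ φ : Fml E, φ.Arith → LK (BaseInit S) ∅ {φ} → ∀ e, A.Sat e φ) →
      ∀ e, (∀ γ ∈ Γ, γ.Arith → A.Sat e γ) → ∃ δ ∈ Δ, δ.Arith ∧ A.Sat e δ) :
    LK (BaseInit S) Γ Δ := by
  by_contra hn
  obtain ⟨G, H, hΓ, hΔ, hG⟩ := exists_henkin hS hn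
  obtain ⟨δ, hδ, ha, hsat⟩ := h _ hG.str
    (fun φ hφ d e => by
      obtain ⟨σ, rfl⟩ : ∃ σ : ℕ → Tm E, e = fun i => Quotient.mk _ (σ i) :=
        ⟨fun i => (e i).out, funext fun i => (Quotient.out_eq _).symm⟩
      refine (hG.sat_str φ hφ σ).2 (hG.mem_of_derivable (Γ := ∅) ((subst_arith σ).2 hφ)
        (by simp) ?_)
      have := d.subst (fun _ _ σ => BaseInit.subst hS σ) σ
      rwa [substS_singleton] at this)
    (fun i => Quotient.mk _ (var i))
    (fun γ hγ ha => by
      rw [hG.sat_str γ ha, Fml.subst_var]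
      exact hΓ hγ)
  rw [hG.sat_str δ ha, Fml.subst_var] at hsat
  exact (hG.notMem ha).1 (hΔ hδ) hsat

end Completeness

/-! ### Countability of the language -/

section Countable

/-- A code in `ℕ` for a term, given codes for the function symbols. -/
def Tm.code (c : (Σ n, E.Functions n) → ℕ) : Tm E → ℕ
  | var i => Nat.pair 0 i
  | zero => Nat.pair 1 0
  | succ t => Nat.pair 2 (t.code c)
  | add s t => Nat.pair 3 (Nat.pair (s.code c) (t.code c))
  | mul s t => Nat.pair 4 (Nat.pair (s.code c) (t.code c))
  | exp t => Nat.pair 5 (t.code c)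
  | fn (n := n) f ts =>
    Nat.pair 6 (Nat.pair (c ⟨n, f⟩) (Encodable.encode (List.ofFn fun i => (ts i).code c)))

theorem Tm.code_injective {c : (Σ n, E.Functions n) → ℕ} (hc : Function.Injective c) :
    Function.Injective (Tm.code c) := by
  intro s
  induction s with
  | @fn n f ts ih =>
    intro t h
    cases t with
    | @fn m g us =>
      simp only [code, Nat.pair_eq_pair, hc.eq_iff, true_and] at h
      obtain ⟨h1, h2⟩ := h
      obtain ⟨rfl, h1⟩ := Sigma.mk.inj_iff.1 h1
      obtain rfl := eq_of_heq h1
      have h3 := List.ofFn_injective (Encodable.encode_injective h2)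
      congr 1
      funext i
      exact ih i (congrFun h3 i)
    | _ => simp [code, Nat.pair_eq_pair] at h
  | var i => intro t h; cases t <;> simp_all [code, Nat.pair_eq_pair]
  | zero => intro t h; cases t <;> simp_all [code, Nat.pair_eq_pair]
  | succ s ih | exp s ih =>
    intro t h
    cases t <;> simp [code, Nat.pair_eq_pair] at h
    rw [ih h]
  | add s s' ih ih' | mul s s' ih ih' =>
    intro t h
    cases t <;> simp [code, Nat.pair_eq_pair] at h
    rw [ih h.1, ih' h.2]

/-- A code in `ℕ` for a formula, given codes for the function and relation symbols. -/
def Fml.code (c : (Σ n, E.Functions n) → ℕ) (d : (Σ n, E.Relations n) → ℕ) : Fml E → ℕ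
  | eq s t => Nat.pair 0 (Nat.pair (s.code c) (t.code c))
  | rel (n := n) R ts =>
    Nat.pair 1 (Nat.pair (d ⟨n, R⟩) (Encodable.encode (List.ofFn fun i => (ts i).code c)))
  | tr t => Nat.pair 2 (t.code c)
  | neg φ => Nat.pair 3 (φ.code c d)
  | or φ ψ => Nat.pair 4 (Nat.pair (φ.code c d) (ψ.code c d))
  | all φ => Nat.pair 5 (φ.code c d)

theorem Fml.code_injective {c : (Σ n, E.Functions n) → ℕ} (hc : Function.Injective c)
    {d : (Σ n, E.Relations n) → ℕ} (hd : Function.Injective d) :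
    Function.Injective (Fml.code c d) := by
  intro φ
  induction φ with
  | @rel n R ts =>
    intro ψ h
    cases ψ with
    | @rel m Q us =>
      simp only [code, Nat.pair_eq_pair, hd.eq_iff, true_and] at h
      obtain ⟨h1, h2⟩ := h
      obtain ⟨rfl, h1⟩ := Sigma.mk.inj_iff.1 h1
      obtain rfl := eq_of_heq h1
      have h3 := List.ofFn_injective (Encodable.encode_injective h2)
      congr 1
      funext i
      exact Tm.code_injective hc (congrFun h3 i)
    | _ => simp [code, Nat.pair_eq_pair] at h
  | eq s s' =>
    intro ψ h
    cases ψ <;> simp [code, Nat.pair_eq_pair, (Tm.code_injective hc).eq_iff] at h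
    rw [h.1, h.2]
  | tr t =>
    intro ψ h
    cases ψ <;> simp [code, Nat.pair_eq_pair, (Tm.code_injective hc).eq_iff] at h
    rw [h]
  | neg φ ih | all φ ih =>
    intro ψ h
    cases ψ <;> simp [code, Nat.pair_eq_pair] at h
    rw [ih h]
  | or φ φ' ih ih' =>
    intro ψ h
    cases ψ <;> simp [code, Nat.pair_eq_pair] at h
    rw [ih h.1, ih' h.2]

theorem Coding.countable_fml (P : Coding E) : Countable (Fml E) := by
  have : Countable (Σ n, E.Functions n) :=
    (Set.countable_univ_iff.1 ((List.finite_toSet P.fns).countable.mono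
      fun f _ => P.fns_complete f))
  obtain ⟨c, hc⟩ := exists_injective_nat (Σ n, E.Functions n)
  exact (Fml.code_injective hc P.relCode_injective).countable

end Countable

end Semantics

/-! ### Pairs and finite sets in discretely ordered semirings with exponentiation -/

section Semiring

variable {M : Type*} [CommSemiring M] [LinearOrder M] [IsStrictOrderedRing M]
  [CanonicallyOrderedAdd M]

/-- The pairing `(x + y)² + x` determines `x + y`, as it lies below `(x + y + 1)²`. -/
theorem pair_injective (hd : ∀ a b : M, a < b → a + 1 ≤ b) {x y x' y' : M}
    (h : (x + y) * (x + y) + x = (x' + y') * (x' + y') + x') : x = x' ∧ y = y' := by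
  have key : ∀ x y x' y' : M, x + y < x' + y' →
      (x + y) * (x + y) + x < (x' + y') * (x' + y') + x' := by
    intro x y x' y' hlt
    have h1 := hd _ _ hlt
    calc (x + y) * (x + y) + x < (x + y) * (x + y) + x + (x + y + y + 1) :=
          lt_add_of_pos_right _ (by positivity)
      _ = (x + y + 1) * (x + y + 1) := by ring
      _ ≤ (x' + y') * (x' + y') := mul_le_mul' h1 h1
      _ ≤ _ := le_self_add
  rcases lt_trichotomy (x + y) (x' + y') with hlt | heq | hgt
  · exact absurd h (key _ _ _ _ hlt).ne
  · rw [heq] at h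
    obtain rfl := add_left_cancel h
    exact ⟨rfl, add_left_cancel heq⟩
  · exact absurd h (key _ _ _ _ hgt).ne'

variable {ex : M → M}

/-- Every finite set is the set of places of the digits `1` in the binary expansion of the sum of
the powers `2 ^ a`, `a ∈ F`. -/
theorem exists_binary_code (hd : ∀ a b : M, a < b → a + 1 ≤ b)
    (h0 : ∀ a, ex a ≠ 0) (h1 : ∀ a, ex (a + 1) = ex a + ex a)
    (hadd : ∀ a b, ex (a + b) = ex a * ex b) (F : Finset M) :
    ∃ c, ∀ y, (∃ a b, c = a * ex (y + 1) + ex y + b ∧ b < ex y) ↔ y ∈ F := by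
  have one_le : ∀ a, 1 ≤ ex a := fun a => by
    simpa using hd 0 _ (pos_iff_ne_zero.2 (h0 a))
  have dvd : ∀ a b : M, a ≤ b → ex a ∣ ex b := by
    intro a b hab
    obtain ⟨c, rfl⟩ := exists_add_of_le hab
    exact ⟨ex c, hadd a c⟩
  have mono : ∀ a b : M, a ≤ b → ex a ≤ ex b := by
    intro a b hab
    obtain ⟨c, rfl⟩ := exists_add_of_le hab
    rw [hadd]
    exact le_mul_of_one_le_right' (one_le c)
  have small : ∀ (F : Finset M) (y : M), (∀ a ∈ F, a < y) → ∑ a ∈ F, ex a < ex y := by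
    intro F
    induction F using Finset.induction_on_max with
    | empty => intro y _; simpa using pos_iff_ne_zero.2 (h0 y)
    | insert m F hm ih =>
      intro y hy
      rw [Finset.sum_insert fun h => (hm m h).false]
      calc ex m + ∑ a ∈ F, ex a < ex m + ex m := by gcongr; exact ih m hm
        _ = ex (m + 1) := (h1 m).symm
        _ ≤ ex y := mono _ _ (hd _ _ (hy m (by simp)))
  refine ⟨∑ a ∈ F, ex a, fun y => ?_⟩
  -- split the sum at `y`
  obtain ⟨α, hα⟩ : ex (y + 1) ∣ ∑ a ∈ F with y < a, ex a :=
    Finset.dvd_sum fun a ha => dvd _ _ (hd _ _ (Finset.mem_filter.1 ha).2)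
  have hβ : ∑ a ∈ F with a < y, ex a < ex y := small _ _ fun a ha => (Finset.mem_filter.1 ha).2
  have hsplit : ∑ a ∈ F, ex a =
      α * ex (y + 1) + (if y ∈ F then ex y else 0) + ∑ a ∈ F with a < y, ex a := by
    have h2 : ∑ a ∈ F with ¬ y < a, ex a =
        (if y ∈ F then ex y else 0) + ∑ a ∈ F with a < y, ex a := by
      rw [← Finset.sum_filter_add_sum_filter_not (F.filter fun a => ¬ y < a) (· = y)]
      congr 1
      · rw [Finset.filter_filter, ← Finset.sum_ite_eq' F y ex, ← Finset.sum_filter]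
        refine Finset.sum_congr (Finset.filter_congr fun a _ => ?_) fun _ _ => rfl
        exact ⟨fun h => h.2, fun h => ⟨h ▸ lt_irrefl a, h⟩⟩
      · rw [Finset.filter_filter]
        refine Finset.sum_congr (Finset.filter_congr fun a _ => ?_) fun _ _ => rfl
        rw [not_lt]
        exact ⟨fun h => lt_of_le_of_ne h.1 h.2, fun h => ⟨h.le, h.ne⟩⟩
    rw [← Finset.sum_filter_add_sum_filter_not F (y < ·), hα, h2, mul_comm, add_assoc]
  constructor
  · rintro ⟨a, b, hab, hb⟩
    by_contra hy
    rw [hsplit, if_neg hy, add_zero, add_assoc] at hab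
    generalize ∑ a ∈ F with a < y, ex a = β at hab hβ
    have hu : ∀ p q d e : M, d < ex (y + 1) → p + 1 ≤ q →
        p * ex (y + 1) + d < q * ex (y + 1) + e := by
      intro p q d e hd' hpq
      calc p * ex (y + 1) + d < p * ex (y + 1) + ex (y + 1) := by gcongr
        _ = (p + 1) * ex (y + 1) := by ring
        _ ≤ q * ex (y + 1) := mul_le_mul' hpq le_rfl
        _ ≤ _ := le_self_add
    rcases lt_trichotomy α a with h | h | h
    · exact (hu α a β (ex y + b) (hβ.trans_le (by rw [h1]; exact le_self_add)) (hd _ _ h)).ne hab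
    · rw [h] at hab
      exact (hβ.trans_le le_self_add).ne (add_left_cancel hab)
    · exact (hu a α (ex y + b) β (by rw [h1]; gcongr) (hd _ _ h)).ne' hab
  · intro hy
    exact ⟨α, _, by rw [hsplit, if_pos hy], hβ⟩

end Semiring

/-! ### Models of `IΔ₀ + exp` -/

section Models

variable {E : FirstOrder.Language.{u, v}} {M : Type*} {A : Str E M}

theorem Str.sat_and {e : ℕ → M} {φ ψ : Fml E} :
    A.Sat e (Fml.and φ ψ) ↔ A.Sat e φ ∧ A.Sat e ψ := by
  simp [Fml.and, Str.Sat, not_or]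

theorem Str.sat_imp {e : ℕ → M} {φ ψ : Fml E} :
    A.Sat e (imp φ ψ) ↔ (A.Sat e φ → A.Sat e ψ) := by
  simp [imp, Str.Sat, imp_iff_not_or]

theorem Str.sat_ex {e : ℕ → M} {φ : Fml E} :
    A.Sat e (ex φ) ↔ ∃ m, A.Sat (cons m e) φ := by
  simp [ex, Str.Sat]

theorem Str.sat_le {e : ℕ → M} {s t : Tm E} :
    A.Sat e (le s t) ↔ ∃ m, A.add m (A.val e s) = A.val e t := by
  simp [le, Str.sat_ex, Str.Sat, Str.val, Str.val_lift_one, cons]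

/-- Models of `IΔ₀ + exp`. -/
def Str.IsModel (A : Str E M) : Prop := ∀ φ, IDexp E φ → ∀ e, A.Sat e φ

namespace Str.IsModel

variable (hA : A.IsModel)
include hA

theorem succ_ne_zero (a : M) : A.succ a ≠ A.zero := by
  simpa [Sat, val] using hA _ .succ_ne_zero fun _ => a

theorem succ_inj {a b : M} (h : A.succ a = A.succ b) : a = b := by
  have := hA _ .succ_inj (cons a fun _ => b)
  simp only [sat_imp, Sat, val, cons] at this
  exact this h

theorem zero_or_succ (a : M) : a = A.zero ∨ ∃ b, a = A.succ b := by
  simpa [sat_ex, Sat, val, cons] using hA _ .zero_or_succ fun _ => a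

theorem add_zero (a : M) : A.add a A.zero = a := by
  simpa [Sat, val] using hA _ .add_zero fun _ => a

theorem add_succ (a b : M) : A.add a (A.succ b) = A.succ (A.add a b) := by
  simpa [Sat, val, cons] using hA _ .add_succ (cons a fun _ => b)

theorem mul_zero (a : M) : A.mul a A.zero = A.zero := by
  simpa [Sat, val] using hA _ .mul_zero fun _ => a

theorem mul_succ (a b : M) : A.mul a (A.succ b) = A.add (A.mul a b) a := by
  simpa [Sat, val, cons] using hA _ .mul_succ (cons a fun _ => b)

theorem exp_zero : A.exp A.zero = A.succ A.zero := by
  simpa [Sat, val] using hA _ .exp_zero fun _ => A.zero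

theorem exp_succ (a : M) : A.exp (A.succ a) = A.add (A.exp a) (A.exp a) := by
  simpa [Sat, val] using hA _ .exp_succ fun _ => a

theorem induction {φ : Fml E} (hφ : Delta0 φ) (e : ℕ → M) (h0 : A.Sat (cons A.zero e) φ)
    (hs : ∀ m, A.Sat (cons m e) φ → A.Sat (cons (A.succ m) e) φ) (m : M) :
    A.Sat (cons m e) φ := by
  have := hA _ (.induction φ hφ) e
  simp only [sat_imp, sat_and, Sat, inst, sat_subst] at this
  refine this ⟨?_, fun m hm => ?_⟩ m
  · convert h0 using 2 with i
    rcases i with _ | i <;> rfl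
  · convert hs m hm using 2 with i
    rcases i with _ | i <;> rfl

/-- Induction for equations between polynomials. -/
theorem induction_eq (s t : Tm E) (hs : s.Pure) (ht : t.Pure) (e : ℕ → M)
    (h0 : A.val (cons A.zero e) s = A.val (cons A.zero e) t)
    (h : ∀ m, A.val (cons m e) s = A.val (cons m e) t →
      A.val (cons (A.succ m) e) s = A.val (cons (A.succ m) e) t) (m : M) :
    A.val (cons m e) s = A.val (cons m e) t :=
  hA.induction (.eq s t hs ht) e h0 h m

theorem zero_add (a : M) : A.add A.zero a = a :=
  hA.induction_eq (Tm.add Tm.zero (var 0)) (var 0) (by simp [Tm.Pure]) trivial (fun _ => a)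
    (hA.add_zero _) (fun m h => by simp only [val, cons] at h ⊢; rw [hA.add_succ, h]) a

theorem succ_add (a b : M) : A.add (A.succ a) b = A.succ (A.add a b) :=
  hA.induction_eq (Tm.add (Tm.succ (var 1)) (var 0)) (Tm.succ (Tm.add (var 1) (var 0)))
    (by simp [Tm.Pure]) (by simp [Tm.Pure]) (fun _ => a)
    (by simp only [val, cons]; rw [hA.add_zero, hA.add_zero])
    (fun m h => by simp only [val, cons] at h ⊢; rw [hA.add_succ, h, hA.add_succ]) b

theorem add_comm (a b : M) : A.add a b = A.add b a :=
  hA.induction_eq (Tm.add (var 1) (var 0)) (Tm.add (var 0) (var 1))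
    (by simp [Tm.Pure]) (by simp [Tm.Pure]) (fun _ => a)
    (by simp only [val, cons]; rw [hA.add_zero, hA.zero_add])
    (fun m h => by simp only [val, cons] at h ⊢; rw [hA.add_succ, h, hA.succ_add]) b

theorem add_assoc (a b c : M) : A.add (A.add a b) c = A.add a (A.add b c) :=
  hA.induction_eq (Tm.add (Tm.add (var 1) (var 2)) (var 0)) (Tm.add (var 1) (Tm.add (var 2) (var 0)))
    (by simp [Tm.Pure]) (by simp [Tm.Pure]) (cons a fun _ => b)
    (by simp only [val, cons]; rw [hA.add_zero, hA.add_zero])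
    (fun m h => by
      simp only [val, cons] at h ⊢; rw [hA.add_succ, h, hA.add_succ, hA.add_succ]) c

theorem zero_mul (a : M) : A.mul A.zero a = A.zero :=
  hA.induction_eq (Tm.mul Tm.zero (var 0)) Tm.zero (by simp [Tm.Pure]) trivial (fun _ => a)
    (hA.mul_zero _)
    (fun m h => by simp only [val, cons] at h ⊢; rw [hA.mul_succ, h, hA.add_zero]) a

theorem succ_mul (a b : M) : A.mul (A.succ a) b = A.add (A.mul a b) b :=
  hA.induction_eq (Tm.mul (Tm.succ (var 1)) (var 0)) (Tm.add (Tm.mul (var 1) (var 0)) (var 0))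
    (by simp [Tm.Pure]) (by simp [Tm.Pure]) (fun _ => a)
    (by simp only [val, cons]; rw [hA.mul_zero, hA.mul_zero, hA.add_zero])
    (fun m h => by
      simp only [val, cons] at h ⊢
      rw [hA.mul_succ, h, hA.mul_succ, hA.add_succ, hA.add_succ, hA.add_assoc, hA.add_assoc,
        hA.add_comm m]) b

theorem mul_comm (a b : M) : A.mul a b = A.mul b a :=
  hA.induction_eq (Tm.mul (var 1) (var 0)) (Tm.mul (var 0) (var 1))
    (by simp [Tm.Pure]) (by simp [Tm.Pure]) (fun _ => a)
    (by simp only [val, cons]; rw [hA.mul_zero, hA.zero_mul])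
    (fun m h => by simp only [val, cons] at h ⊢; rw [hA.mul_succ, h, hA.succ_mul]) b

theorem mul_add (a b c : M) : A.mul a (A.add b c) = A.add (A.mul a b) (A.mul a c) :=
  hA.induction_eq (Tm.mul (var 1) (Tm.add (var 2) (var 0)))
    (Tm.add (Tm.mul (var 1) (var 2)) (Tm.mul (var 1) (var 0)))
    (by simp [Tm.Pure]) (by simp [Tm.Pure]) (cons a fun _ => b)
    (by simp only [val, cons]; rw [hA.add_zero, hA.mul_zero, hA.add_zero])
    (fun m h => by
      simp only [val, cons] at h ⊢
      rw [hA.add_succ, hA.mul_succ, h, hA.mul_succ, hA.add_assoc]) c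

theorem mul_assoc (a b c : M) : A.mul (A.mul a b) c = A.mul a (A.mul b c) :=
  hA.induction_eq (Tm.mul (Tm.mul (var 1) (var 2)) (var 0)) (Tm.mul (var 1) (Tm.mul (var 2) (var 0)))
    (by simp [Tm.Pure]) (by simp [Tm.Pure]) (cons a fun _ => b)
    (by simp only [val, cons]; rw [hA.mul_zero, hA.mul_zero, hA.mul_zero])
    (fun m h => by
      simp only [val, cons] at h ⊢
      rw [hA.mul_succ, h, hA.mul_succ, hA.mul_add]) c

theorem add_right_cancel {a b c : M} (h : A.add a c = A.add b c) : a = b := by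
  have := hA.induction (φ := imp (Fml.eq (Tm.add (var 1) (var 0)) (Tm.add (var 2) (var 0)))
      (Fml.eq (var 1) (var 2)))
    (.or _ _ (.neg _ (.eq _ _ (by simp [Tm.Pure]) (by simp [Tm.Pure])))
      (.eq _ _ trivial trivial)) (cons a fun _ => b)
    (by simp only [sat_imp, Sat, val, cons, hA.add_zero]; exact id)
    (fun m hm => by
      simp only [sat_imp, Sat, val, cons, hA.add_succ] at hm ⊢
      exact fun h => hm (hA.succ_inj h)) c
  simp only [sat_imp, Sat, val, cons] at this
  exact this h

theorem exp_add (a b : M) : A.exp (A.add a b) = A.mul (A.exp a) (A.exp b) :=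
  hA.induction_eq (Tm.exp (Tm.add (var 1) (var 0))) (Tm.mul (Tm.exp (var 1)) (Tm.exp (var 0)))
    (by simp [Tm.Pure]) (by simp [Tm.Pure]) (fun _ => a)
    (by
      simp only [val, cons]
      rw [hA.add_zero, hA.exp_zero, hA.mul_succ, hA.mul_zero, hA.zero_add])
    (fun m h => by
      simp only [val, cons] at h ⊢
      rw [hA.add_succ, hA.exp_succ, h, hA.exp_succ, hA.mul_add]) b

theorem eq_zero_of_add_eq_zero {a b : M} (h : A.add a b = A.zero) : a = A.zero ∧ b = A.zero := by
  rcases hA.zero_or_succ b with rfl | ⟨c, rfl⟩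
  · exact ⟨by rwa [hA.add_zero] at h, rfl⟩
  · rw [hA.add_succ] at h
    exact (hA.succ_ne_zero _ h).elim

theorem exp_ne_zero (a : M) : A.exp a ≠ A.zero :=
  hA.induction (φ := Fml.neg (Fml.eq (Tm.exp (var 0)) Tm.zero))
    (.neg _ (.eq _ _ trivial trivial)) (fun _ => a)
    (by simp only [Sat, val, cons, hA.exp_zero]; exact hA.succ_ne_zero _)
    (fun m hm => by
      simp only [Sat, val, cons, hA.exp_succ] at hm ⊢
      exact fun h => hm (hA.eq_zero_of_add_eq_zero h).1) a

/-- The order is linear. Induction is restricted to bounded formulas, so `≤` has to be written with a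
bounded quantifier first. -/
theorem total (a b : M) : (∃ c, A.add c a = b) ∨ ∃ c, A.add c b = a := by
  -- `s ≤ t` as a bounded formula
  let B : Tm E → Tm E → Fml E := fun s t => Fml.neg (Fml.all (imp (le (var 0) (t.lift 1))
    (Fml.neg (Fml.eq (Tm.add (var 0) (s.lift 1)) (t.lift 1)))))
  have hB : ∀ e s t, A.Sat e (B s t) ↔ ∃ c, A.add c (A.val e s) = A.val e t := by
    intro e s t
    simp only [B, Sat, sat_imp, sat_le, val, val_lift_one, cons, not_forall, not_not,
      exists_prop]
    refine ⟨fun ⟨c, _, h⟩ => ⟨c, h⟩, fun ⟨c, h⟩ => ⟨c, ⟨A.val e s, ?_⟩, h⟩⟩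
    rw [hA.add_comm, h]
  have hD : ∀ i j, Delta0 (B (var i) (var j)) := fun i j =>
    .neg _ (.ball (var j) _ trivial (.neg _ (.eq _ _ (by simp [Tm.Pure, Tm.lift, Tm.subst])
      (by simp [Tm.Pure, Tm.lift, Tm.subst]))))
  have := hA.induction (φ := Fml.or (B (var 0) (var 1)) (B (var 1) (var 0)))
    (.or _ _ (hD _ _) (hD _ _)) (fun _ => b)
    (by
      simp only [Sat, hB, val, cons]
      exact .inl ⟨b, hA.add_zero b⟩)
    (fun m hm => by
      simp only [Sat, hB, val, cons] at hm ⊢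
      rcases hm with ⟨c, hc⟩ | ⟨c, hc⟩
      · rcases hA.zero_or_succ c with rfl | ⟨d, rfl⟩
        · refine .inr ⟨A.succ A.zero, ?_⟩
          rw [← hc, hA.zero_add, hA.succ_add, hA.zero_add]
        · exact .inl ⟨d, by rw [hA.add_succ, ← hA.succ_add, hc]⟩
      · exact .inr ⟨A.succ c, by rw [hA.succ_add, hc]⟩) a
  simpa only [Sat, hB, val, cons] using this

/-- A model of `IΔ₀ + exp` as a semiring. -/
abbrev commSemiring : CommSemiring M where
  add := A.add
  zero := A.zero
  mul := A.mul
  one := A.succ A.zero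
  add_assoc := hA.add_assoc
  zero_add := hA.zero_add
  add_zero := hA.add_zero
  add_comm := hA.add_comm
  nsmul := @nsmulRec M ⟨A.zero⟩ ⟨A.add⟩
  mul_assoc := hA.mul_assoc
  mul_comm := hA.mul_comm
  left_distrib := hA.mul_add
  right_distrib a b c := by
    change A.mul (A.add a b) c = A.add (A.mul a c) (A.mul b c)
    rw [hA.mul_comm, hA.mul_add, hA.mul_comm c, hA.mul_comm c]
  zero_mul := hA.zero_mul
  mul_zero := hA.mul_zero
  one_mul a := by
    change A.mul (A.succ A.zero) a = a
    rw [hA.succ_mul, hA.zero_mul, hA.zero_add]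
  mul_one a := by
    change A.mul a (A.succ A.zero) = a
    rw [hA.mul_succ, hA.mul_zero, hA.zero_add]
  npow := @npowRec M ⟨A.succ A.zero⟩ ⟨A.mul⟩

theorem succ_eq (a : M) : letI := hA.commSemiring; A.succ a = a + 1 := by
  change A.succ a = A.add a (A.succ A.zero)
  rw [hA.add_succ, hA.add_zero]

/-- The order of a model of `IΔ₀ + exp`. -/
noncomputable abbrev linearOrder : LinearOrder M where
  le a b := ∃ c, A.add c a = b
  le_refl a := ⟨A.zero, hA.zero_add a⟩
  le_trans := by
    rintro a _ _ ⟨c, rfl⟩ ⟨d, rfl⟩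
    exact ⟨A.add d c, hA.add_assoc d c a⟩
  le_antisymm := by
    rintro a b ⟨c, rfl⟩ ⟨d, hd⟩
    have h : A.add (A.add d c) a = A.add A.zero a := by rw [hA.add_assoc, hd, hA.zero_add]
    rw [(hA.eq_zero_of_add_eq_zero (hA.add_right_cancel h)).2, hA.zero_add]
  le_total := hA.total
  toDecidableLE := Classical.decRel _

theorem add_one_le_of_lt : letI := hA.commSemiring; letI := hA.linearOrder;
    ∀ a b : M, a < b → a + 1 ≤ b := by
  let _ := hA.commSemiring
  let _ := hA.linearOrder
  intro a b h
  obtain ⟨c, hc⟩ := h.le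
  change c + a = b at hc
  rcases hA.zero_or_succ c with rfl | ⟨d, rfl⟩
  · exact (h.ne ((hA.zero_add a).symm.trans hc)).elim
  · rw [hA.succ_eq] at hc
    exact ⟨d, show d + (a + 1) = b by rw [← hc]; ring⟩

theorem canonicallyOrderedAdd : letI := hA.commSemiring; letI := hA.linearOrder;
    CanonicallyOrderedAdd M := by
  let _ := hA.commSemiring
  let _ := hA.linearOrder
  exact
    { exists_add_of_le := fun {a b} ⟨c, hc⟩ => ⟨c, hc.symm.trans (hA.add_comm c a)⟩
      le_self_add := fun a b => ⟨b, hA.add_comm b a⟩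
      le_add_self := fun a b => ⟨b, rfl⟩ }

theorem isStrictOrderedRing : letI := hA.commSemiring; letI := hA.linearOrder;
    IsStrictOrderedRing M := by
  let _ := hA.commSemiring
  let _ := hA.linearOrder
  have := hA.canonicallyOrderedAdd
  have : IsRightCancelAdd M := ⟨fun c a b h => hA.add_right_cancel h⟩
  have : IsLeftCancelAdd M := ⟨fun c a b h => by
    refine hA.add_right_cancel (c := c) ?_
    change a + c = b + c
    rw [_root_.add_comm, show c + a = c + b from h, _root_.add_comm]⟩
  have : IsOrderedAddMonoid M :=
    { add_le_add_left := by
        rintro a _ ⟨c, rfl⟩ d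
        exact ⟨c, (hA.add_assoc c a d).symm⟩ }
  have : IsOrderedCancelAddMonoid M :=
    { le_of_add_le_add_left := by
        rintro a b c ⟨d, hd⟩
        change d + (a + b) = a + c at hd
        refine ⟨d, ?_⟩
        change d + b = c
        exact _root_.add_left_cancel (a := a) (by rw [← hd]; ring) }
  have : ZeroLEOneClass M := ⟨⟨A.succ A.zero, hA.add_zero _⟩⟩
  have : Nontrivial M := ⟨A.succ A.zero, A.zero, hA.succ_ne_zero _⟩
  have pos : ∀ a b : M, a ≠ 0 → b ≠ 0 → 0 < a * b := by
    intro a b ha hb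
    obtain ⟨c, rfl⟩ := (hA.zero_or_succ a).resolve_left ha
    obtain ⟨d, rfl⟩ := (hA.zero_or_succ b).resolve_left hb
    rw [pos_iff_ne_zero]
    change A.mul _ _ ≠ A.zero
    rw [hA.mul_succ, hA.add_succ]
    exact hA.succ_ne_zero _
  have lt : ∀ a b c : M, 0 < a → b < c → a * b < a * c := by
    intro a b c ha hbc
    obtain ⟨d, rfl⟩ := exists_add_of_le hbc.le
    have hd : d ≠ 0 := by
      rintro rfl
      exact hbc.ne (_root_.add_zero b).symm
    rw [_root_.mul_add]
    exact lt_add_of_pos_right _ (pos a d ha.ne' hd)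
  exact
    { mul_lt_mul_of_pos_left := fun a ha b c hbc => lt a b c ha hbc
      mul_lt_mul_of_pos_right := fun a ha b c hbc => by
        change b * a < c * a
        rw [_root_.mul_comm b, _root_.mul_comm c]
        exact lt a b c ha hbc }

end Str.IsModel

end Models

/-! ### Coded formulas, their depth and substitution in models of `IΔ₀ + exp` -/

section Coded

variable {E : FirstOrder.Language.{u, v}} {M : Type*} {A : Str E M}

namespace Str

/-- The value of a numeral. -/
def nat (A : Str E M) : ℕ → M
  | 0 => A.zero
  | k + 1 => A.succ (A.nat k)

/-- The pairing function of the coding. -/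
def pair (A : Str E M) (a b : M) : M := A.succ (A.add (A.mul (A.add a b) (A.add a b)) a)

/-- Membership in the finite set with code `c`. -/
def Mem (A : Str E M) (i c : M) : Prop :=
  ∃ a b, c = A.add (A.add (A.mul a (A.exp (A.succ i))) (A.exp i)) b ∧
    ∃ d, A.add d (A.succ b) = A.exp i

/-- The operation `¬̇` on codes. -/
def codeNeg (A : Str E M) (a : M) : M := A.pair (A.nat 7) a
/-- The operation `∨̇` on codes. -/
def codeOr (A : Str E M) (a b : M) : M := A.pair (A.nat 6) (A.pair a b)
/-- The operation `∀̇` on codes. -/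
def codeAll (A : Str E M) (a b : M) : M := A.pair (A.nat 8) (A.pair a b)

theorem val_num (e : ℕ → M) (k : ℕ) : A.val e (num k) = A.nat k := by
  induction k with
  | zero => rfl
  | succ k ih => simp [num, val, nat, ih]

theorem val_pr (e : ℕ → M) (s t : Tm E) : A.val e (pr s t) = A.pair (A.val e s) (A.val e t) := rfl

theorem val_cNeg (e : ℕ → M) (s : Tm E) : A.val e (cNeg s) = A.codeNeg (A.val e s) := by
  rw [cNeg, val_pr, val_num, codeNeg]

theorem val_cOr (e : ℕ → M) (s t : Tm E) :
    A.val e (cOr s t) = A.codeOr (A.val e s) (A.val e t) := by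
  rw [cOr, val_pr, val_pr, val_num, codeOr]

theorem val_cAll (e : ℕ → M) (s t : Tm E) :
    A.val e (cAll s t) = A.codeAll (A.val e s) (A.val e t) := by
  rw [cAll, val_pr, val_pr, val_num, codeAll]

theorem val_cEq (e : ℕ → M) (s t : Tm E) :
    A.val e (cEq s t) = A.pair (A.nat 2) (A.pair (A.val e s) (A.val e t)) := by
  rw [cEq, val_pr, val_pr, val_num]

theorem val_cRel (e : ℕ → M) (s t : Tm E) :
    A.val e (cRel s t) = A.pair (A.nat 3) (A.pair (A.val e s) (A.val e t)) := by
  rw [cRel, val_pr, val_pr, val_num]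

theorem val_cP (e : ℕ → M) (s t : Tm E) :
    A.val e (cP s t) = A.pair (A.nat 4) (A.pair (A.val e s) (A.val e t)) := by
  rw [cP, val_pr, val_pr, val_num]

theorem val_cEps (e : ℕ → M) : A.val e cEps = A.pair (A.nat 5) A.zero := by
  rw [cEps, val_pr, val_num]
  rfl

theorem val_lift_two (a b : M) (e : ℕ → M) (t : Tm E) :
    A.val (cons b (cons a e)) (t.lift 2) = A.val e t := by
  rw [Tm.lift, val_subst]
  rfl

theorem sat_exs_two {e : ℕ → M} {φ : Fml E} :
    A.Sat e (exs 2 φ) ↔ ∃ a b, A.Sat (cons b (cons a e)) φ := by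
  simp [exs, sat_ex]

theorem sat_exs_three {e : ℕ → M} {φ : Fml E} :
    A.Sat e (exs 3 φ) ↔ ∃ a b c, A.Sat (cons c (cons b (cons a e))) φ := by
  simp [exs, sat_ex]

theorem sat_exs_four {e : ℕ → M} {φ : Fml E} :
    A.Sat e (exs 4 φ) ↔ ∃ a b c d, A.Sat (cons d (cons c (cons b (cons a e)))) φ := by
  simp [exs, sat_ex]

theorem sat_alls_two {e : ℕ → M} {φ : Fml E} :
    A.Sat e (alls 2 φ) ↔ ∀ a b, A.Sat (cons b (cons a e)) φ := by
  simp [alls, Sat]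

theorem sat_or {e : ℕ → M} {φ ψ : Fml E} : A.Sat e (or φ ψ) ↔ A.Sat e φ ∨ A.Sat e ψ := Iff.rfl

theorem sat_neg {e : ℕ → M} {φ : Fml E} : A.Sat e (neg φ) ↔ ¬ A.Sat e φ := Iff.rfl

theorem sat_eq {e : ℕ → M} {s t : Tm E} : A.Sat e (eq s t) ↔ A.val e s = A.val e t := Iff.rfl

theorem sat_mem {e : ℕ → M} {s t : Tm E} :
    A.Sat e (mem s t) ↔ A.Mem (A.val e s) (A.val e t) := by
  simp [mem, sat_exs_two, sat_and, sat_eq, lt, sat_le, val, val_lift_two, cons, Mem]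

/-- The number `u` is not a negation, disjunction or quantification. -/
def Atomic (A : Str E M) (u : M) : Prop :=
  (∀ a, u ≠ A.codeNeg a) ∧ (∀ a b, u ≠ A.codeOr a b) ∧ ∀ a b, u ≠ A.codeAll a b

/-- The closure condition on a relation `R` between formulas and their depths, at the pair
`(u, m)`. -/
def DepthStep (A : Str E M) (R : M → M → Prop) (u m : M) : Prop :=
  (m = A.zero ∧ A.Atomic u) ∨
  (∃ y k, u = A.codeNeg y ∧ m = A.succ k ∧ R y k) ∨
  (∃ y k y' k', u = A.codeOr y y' ∧ (R y k ∧ R y' k') ∧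
    (((∃ d, A.add d k = k') ∧ m = A.succ k') ∨ ((∃ d, A.add d k' = k) ∧ m = A.succ k))) ∨
  ∃ i y k, u = A.codeAll i y ∧ m = A.succ k ∧ R y k

theorem DepthStep.mono {R R' : M → M → Prop} (h : ∀ u m, R u m → R' u m) {u m : M}
    (hu : A.DepthStep R u m) : A.DepthStep R' u m := by
  rcases hu with hu | ⟨y, k, h1, h2, h3⟩ | ⟨y, k, y', k', h1, ⟨h2, h3⟩, h4⟩ | ⟨i, y, k, h1, h2, h3⟩
  · exact .inl hu
  · exact .inr (.inl ⟨y, k, h1, h2, h _ _ h3⟩)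
  · exact .inr (.inr (.inl ⟨y, k, y', k', h1, ⟨h _ _ h2, h _ _ h3⟩, h4⟩))
  · exact .inr (.inr (.inr ⟨i, y, k, h1, h2, h _ _ h3⟩))

theorem sat_depthF {e : ℕ → M} {s t : Tm E} : A.Sat e (depthF s t) ↔
    ∃ c, A.Mem (A.pair (A.val e s) (A.val e t)) c ∧
      ∀ u m, A.Mem (A.pair u m) c → A.DepthStep (fun u m => A.Mem (A.pair u m) c) u m := by
  simp only [depthF, sat_ex, sat_and, sat_mem, val_pr, val_lift_one, sat_alls_two, sat_imp, sat_or,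
    sat_eq, sat_neg, sat_exs_two, sat_exs_three, sat_exs_four, sat_le, val_cNeg, val_cOr, val_cAll,
    val, cons, DepthStep, Atomic, not_or, not_exists, ne_eq]

/-- The depth of `u` is at most the standard number `k`. -/
inductive DepthLe (A : Str E M) : M → ℕ → Prop
  | atomic {u k} : A.Atomic u → DepthLe A u k
  | neg {a k} : DepthLe A a k → DepthLe A (A.codeNeg a) (k + 1)
  | or {a b k} : DepthLe A a k → DepthLe A b k → DepthLe A (A.codeOr a b) (k + 1)
  | all {i a k} : DepthLe A a k → DepthLe A (A.codeAll i a) (k + 1)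

/-- The closure condition on a relation `R` between formulas and the results of a substitution, at
the pair `(u, w)`. -/
def SubStep (A : Str E M) (R : M → M → Prop) (u w : M) : Prop :=
  (A.Atomic u ∧ A.Atomic w) ∨
  (∃ a a', u = A.codeNeg a ∧ w = A.codeNeg a' ∧ R a a') ∨
  (∃ a a' b b', u = A.codeOr a b ∧ w = A.codeOr a' b' ∧ R a a' ∧ R b b') ∨
  (∃ i a a', u = A.codeAll i a ∧ w = A.codeAll i a' ∧ R a a') ∨
  w = u

namespace IsModel

variable (hA : A.IsModel)
include hA

theorem pair_inj {a b c d : M} : A.pair a b = A.pair c d ↔ a = c ∧ b = d := by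
  refine ⟨fun h => ?_, by rintro ⟨rfl, rfl⟩; rfl⟩
  let _ := hA.commSemiring
  let _ := hA.linearOrder
  have := hA.canonicallyOrderedAdd
  have := hA.isStrictOrderedRing
  exact pair_injective hA.add_one_le_of_lt (hA.succ_inj h)

/-- Every finite subset of a model has a code in it, even if its elements are nonstandard. -/
theorem exists_code (F : Finset M) : ∃ c, ∀ y, A.Mem y c ↔ y ∈ F := by
  let _ := hA.commSemiring
  let _ := hA.linearOrder
  have := hA.canonicallyOrderedAdd
  have := hA.isStrictOrderedRing
  have hlt : ∀ a b : M, (∃ d, A.add d (A.succ a) = b) ↔ a < b := by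
    intro a b
    rw [hA.succ_eq]
    exact ⟨fun h => (lt_add_one a).trans_le h, hA.add_one_le_of_lt a b⟩
  obtain ⟨c, hc⟩ := exists_binary_code (ex := A.exp) hA.add_one_le_of_lt hA.exp_ne_zero
    (fun a => by rw [← hA.succ_eq]; exact hA.exp_succ a) hA.exp_add F
  refine ⟨c, fun y => ?_⟩
  rw [← hc y, ← hA.succ_eq]
  simp only [Mem, hlt]
  rfl

theorem nat_inj {i j : ℕ} : A.nat i = A.nat j ↔ i = j := by
  refine ⟨fun h => ?_, fun h => h ▸ rfl⟩
  induction i generalizing j with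
  | zero =>
    cases j with
    | zero => rfl
    | succ j => exact (hA.succ_ne_zero _ h.symm).elim
  | succ i ih =>
    cases j with
    | zero => exact (hA.succ_ne_zero _ h).elim
    | succ j => rw [ih (hA.succ_inj h)]

theorem le_nat {d n : M} {k : ℕ} (h : A.add d n = A.nat k) : ∃ j ≤ k, n = A.nat j := by
  induction k generalizing n with
  | zero => exact ⟨0, le_rfl, (hA.eq_zero_of_add_eq_zero h).2⟩
  | succ k ih =>
    rcases hA.zero_or_succ n with rfl | ⟨m, rfl⟩
    · exact ⟨0, Nat.zero_le _, rfl⟩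
    · rw [hA.add_succ] at h
      obtain ⟨j, hj, rfl⟩ := ih (hA.succ_inj h)
      exact ⟨j + 1, Nat.succ_le_succ hj, rfl⟩

theorem nat_add (i j : ℕ) : A.add (A.nat i) (A.nat j) = A.nat (i + j) := by
  induction j with
  | zero => exact hA.add_zero _
  | succ j ih => rw [nat, hA.add_succ, ih]; rfl

theorem exists_add_nat {i j : ℕ} (h : i ≤ j) : ∃ d, A.add d (A.nat i) = A.nat j :=
  ⟨A.nat (j - i), by rw [hA.nat_add, Nat.sub_add_cancel h]⟩

theorem eq_nat_of_succ {j : ℕ} {n : M} (h : A.nat j = A.succ n) : ∃ i, j = i + 1 ∧ n = A.nat i := by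
  cases j with
  | zero => exact (hA.succ_ne_zero _ h.symm).elim
  | succ i => exact ⟨i, rfl, (hA.succ_inj h).symm⟩

theorem codeNeg_inj {a b : M} : A.codeNeg a = A.codeNeg b ↔ a = b := by
  simp [codeNeg, hA.pair_inj]

theorem codeOr_inj {a b c d : M} : A.codeOr a b = A.codeOr c d ↔ a = c ∧ b = d := by
  simp [codeOr, hA.pair_inj]

theorem codeAll_inj {a b c d : M} : A.codeAll a b = A.codeAll c d ↔ a = c ∧ b = d := by
  simp [codeAll, hA.pair_inj]

theorem codeNeg_ne_codeOr {a b c : M} : A.codeNeg a ≠ A.codeOr b c := by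
  simp [codeNeg, codeOr, hA.pair_inj, hA.nat_inj]

theorem codeNeg_ne_codeAll {a b c : M} : A.codeNeg a ≠ A.codeAll b c := by
  simp [codeNeg, codeAll, hA.pair_inj, hA.nat_inj]

theorem codeOr_ne_codeAll {a b c d : M} : A.codeOr a b ≠ A.codeAll c d := by
  simp [codeOr, codeAll, hA.pair_inj, hA.nat_inj]

theorem atomic_pair {i : ℕ} (a : M) (hi : i < 6) : A.Atomic (A.pair (A.nat i) a) := by
  refine ⟨fun b h => ?_, fun b c h => ?_, fun b c h => ?_⟩
  all_goals
    have := hA.nat_inj.1 (hA.pair_inj.1 h).1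
    omega

/-- If the relation `R` between formulas and depths is closed under passing to constituents, then
the standard depths that it assigns are correct. -/
theorem depthLe_of_closed {R : M → M → Prop} (hR : ∀ u m, R u m → A.DepthStep R u m) {k j : ℕ}
    (hj : j ≤ k) {u : M} (h : R u (A.nat j)) : A.DepthLe u k := by
  induction k generalizing j u with
  | zero =>
    obtain rfl := Nat.le_zero.1 hj
    rcases hR _ _ h with hu | ⟨y, m, -, h2, -⟩ | ⟨y, m, y', m', -, -, ⟨-, h2⟩ | ⟨-, h2⟩⟩ |
      ⟨i, y, m, -, h2, -⟩
    · exact .atomic hu.2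
    all_goals exact (hA.succ_ne_zero _ h2.symm).elim
  | succ k ih =>
    rcases hR _ _ h with hu | ⟨y, m, rfl, h2, h3⟩ | ⟨y, m, y', m', rfl, ⟨h3, h4⟩, h5⟩ |
      ⟨i, y, m, rfl, h2, h3⟩
    · exact .atomic hu.2
    · obtain ⟨i, rfl, rfl⟩ := hA.eq_nat_of_succ h2
      exact .neg (ih (by omega) h3)
    · rcases h5 with ⟨⟨d, hd⟩, h2⟩ | ⟨⟨d, hd⟩, h2⟩
      all_goals
        obtain ⟨i, rfl, rfl⟩ := hA.eq_nat_of_succ h2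
        obtain ⟨i', hi', rfl⟩ := hA.le_nat hd
        exact .or (ih (by omega) h3) (ih (by omega) h4)
    · obtain ⟨i, rfl, rfl⟩ := hA.eq_nat_of_succ h2
      exact .all (ih (by omega) h3)

/-- A formula of standard depth has finitely many subformulas outside its atoms, so their depths
form a finite set, which has a code. -/
theorem exists_finset_of_depthLe {u : M} {k : ℕ} (h : A.DepthLe u k) :
    ∃ j ≤ k, ∃ F : Set (M × M), F.Finite ∧ (u, A.nat j) ∈ F ∧
      ∀ a m, (a, m) ∈ F → A.DepthStep (fun a m => (a, m) ∈ F) a m := by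
  have ins : ∀ (F : Set (M × M)) (u m : M),
      (∀ a m, (a, m) ∈ F → A.DepthStep (fun a m => (a, m) ∈ F) a m) →
      A.DepthStep (fun a m => (a, m) ∈ F) u m →
      ∀ a m', (a, m') ∈ insert (u, m) F →
        A.DepthStep (fun a m' => (a, m') ∈ insert (u, m) F) a m' := by
    intro F u m hF hu a m' ham
    refine DepthStep.mono (R := fun a m => (a, m) ∈ F) (fun _ _ => Set.mem_insert_of_mem _) ?_
    rcases ham with h | h
    · obtain ⟨rfl, rfl⟩ := Prod.mk.inj h
      exact hu
    · exact hF _ _ h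
  induction h with
  | @atomic u k hu =>
    refine ⟨0, Nat.zero_le _, {(u, A.zero)}, Set.finite_singleton _, rfl, fun a m h => ?_⟩
    obtain ⟨rfl, rfl⟩ := Prod.mk.inj h
    exact .inl ⟨rfl, hu⟩
  | @neg a k _ ih =>
    obtain ⟨j, hj, F, hF, h1, h2⟩ := ih
    exact ⟨j + 1, by omega, insert (A.codeNeg a, A.nat (j + 1)) F, hF.insert _, .inl rfl,
      ins _ _ _ h2 (.inr (.inl ⟨a, A.nat j, rfl, rfl, h1⟩))⟩
  | @all i a k _ ih =>
    obtain ⟨j, hj, F, hF, h1, h2⟩ := ih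
    exact ⟨j + 1, by omega, insert (A.codeAll i a, A.nat (j + 1)) F, hF.insert _, .inl rfl,
      ins _ _ _ h2 (.inr (.inr (.inr ⟨i, a, A.nat j, rfl, rfl, h1⟩)))⟩
  | @or a b k _ _ ih ih' =>
    obtain ⟨j, hj, F, hF, h1, h2⟩ := ih
    obtain ⟨j', hj', F', hF', h1', h2'⟩ := ih'
    refine ⟨max j j' + 1, by omega, insert (A.codeOr a b, A.nat (max j j' + 1)) (F ∪ F'),
      (hF.union hF').insert _, .inl rfl, ins _ _ _ ?_ ?_⟩
    · rintro x m (h | h)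
      · exact (h2 _ _ h).mono fun _ _ => .inl
      · exact (h2' _ _ h).mono fun _ _ => .inr
    · refine .inr (.inr (.inl ⟨a, A.nat j, b, A.nat j', rfl, ⟨.inl h1, .inr h1'⟩, ?_⟩))
      rcases le_total j j' with hjj | hjj
      · exact .inl ⟨hA.exists_add_nat hjj, by rw [max_eq_right hjj]; rfl⟩
      · exact .inr ⟨hA.exists_add_nat hjj, by rw [max_eq_left hjj]; rfl⟩

/-- Below a standard bound, `ḋ(x) ≤ k` has its intended meaning in all models of `IΔ₀ + exp`. -/
theorem sat_depthLe {e : ℕ → M} {t : Tm E} {k : ℕ} :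
    A.Sat e (depthLe t (num k)) ↔ A.DepthLe (A.val e t) k := by
  simp only [depthLe, sat_ex, sat_and, sat_depthF, sat_le, val_lift_one, val, cons, val_num]
  constructor
  · rintro ⟨n, ⟨c, h1, h2⟩, d, hd⟩
    obtain ⟨j, hj, rfl⟩ := hA.le_nat hd
    exact hA.depthLe_of_closed h2 hj h1
  · intro h
    obtain ⟨j, hj, F, hF, h1, h2⟩ := hA.exists_finset_of_depthLe h
    classical
    obtain ⟨c, hc⟩ := hA.exists_code (hF.toFinset.image fun p => A.pair p.1 p.2)
    have hc' : ∀ u m, A.Mem (A.pair u m) c ↔ (u, m) ∈ F := by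
      intro u m
      simp [hc, hA.pair_inj]
    refine ⟨A.nat j, ⟨c, (hc' _ _).2 h1, fun u m hum => ?_⟩, hA.exists_add_nat hj⟩
    simp only [hc'] at hum ⊢
    exact h2 u m hum

/-- A coded substitution provides a relation that is closed under passing to constituents. What it
does to atomic formulas has no effect on the depth and is forgotten. -/
theorem sat_subF {P : Coding E} {e : ℕ → M} {x y z w : Tm E} (h : A.Sat e (subF P x y z w)) :
    ∃ R : M → M → Prop, R (A.val e x) (A.val e w) ∧ ∀ u w, R u w → A.SubStep R u w := by
  have ha : ∀ (e : ℕ → M) (x y z w : Tm E), A.Sat e (substAtom x y z w) →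
      A.Atomic (A.val e x) ∧ A.Atomic (A.val e w) := by
    intro e x y z w h
    rw [substAtom, sat_or, sat_or, sat_or, sat_exs_four, sat_exs_three, sat_exs_three] at h
    have lift_three : ∀ a b c e (t : Tm E),
        A.val (cons c (cons b (cons a e))) (t.lift 3) = A.val e t := by
      intro a b c e t
      rw [Tm.lift, val_subst]
      rfl
    have lift_four : ∀ a b c d e (t : Tm E),
        A.val (cons d (cons c (cons b (cons a e)))) (t.lift 4) = A.val e t := by
      intro a b c d e t
      rw [Tm.lift, val_subst]
      rfl
    simp only [sat_and, sat_eq, lift_three, lift_four, val_cEq, val_cRel, val_cP, val_cEps] at h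
    rcases h with ⟨_, _, _, _, h, h', _⟩ | ⟨_, _, _, h, h', _⟩ | ⟨_, _, _, h, h', _⟩ | ⟨h, h'⟩
    all_goals
      rw [h, h']
      exact ⟨hA.atomic_pair _ (by omega), hA.atomic_pair _ (by omega)⟩
  rw [subF, sat_and, sat_and] at h
  obtain ⟨c, h⟩ := sat_ex.1 h.2.2
  rw [sat_and, sat_alls_two, sat_mem, val_pr, val_lift_one, val_lift_one] at h
  refine ⟨fun u w => A.Mem (A.pair u w) c, h.1, fun u w huw => ?_⟩
  have h2 := h.2 u w
  rw [sat_imp, sat_or] at h2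
  rcases h2 (sat_mem.2 huw) with h2 | h2
  · exact .inl (ha _ _ _ _ _ h2)
  · simp only [sat_or, sat_and, sat_mem, val_pr, sat_eq, sat_ex, sat_exs_two, sat_exs_three,
      sat_exs_four, val_cNeg, val_cOr, val_cAll, val, cons] at h2
    rcases h2 with ⟨a, a', h3, h4, h5⟩ | ⟨a, a', b, b', h3, h4, h5, h6⟩ |
      ⟨i, a, a', -, h3, h4, h5⟩ | ⟨_, _, h4⟩
    · exact .inr (.inl ⟨a, a', h3, h4, h5⟩)
    · exact .inr (.inr (.inl ⟨a, a', b, b', h3, h4, h5, h6⟩))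
    · exact .inr (.inr (.inr (.inl ⟨i, a, a', h3, h4, h5⟩)))
    · exact .inr (.inr (.inr (.inr h4)))

/-- Substitution does not raise the depth. -/
theorem depthLe_of_subStep {R : M → M → Prop} (hR : ∀ u w, R u w → A.SubStep R u w) {u : M} {k : ℕ}
    (hu : A.DepthLe u k) {w : M} (h : R u w) : A.DepthLe w k := by
  induction hu generalizing w with
  | atomic hu =>
    rcases hR _ _ h with ⟨_, hw⟩ | ⟨a, _, rfl, _⟩ | ⟨a, _, b, _, rfl, _⟩ | ⟨i, a, _, rfl, _⟩ | rfl
    · exact .atomic hw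
    · exact (hu.1 _ rfl).elim
    · exact (hu.2.1 _ _ rfl).elim
    · exact (hu.2.2 _ _ rfl).elim
    · exact .atomic hu
  | neg ha ih =>
    rcases hR _ _ h with ⟨hu, _⟩ | ⟨a, _, h1, rfl, h2⟩ | ⟨a, _, b, _, h1, _⟩ | ⟨i, a, _, h1, _⟩ | rfl
    · exact (hu.1 _ rfl).elim
    · exact .neg (ih (hA.codeNeg_inj.1 h1 ▸ h2))
    · exact (hA.codeNeg_ne_codeOr h1).elim
    · exact (hA.codeNeg_ne_codeAll h1).elim
    · exact .neg ha
  | or ha hb ih ih' =>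
    rcases hR _ _ h with ⟨hu, _⟩ | ⟨a, _, h1, _⟩ | ⟨a, _, b, _, h1, rfl, h2, h3⟩ |
      ⟨i, a, _, h1, _⟩ | rfl
    · exact (hu.2.1 _ _ rfl).elim
    · exact (hA.codeNeg_ne_codeOr h1.symm).elim
    · obtain ⟨rfl, rfl⟩ := hA.codeOr_inj.1 h1
      exact .or (ih h2) (ih' h3)
    · exact (hA.codeOr_ne_codeAll h1).elim
    · exact .or ha hb
  | all ha ih =>
    rcases hR _ _ h with ⟨hu, _⟩ | ⟨a, _, h1, _⟩ | ⟨a, _, b, _, h1, _⟩ |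
      ⟨i, a, _, h1, rfl, h2⟩ | rfl
    · exact (hu.2.2 _ _ rfl).elim
    · exact (hA.codeNeg_ne_codeAll h1.symm).elim
    · exact (hA.codeOr_ne_codeAll h1.symm).elim
    · obtain ⟨rfl, rfl⟩ := hA.codeAll_inj.1 h1
      exact .all (ih h2)
    · exact .all ha

theorem depthLe_codeNeg {a : M} {k : ℕ} (h : A.DepthLe (A.codeNeg a) k) :
    ∃ j, k = j + 1 ∧ A.DepthLe a j := by
  generalize hu : A.codeNeg a = u at h
  cases h with
  | atomic h => exact (h.1 _ hu.symm).elim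
  | neg h => exact ⟨_, rfl, hA.codeNeg_inj.1 hu ▸ h⟩
  | or => exact (hA.codeNeg_ne_codeOr hu).elim
  | all => exact (hA.codeNeg_ne_codeAll hu).elim

theorem depthLe_codeOr {a b : M} {k : ℕ} (h : A.DepthLe (A.codeOr a b) k) :
    ∃ j, k = j + 1 ∧ A.DepthLe a j ∧ A.DepthLe b j := by
  generalize hu : A.codeOr a b = u at h
  cases h with
  | atomic h => exact (h.2.1 _ _ hu.symm).elim
  | neg => exact (hA.codeNeg_ne_codeOr hu.symm).elim
  | or h h' =>
    obtain ⟨rfl, rfl⟩ := hA.codeOr_inj.1 hu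
    exact ⟨_, rfl, h, h'⟩
  | all => exact (hA.codeOr_ne_codeAll hu).elim

theorem depthLe_codeAll {i a : M} {k : ℕ} (h : A.DepthLe (A.codeAll i a) k) :
    ∃ j, k = j + 1 ∧ A.DepthLe a j := by
  generalize hu : A.codeAll i a = u at h
  cases h with
  | atomic h => exact (h.2.2 _ _ hu.symm).elim
  | neg => exact (hA.codeNeg_ne_codeAll hu.symm).elim
  | or => exact (hA.codeOr_ne_codeAll hu.symm).elim
  | all h =>
    obtain ⟨rfl, rfl⟩ := hA.codeAll_inj.1 hu
    exact ⟨_, rfl, h⟩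

end IsModel

end Str

end Coded

/-! ### Arithmetical entailment -/

section Entailment

variable {E : FirstOrder.Language.{u, v}}

theorem Fml.and_arith {φ ψ : Fml E} : (and φ ψ).Arith ↔ φ.Arith ∧ ψ.Arith := Iff.rfl

theorem Fml.exs_arith {n : ℕ} {φ : Fml E} : (exs n φ).Arith ↔ φ.Arith := by
  induction n with
  | zero => rfl
  | succ n ih => simpa [exs, ex, Fml.Arith] using ih

theorem Fml.alls_arith {n : ℕ} {φ : Fml E} : (alls n φ).Arith ↔ φ.Arith := by
  induction n with
  | zero => rfl
  | succ n ih => simpa [alls, Fml.Arith] using ih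

theorem Fml.ors_arith {l : List (Fml E)} (h : ∀ φ ∈ l, φ.Arith) : (ors l).Arith := by
  induction l with
  | nil => trivial
  | cons φ l ih => exact ⟨h φ (by simp), ih fun ψ hψ => h ψ (by simp [hψ])⟩

theorem Fml.Pure.arith {φ : Fml E} (h : φ.Pure) : φ.Arith := by
  induction φ <;> simp_all [Fml.Pure, Fml.Arith]

theorem mem_arith (s t : Tm E) : (mem s t).Arith := by
  simp [mem, exs_arith, Fml.and, lt, le, ex, Fml.Arith]

theorem isFn_arith (P : Coding E) (q n : Tm E) : (isFn P q n).Arith := by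
  refine ors_arith fun φ hφ => ?_
  obtain ⟨f, -, rfl⟩ := List.mem_map.1 hφ
  simp [Fml.and, Fml.Arith]

theorem isRel_arith (P : Coding E) (q n : Tm E) : (isRel P q n).Arith :=
  (subst_arith _).2 P.relF_pure.arith

theorem termIn_arith (P : Coding E) (x e : Tm E) : (termIn P x e).Arith := by
  simp [termIn, exs_arith, Fml.and, imp, ex, Fml.Arith, mem_arith, isFn_arith]

theorem listIn_arith (P : Coding E) (l n e : Tm E) : (listIn P l n e).Arith := by
  simp [listIn, exs_arith, Fml.and, imp, ex, Fml.Arith, mem_arith, termIn_arith]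

theorem sentF_arith (P : Coding E) (x : Tm E) : (sentF P x).Arith := by
  simp [sentF, formIn, atomIn, exs_arith, alls_arith, Fml.and, imp, iff, ex, Fml.Arith, mem_arith,
    termIn_arith, listIn_arith, isRel_arith]

theorem subF_arith (P : Coding E) (x y z w : Tm E) : (subF P x y z w).Arith := by
  simp [subF, termF, substAtom, substTerm, substList, substClosed, exs_arith, alls_arith, Fml.and, imp,
    ex, Fml.Arith, mem_arith, termIn_arith]

theorem depthLe_arith (x k : Tm E) : (depthLe x k).Arith := by
  simp [depthLe, depthF, exs_arith, alls_arith, Fml.and, imp, le, ex, Fml.Arith, mem_arith]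

theorem valF_arith (P : Coding E) (x w : Tm E) : (valF P x w).Arith := by
  have h : (ors ((fnSyms P).map fun f => exs 2 (and (eq (var 3) (cFn (num f.code) (var 1)))
      (and (mem (pr (var 1) (var 0)) (var 4)) (applyF f (var 0) (var 2)))))).Arith := by
    refine ors_arith fun φ hφ => ?_
    obtain ⟨f, -, rfl⟩ := List.mem_map.1 hφ
    simp [applyF, exs_arith, Fml.and, Fml.Arith, mem_arith]
  simp [valF, h, exs_arith, alls_arith, and_arith, imp, Fml.Arith, mem_arith]

theorem eqF_arith (P : Coding E) (r s : Tm E) : (eqF P r s).Arith := by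
  simp [eqF, alls_arith, Fml.and, imp, Fml.Arith, valF_arith]

theorem Delta0.arith {φ : Fml E} (h : Delta0 φ) : φ.Arith := by
  induction h with
  | eq => trivial
  | neg _ _ ih => exact ih
  | or _ _ _ _ ih ih' => exact ⟨ih, ih'⟩
  | ball t φ _ _ ih => exact ⟨trivial, ih⟩

theorem IDexp.arith {φ : Fml E} (h : IDexp E φ) : φ.Arith := by
  cases h with
  | induction φ hφ =>
    simp [Fml.and, imp, inst, Fml.Arith, subst_arith, hφ.arith]
  | _ => simp [imp, ex, Fml.Arith]

/-- Semantic entailment of a sequent in models of `IΔ₀ + exp`, where the formulas that are not in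
`L` are disregarded. -/
def Valid (Γ Δ : Finset (Fml E)) : Prop :=
  ∀ (M : Type u) (A : Str E M), A.IsModel → ∀ e, (∀ γ ∈ Γ, γ.Arith → A.Sat e γ) →
    ∃ δ ∈ Δ, δ.Arith ∧ A.Sat e δ

/-- Semantic entailment of a formula of `L` in models of `IΔ₀ + exp`. -/
def Entails (Γ : Finset (Fml E)) (α : Fml E) : Prop :=
  α.Arith ∧ ∀ (M : Type u) (A : Str E M), A.IsModel → ∀ e, (∀ γ ∈ Γ, γ.Arith → A.Sat e γ) →
    A.Sat e α

theorem Entails.valid {Γ Δ : Finset (Fml E)} {α : Fml E} (h : Entails Γ α) (hα : α ∈ Δ) :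
    Valid Γ Δ := fun M A hA e he => ⟨α, hα, h.1, h.2 M A hA e he⟩

theorem Entails.mono {Γ Γ' : Finset (Fml E)} {α : Fml E} (h : Entails Γ α) (hΓ : Γ ⊆ Γ') :
    Entails Γ' α := ⟨h.1, fun M A hA e he => h.2 M A hA e fun γ hγ => he γ (hΓ hγ)⟩

theorem Entails.insert {Γ : Finset (Fml E)} {α : Fml E} (h : Entails Γ α) (β : Fml E) :
    Entails (insert β Γ) α := h.mono (Finset.subset_insert _ _)

theorem Entails.of_mem {Γ : Finset (Fml E)} {α : Fml E} (ha : α.Arith) (h : α ∈ Γ) :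
    Entails Γ α := ⟨ha, fun _ _ _ _ he => he α h ha⟩

theorem Entails.eq_of_mem {Γ : Finset (Fml E)} {s t : Tm E} (h : eq s t ∈ Γ) :
    Entails Γ (eq s t) := .of_mem trivial h

theorem Entails.eq_refl (Γ : Finset (Fml E)) (s : Tm E) : Entails Γ (eq s s) :=
  ⟨trivial, fun _ _ _ _ _ => rfl⟩

theorem Entails.eq_symm {Γ : Finset (Fml E)} {s t : Tm E} (h : Entails Γ (eq s t)) :
    Entails Γ (eq t s) := ⟨trivial, fun M A hA e he => (h.2 M A hA e he).symm⟩

theorem Entails.eq_trans {Γ : Finset (Fml E)} {r s t : Tm E} (h : Entails Γ (eq r s))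
    (h' : Entails Γ (eq s t)) : Entails Γ (eq r t) :=
  ⟨trivial, fun M A hA e he => (h.2 M A hA e he).trans (h'.2 M A hA e he)⟩

theorem Entails.sentF {P : Coding E} {Γ : Finset (Fml E)} {s t : Tm E}
    (h : Entails Γ (eq s t)) (hs : Entails Γ (sentF P s)) : Entails Γ (sentF P t) := by
  refine ⟨sentF_arith P t, fun M A hA e he => ?_⟩
  have key : ∀ t, CompTruth.sentF P t = (CompTruth.sentF P (var 0)).subst fun _ => t := by
    intro t
    rw [sentF_subst]
    rfl
  have h1 := hs.2 M A hA e he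
  rw [key, Str.sat_subst] at h1 ⊢
  rwa [← (h.2 M A hA e he : A.val e s = A.val e t)]

theorem Entails.eqF {P : Coding E} {Γ : Finset (Fml E)} {s t s' t' : Tm E}
    (h : Entails Γ (eq s s')) (h' : Entails Γ (eq t t')) (hs : Entails Γ (eqF P s t)) :
    Entails Γ (eqF P s' t') := by
  refine ⟨eqF_arith P s' t', fun M A hA e he => ?_⟩
  have key : ∀ s t, CompTruth.eqF P s t =
      (CompTruth.eqF P (var 0) (var 1)).subst (cons s fun _ => t) := by
    intro s t
    rw [eqF_subst]
    rfl
  have val_cons : ∀ s t : Tm E, (fun i => A.val e (cons s (fun _ => t) i)) =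
      cons (A.val e s) fun _ => A.val e t := by
    intro s t
    funext i
    cases i <;> rfl
  have h1 := hs.2 M A hA e he
  rw [key, Str.sat_subst, val_cons] at h1 ⊢
  rwa [← (h.2 M A hA e he : A.val e s = A.val e s'), ← (h'.2 M A hA e he : A.val e t = A.val e t')]

theorem Entails.subF {P : Coding E} {Γ : Finset (Fml E)} {x y x' y' z w : Tm E}
    (h : Entails Γ (eq x x')) (h' : Entails Γ (eq y y')) (hs : Entails Γ (subF P x y z w)) :
    Entails Γ (subF P x' y' z w) := by
  refine ⟨subF_arith P x' y' z w, fun M A hA e he => ?_⟩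
  have key : ∀ x y, CompTruth.subF P x y z w =
      (CompTruth.subF P (var 0) (var 1) (var 2) (var 3)).subst
        (cons x (cons y (cons z fun _ => w))) := by
    intro x y
    rw [subF_subst]
    rfl
  have val_cons : ∀ x y : Tm E, (fun i => A.val e (cons x (cons y (cons z fun _ => w)) i)) =
      cons (A.val e x) (cons (A.val e y) fun i => A.val e (cons z (fun _ => w) i)) := by
    intro x y
    funext i
    rcases i with _ | _ | i <;> rfl
  have h1 := hs.2 M A hA e he
  rw [key, Str.sat_subst, val_cons] at h1 ⊢
  rwa [← (h.2 M A hA e he : A.val e x = A.val e x'), ← (h'.2 M A hA e he : A.val e y = A.val e y')]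

section Components

variable {Γ : Finset (Fml E)} {φ a b a' b' : Tm E}

theorem Entails.cNeg_inj (h : Entails Γ (eq φ (cNeg a))) (h' : Entails Γ (eq φ (cNeg a'))) :
    Entails Γ (eq a a') := by
  refine ⟨trivial, fun M A hA e he => ?_⟩
  have h1 := (h.2 M A hA e he).symm.trans (h'.2 M A hA e he)
  rwa [Str.val_cNeg, Str.val_cNeg, hA.codeNeg_inj] at h1

theorem Entails.cOr_inj (h : Entails Γ (eq φ (cOr a b))) (h' : Entails Γ (eq φ (cOr a' b'))) :
    Entails Γ (eq a a') ∧ Entails Γ (eq b b') := by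
  refine ⟨⟨trivial, fun M A hA e he => ?_⟩, ⟨trivial, fun M A hA e he => ?_⟩⟩
  all_goals
    have h1 := (h.2 M A hA e he).symm.trans (h'.2 M A hA e he)
    rw [Str.val_cOr, Str.val_cOr, hA.codeOr_inj] at h1
  · exact h1.1
  · exact h1.2

theorem Entails.cAll_inj (h : Entails Γ (eq φ (cAll a b))) (h' : Entails Γ (eq φ (cAll a' b'))) :
    Entails Γ (eq a a') ∧ Entails Γ (eq b b') := by
  refine ⟨⟨trivial, fun M A hA e he => ?_⟩, ⟨trivial, fun M A hA e he => ?_⟩⟩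
  all_goals
    have h1 := (h.2 M A hA e he).symm.trans (h'.2 M A hA e he)
    rw [Str.val_cAll, Str.val_cAll, hA.codeAll_inj] at h1
  · exact h1.1
  · exact h1.2

theorem Entails.cEq_inj (h : Entails Γ (eq φ (cEq a b))) (h' : Entails Γ (eq φ (cEq a' b'))) :
    Entails Γ (eq a a') ∧ Entails Γ (eq b b') := by
  refine ⟨⟨trivial, fun M A hA e he => ?_⟩, ⟨trivial, fun M A hA e he => ?_⟩⟩
  all_goals
    have h1 := (h.2 M A hA e he).symm.trans (h'.2 M A hA e he)
    rw [Str.val_cEq, Str.val_cEq, hA.pair_inj, hA.pair_inj] at h1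
  · exact h1.2.1
  · exact h1.2.2

theorem Entails.cNeg_cOr (h : Entails Γ (eq φ (cNeg a))) (h' : Entails Γ (eq φ (cOr a' b'))) :
    Valid Γ ∅ := fun M A hA e he => by
  have h1 := (h.2 M A hA e he).symm.trans (h'.2 M A hA e he)
  rw [Str.val_cNeg, Str.val_cOr] at h1
  exact (hA.codeNeg_ne_codeOr h1).elim

theorem Entails.cNeg_cAll (h : Entails Γ (eq φ (cNeg a))) (h' : Entails Γ (eq φ (cAll a' b'))) :
    Valid Γ ∅ := fun M A hA e he => by
  have h1 := (h.2 M A hA e he).symm.trans (h'.2 M A hA e he)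
  rw [Str.val_cNeg, Str.val_cAll] at h1
  exact (hA.codeNeg_ne_codeAll h1).elim

theorem Entails.cOr_cAll (h : Entails Γ (eq φ (cOr a b))) (h' : Entails Γ (eq φ (cAll a' b'))) :
    Valid Γ ∅ := fun M A hA e he => by
  have h1 := (h.2 M A hA e he).symm.trans (h'.2 M A hA e he)
  rw [Str.val_cOr, Str.val_cAll] at h1
  exact (hA.codeOr_ne_codeAll h1).elim

theorem Entails.cEq_cNeg (h : Entails Γ (eq φ (cEq a b))) (h' : Entails Γ (eq φ (cNeg a'))) :
    Valid Γ ∅ := fun M A hA e he => by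
  have h1 := (h.2 M A hA e he).symm.trans (h'.2 M A hA e he)
  rw [Str.val_cEq, Str.val_cNeg] at h1
  exact ((hA.atomic_pair _ (by omega)).1 _ h1).elim

theorem Entails.cEq_cOr (h : Entails Γ (eq φ (cEq a b))) (h' : Entails Γ (eq φ (cOr a' b'))) :
    Valid Γ ∅ := fun M A hA e he => by
  have h1 := (h.2 M A hA e he).symm.trans (h'.2 M A hA e he)
  rw [Str.val_cEq, Str.val_cOr] at h1
  exact ((hA.atomic_pair _ (by omega)).2.1 _ _ h1).elim

theorem Entails.cEq_cAll (h : Entails Γ (eq φ (cEq a b))) (h' : Entails Γ (eq φ (cAll a' b'))) :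
    Valid Γ ∅ := fun M A hA e he => by
  have h1 := (h.2 M A hA e he).symm.trans (h'.2 M A hA e he)
  rw [Str.val_cEq, Str.val_cAll] at h1
  exact ((hA.atomic_pair _ (by omega)).2.2 _ _ h1).elim

theorem Entails.depth_cNeg {k : ℕ} (h : Entails Γ (eq φ (cNeg a)))
    (h' : Entails Γ (depthLe φ (num k))) :
    Valid Γ ∅ ∨ ∃ j < k, Entails Γ (depthLe a (num j)) := by
  have key : ∀ (M : Type u) (A : Str E M), A.IsModel → ∀ e, (∀ γ ∈ Γ, γ.Arith → A.Sat e γ) →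
      ∃ j, k = j + 1 ∧ A.DepthLe (A.val e a) j := by
    intro M A hA e he
    have h1 := hA.sat_depthLe.1 (h'.2 M A hA e he)
    rw [(h.2 M A hA e he : A.val e φ = _), Str.val_cNeg] at h1
    exact hA.depthLe_codeNeg h1
  cases k with
  | zero => exact .inl fun M A hA e he => by simpa using key M A hA e he
  | succ k =>
    refine .inr ⟨k, k.lt_succ_self, depthLe_arith _ _, fun M A hA e he => hA.sat_depthLe.2 ?_⟩
    obtain ⟨j, hj, h1⟩ := key M A hA e he
    rwa [Nat.succ.inj hj]

/-- A disjunction of depth at most `k` has constituents of depth at most `k - 1`; for `k = 0` the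
hypotheses are contradictory. -/
theorem Entails.depth_cOr {k : ℕ} (h : Entails Γ (eq φ (cOr a b)))
    (h' : Entails Γ (depthLe φ (num k))) :
    Valid Γ ∅ ∨ ∃ j < k, Entails Γ (depthLe a (num j)) ∧ Entails Γ (depthLe b (num j)) := by
  have key : ∀ (M : Type u) (A : Str E M), A.IsModel → ∀ e, (∀ γ ∈ Γ, γ.Arith → A.Sat e γ) →
      ∃ j, k = j + 1 ∧ A.DepthLe (A.val e a) j ∧ A.DepthLe (A.val e b) j := by
    intro M A hA e he
    have h1 := hA.sat_depthLe.1 (h'.2 M A hA e he)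
    rw [(h.2 M A hA e he : A.val e φ = _), Str.val_cOr] at h1
    exact hA.depthLe_codeOr h1
  cases k with
  | zero => exact .inl fun M A hA e he => by simpa using key M A hA e he
  | succ k =>
    refine .inr ⟨k, k.lt_succ_self, ⟨depthLe_arith _ _, fun M A hA e he => hA.sat_depthLe.2 ?_⟩,
      ⟨depthLe_arith _ _, fun M A hA e he => hA.sat_depthLe.2 ?_⟩⟩
    all_goals obtain ⟨j, hj, h1, h2⟩ := key M A hA e he
    · rwa [Nat.succ.inj hj]
    · rwa [Nat.succ.inj hj]

/-- The depth of an instance `ψ₀[t/s]` is smaller than that of the quantified formula. -/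
theorem Entails.depth_cAll {P : Coding E} {k : ℕ} {t u : Tm E} (h : Entails Γ (eq φ (cAll a b)))
    (hs : Entails Γ (CompTruth.subF P b a t u)) (h' : Entails Γ (depthLe φ (num k))) :
    Valid Γ ∅ ∨ ∃ j < k, Entails Γ (depthLe u (num j)) := by
  have key : ∀ (M : Type u) (A : Str E M), A.IsModel → ∀ e, (∀ γ ∈ Γ, γ.Arith → A.Sat e γ) →
      ∃ j, k = j + 1 ∧ A.DepthLe (A.val e u) j := by
    intro M A hA e he
    have h1 := hA.sat_depthLe.1 (h'.2 M A hA e he)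
    rw [(h.2 M A hA e he : A.val e φ = _), Str.val_cAll] at h1
    obtain ⟨j, hj, h2⟩ := hA.depthLe_codeAll h1
    obtain ⟨R, hR, hR'⟩ := hA.sat_subF (hs.2 M A hA e he)
    exact ⟨j, hj, hA.depthLe_of_subStep hR' h2 hR⟩
  cases k with
  | zero => exact .inl fun M A hA e he => by simpa using key M A hA e he
  | succ k =>
    refine .inr ⟨k, k.lt_succ_self, depthLe_arith _ _, fun M A hA e he => hA.sat_depthLe.2 ?_⟩
    obtain ⟨j, hj, h1⟩ := key M A hA e he
    rwa [Nat.succ.inj hj]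

end Components

/-- By completeness, what holds in all models of `IΔ₀ + exp` is derivable from `S`. -/
theorem Valid.derivable (P : Coding E) {S : Set (Fml E)} (hS : ∀ φ ∈ S, φ.Arith ∧ φ.Closed)
    (hI : ∀ φ, IDexp E φ → Provable S φ) {Γ Δ : Finset (Fml E)} (h : Valid Γ Δ) :
    LK (BaseInit S) Γ Δ := by
  have := P.countable_fml
  refine completeness (fun φ hφ => (hS φ hφ).2) fun M A hA => h M A fun φ hφ e => ?_
  exact hA φ hφ.arith ((hI φ hφ).mono fun _ _ h => h.1) e

end Entailment

/-! ### Structural properties of `CT*[S]` -/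

section Calculus

variable {E : FirstOrder.Language.{u, v}} {P : Coding E} {S : Set (Fml E)}

theorem Init.weaken {Γ Δ Γ' Δ' : Finset (Fml E)} (h : Init P S Γ Δ) (hΓ : Γ ⊆ Γ') (hΔ : Δ ⊆ Δ') :
    Init P S Γ' Δ' := by
  cases h with
  | base h => exact .base (h.weaken hΓ hΔ)
  | tr_repl r s =>
    obtain ⟨h1, h2⟩ := Finset.insert_subset_iff.1 hΓ
    rw [← Finset.insert_eq_of_mem (Finset.insert_subset_iff.1 hΔ).1,
      ← Finset.insert_eq_of_mem h1,
      ← Finset.insert_eq_of_mem (Finset.insert_subset_iff.1 h2).1]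
    exact .tr_repl r s
  | tr_sent r =>
    rw [← Finset.insert_eq_of_mem (Finset.insert_subset_iff.1 hΔ).1,
      ← Finset.insert_eq_of_mem (Finset.insert_subset_iff.1 hΓ).1]
    exact .tr_sent r

theorem Init.subst (hS : ∀ φ ∈ S, φ.Arith ∧ φ.Closed) {Γ Δ : Finset (Fml E)} (h : Init P S Γ Δ)
    (σ : ℕ → Tm E) : Init P S (substS σ Γ) (substS σ Δ) := by
  cases h with
  | base h => exact .base (h.subst (fun φ hφ => (hS φ hφ).2) σ)
  | tr_repl r s =>
    simp only [substS_insert]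
    exact .tr_repl _ _
  | tr_sent r =>
    simp only [substS_insert, sentF_subst]
    exact .tr_sent _

theorem Star.weaken {Γ Δ Γ' Δ' : Finset (Fml E)} (h : Star P S Γ Δ) (hΓ : Γ ⊆ Γ') (hΔ : Δ ⊆ Δ') :
    Star P S Γ' Δ' := LK.weaken (fun _ _ _ _ => Init.weaken) h hΓ hΔ

theorem Star.subst (hS : ∀ φ ∈ S, φ.Arith ∧ φ.Closed) {Γ Δ : Finset (Fml E)} (h : Star P S Γ Δ)
    (σ : ℕ → Tm E) : Star P S (substS σ Γ) (substS σ Δ) :=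
  LK.subst (I := Init P S) (fun _ _ σ h => Init.subst hS h σ) h σ

theorem Star.der {Γ Δ : Finset (Fml E)} (h : Star P S Γ Δ) (a r : ℕ) : Der P S a r Γ Δ := by
  induction h with
  | init h => exact .init h
  | allR α _ ih => exact .allR α ih
  | allL α s _ ih => exact .allL α s ih
  | orR α β _ ih => exact .orR α β ih
  | orL α β _ _ ih ih' => exact .orL α β ih ih'
  | negR α _ ih => exact .negR α ih
  | negL α _ ih => exact .negL α ih
  | cut α hα _ _ ih ih' => exact .cut α hα ih ih'

theorem Der.weaken {a r : ℕ} {Γ Δ Γ' Δ' : Finset (Fml E)} (d : Der P S a r Γ Δ) (hΓ : Γ ⊆ Γ')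
    (hΔ : Δ ⊆ Δ') : Der P S a r Γ' Δ' := by
  have ins : ∀ {Θ Θ' : Finset (Fml E)} (φ : Fml E), Θ ⊆ Θ' → insert φ Θ ⊆ insert φ Θ' :=
    fun φ h => Finset.insert_subset_insert φ h
  induction d generalizing Γ' Δ' with
  | init hi => exact .init (hi.weaken hΓ hΔ)
  | allR α _ ih =>
    obtain ⟨hm, hΔ⟩ := Finset.insert_subset_iff.1 hΔ
    rw [← Finset.insert_eq_of_mem hm]
    exact .allR α (ih (liftS_mono hΓ) (ins _ (liftS_mono hΔ)))
  | allL α s _ ih =>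
    obtain ⟨hm, hΓ⟩ := Finset.insert_subset_iff.1 hΓ
    rw [← Finset.insert_eq_of_mem hm]
    exact .allL α s (ih (ins _ hΓ) hΔ)
  | orR α β _ ih =>
    obtain ⟨hm, hΔ⟩ := Finset.insert_subset_iff.1 hΔ
    rw [← Finset.insert_eq_of_mem hm]
    exact .orR α β (ih hΓ (ins _ (ins _ hΔ)))
  | orL α β _ _ ih ih' =>
    obtain ⟨hm, hΓ⟩ := Finset.insert_subset_iff.1 hΓ
    rw [← Finset.insert_eq_of_mem hm]
    exact .orL α β (ih (ins _ hΓ) hΔ) (ih' (ins _ hΓ) hΔ)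
  | negR α _ ih =>
    obtain ⟨hm, hΔ⟩ := Finset.insert_subset_iff.1 hΔ
    rw [← Finset.insert_eq_of_mem hm]
    exact .negR α (ih (ins _ hΓ) hΔ)
  | negL α _ ih =>
    obtain ⟨hm, hΓ⟩ := Finset.insert_subset_iff.1 hΓ
    rw [← Finset.insert_eq_of_mem hm]
    exact .negL α (ih hΓ (ins _ hΔ))
  | cut α hα _ _ ih ih' => exact .cut α hα (ih (ins _ hΓ) hΔ) (ih' hΓ (ins _ hΔ))
  | trOrR ψ ψ₀ ψ₁ _ ih =>
    simp only [Finset.insert_subset_iff] at hΓ hΔ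
    rw [← Finset.insert_eq_of_mem hΔ.1, ← Finset.insert_eq_of_mem hΓ.1,
      ← Finset.insert_eq_of_mem hΓ.2.1]
    exact .trOrR ψ ψ₀ ψ₁ (ih hΓ.2.2 (ins _ (ins _ hΔ.2)))
  | trOrL ψ ψ₀ ψ₁ _ _ ih ih' =>
    simp only [Finset.insert_subset_iff] at hΓ
    rw [← Finset.insert_eq_of_mem hΓ.1, ← Finset.insert_eq_of_mem hΓ.2.1]
    exact .trOrL ψ ψ₀ ψ₁ (ih (ins _ hΓ.2.2) hΔ) (ih' (ins _ hΓ.2.2) hΔ)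
  | trAllR ψ ψ₀ s _ ih =>
    simp only [Finset.insert_subset_iff] at hΓ hΔ
    rw [← Finset.insert_eq_of_mem hΔ.1, ← Finset.insert_eq_of_mem hΓ.1,
      ← Finset.insert_eq_of_mem hΓ.2.1]
    exact .trAllR ψ ψ₀ s (ih (ins _ (liftS_mono hΓ.2.2)) (ins _ (liftS_mono hΔ.2)))
  | trAllL ψ ψ₀ s t u _ ih =>
    simp only [Finset.insert_subset_iff] at hΓ
    rw [← Finset.insert_eq_of_mem hΓ.1, ← Finset.insert_eq_of_mem hΓ.2.1,
      ← Finset.insert_eq_of_mem hΓ.2.2.1]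
    exact .trAllL ψ ψ₀ s t u (ih (ins _ hΓ.2.2.2) hΔ)
  | trNegR ψ ψ₀ _ ih =>
    simp only [Finset.insert_subset_iff] at hΓ hΔ
    rw [← Finset.insert_eq_of_mem hΔ.1, ← Finset.insert_eq_of_mem hΓ.1,
      ← Finset.insert_eq_of_mem hΓ.2.1]
    exact .trNegR ψ ψ₀ (ih (ins _ hΓ.2.2) hΔ.2)
  | trNegL ψ ψ₀ _ ih =>
    simp only [Finset.insert_subset_iff] at hΓ
    rw [← Finset.insert_eq_of_mem hΓ.1, ← Finset.insert_eq_of_mem hΓ.2.1,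
      ← Finset.insert_eq_of_mem hΓ.2.2.1]
    exact .trNegL ψ ψ₀ (ih hΓ.2.2.2 (ins _ hΔ))
  | trEqR ψ s t _ ih =>
    simp only [Finset.insert_subset_iff] at hΓ hΔ
    rw [← Finset.insert_eq_of_mem hΔ.1, ← Finset.insert_eq_of_mem hΓ.1,
      ← Finset.insert_eq_of_mem hΓ.2.1]
    exact .trEqR ψ s t (ih hΓ.2.2 (ins _ hΔ.2))
  | trEqL ψ s t _ ih =>
    simp only [Finset.insert_subset_iff] at hΓ
    rw [← Finset.insert_eq_of_mem hΓ.1, ← Finset.insert_eq_of_mem hΓ.2.1]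
    exact .trEqL ψ s t (ih (ins _ hΓ.2.2) hΔ)
  | trCut k φ hk _ _ hs ih ih' =>
    exact .trCut k φ hk (ih (ins _ hΓ) hΔ) (ih' hΓ (ins _ hΔ)) (hs.weaken (ins _ hΓ) subset_rfl)

theorem Der.mono {a r a' r' : ℕ} {Γ Δ : Finset (Fml E)} (d : Der P S a r Γ Δ) (ha : a ≤ a')
    (hr : r ≤ r') : Der P S a' r' Γ Δ := by
  induction d generalizing a' with
  | init h => exact .init h
  | allR α _ ih => exact .allR α (ih ha hr)
  | allL α s _ ih => exact .allL α s (ih ha hr)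
  | orR α β _ ih => exact .orR α β (ih ha hr)
  | orL α β _ _ ih ih' => exact .orL α β (ih ha hr) (ih' ha hr)
  | negR α _ ih => exact .negR α (ih ha hr)
  | negL α _ ih => exact .negL α (ih ha hr)
  | cut α hα _ _ ih ih' => exact .cut α hα (ih ha hr) (ih' ha hr)
  | trOrR ψ ψ₀ ψ₁ _ ih =>
    obtain ⟨b, rfl⟩ := Nat.exists_eq_add_of_le' ha
    exact .trOrR ψ ψ₀ ψ₁ (ih (Nat.le_add_left _ b) hr)
  | trOrL ψ ψ₀ ψ₁ _ _ ih ih' =>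
    obtain ⟨b, rfl⟩ := Nat.exists_eq_add_of_le' ha
    exact .trOrL ψ ψ₀ ψ₁ (ih (Nat.le_add_left _ b) hr) (ih' (Nat.le_add_left _ b) hr)
  | trAllR ψ ψ₀ s _ ih =>
    obtain ⟨b, rfl⟩ := Nat.exists_eq_add_of_le' ha
    exact .trAllR ψ ψ₀ s (ih (Nat.le_add_left _ b) hr)
  | trAllL ψ ψ₀ s t u _ ih =>
    obtain ⟨b, rfl⟩ := Nat.exists_eq_add_of_le' ha
    exact .trAllL ψ ψ₀ s t u (ih (Nat.le_add_left _ b) hr)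
  | trNegR ψ ψ₀ _ ih =>
    obtain ⟨b, rfl⟩ := Nat.exists_eq_add_of_le' ha
    exact .trNegR ψ ψ₀ (ih (Nat.le_add_left _ b) hr)
  | trNegL ψ ψ₀ _ ih =>
    obtain ⟨b, rfl⟩ := Nat.exists_eq_add_of_le' ha
    exact .trNegL ψ ψ₀ (ih (Nat.le_add_left _ b) hr)
  | trEqR ψ s t _ ih =>
    obtain ⟨b, rfl⟩ := Nat.exists_eq_add_of_le' ha
    exact .trEqR ψ s t (ih (Nat.le_add_left _ b) hr)
  | trEqL ψ s t _ ih =>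
    obtain ⟨b, rfl⟩ := Nat.exists_eq_add_of_le' ha
    exact .trEqL ψ s t (ih (Nat.le_add_left _ b) hr)
  | trCut k φ hk _ _ hs ih ih' =>
    obtain ⟨b, rfl⟩ := Nat.exists_eq_add_of_le' ha
    exact .trCut k φ (hk.trans_le hr) (ih (Nat.le_add_left _ b) hr)
      (ih' (Nat.le_add_left _ b) hr) hs

theorem Der.subst (hS : ∀ φ ∈ S, φ.Arith ∧ φ.Closed) {a r : ℕ} {Γ Δ : Finset (Fml E)}
    (d : Der P S a r Γ Δ) (σ : ℕ → Tm E) : Der P S a r (substS σ Γ) (substS σ Δ) := by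
  have tr_subst : ∀ (t : Tm E) (τ : ℕ → Tm E), (tr t).subst τ = tr (t.subst τ) := fun _ _ => rfl
  induction d generalizing σ with
  | init hi => exact .init (hi.subst hS σ)
  | allR α _ ih =>
    rw [substS_insert, all_subst]
    refine .allR _ ?_
    simpa only [substS_insert, liftS_substS] using ih (upN 1 σ)
  | allL α s _ ih =>
    rw [substS_insert, all_subst]
    refine .allL _ (s.subst σ) ?_
    simpa only [substS_insert, inst_subst] using ih σ
  | orR α β _ ih =>
    rw [substS_insert, or_subst]
    refine .orR _ _ ?_
    simpa only [substS_insert] using ih σ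
  | orL α β _ _ ih ih' =>
    rw [substS_insert, or_subst]
    refine .orL _ _ ?_ ?_
    · simpa only [substS_insert] using ih σ
    · simpa only [substS_insert] using ih' σ
  | negR α _ ih =>
    rw [substS_insert, neg_subst]
    refine .negR _ ?_
    simpa only [substS_insert] using ih σ
  | negL α _ ih =>
    rw [substS_insert, neg_subst]
    refine .negL _ ?_
    simpa only [substS_insert] using ih σ
  | cut α hα _ _ ih ih' =>
    refine .cut (α.subst σ) ((subst_arith σ).2 hα) ?_ ?_
    · simpa only [substS_insert] using ih σ
    · simpa only [substS_insert] using ih' σ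
  | trOrR ψ ψ₀ ψ₁ _ ih =>
    simp only [substS_insert, sentF_subst, eq_subst, cOr_subst, tr_subst] at ih ⊢
    exact .trOrR _ _ _ (ih σ)
  | trOrL ψ ψ₀ ψ₁ _ _ ih ih' =>
    simp only [substS_insert, eq_subst, cOr_subst, tr_subst] at ih ih' ⊢
    exact .trOrL _ _ _ (ih σ) (ih' σ)
  | trAllR ψ ψ₀ s _ ih =>
    have h := ih (upN 2 σ)
    simp only [substS_insert, subF_subst, liftS_substS, Tm.lift_subst_upN, Tm.subst_var_idx,
      tr_subst, upN_of_lt σ (Nat.zero_lt_two), upN_of_lt σ (Nat.one_lt_two)] at h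
    simp only [substS_insert, sentF_subst, eq_subst, cAll_subst, tr_subst]
    exact .trAllR _ _ _ h
  | trAllL ψ ψ₀ s t u _ ih =>
    simp only [substS_insert, subF_subst, eq_subst, cAll_subst, tr_subst] at ih ⊢
    exact .trAllL _ _ _ _ _ (ih σ)
  | trNegR ψ ψ₀ _ ih =>
    simp only [substS_insert, sentF_subst, eq_subst, cNeg_subst, tr_subst] at ih ⊢
    exact .trNegR _ _ (ih σ)
  | trNegL ψ ψ₀ _ ih =>
    simp only [substS_insert, sentF_subst, eq_subst, cNeg_subst, tr_subst] at ih ⊢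
    exact .trNegL _ _ (ih σ)
  | trEqR ψ s t _ ih =>
    simp only [substS_insert, sentF_subst, eqF_subst, eq_subst, cEq_subst, tr_subst] at ih ⊢
    exact .trEqR _ _ _ (ih σ)
  | trEqL ψ s t _ ih =>
    simp only [substS_insert, eqF_subst, eq_subst, cEq_subst, tr_subst] at ih ⊢
    exact .trEqL _ _ _ (ih σ)
  | trCut k φ hk _ _ hs ih ih' =>
    simp only [substS_insert, tr_subst] at ih ih'
    refine .trCut k _ hk (ih σ) (ih' σ) ?_
    have := Star.subst hS hs σ
    simpa only [substS_insert, substS_singleton, sentF_subst, depthLe_subst, Tm.num_subst] using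
      this

theorem Der.cut_sentF {a r : ℕ} {Γ Δ : Finset (Fml E)} {s : Tm E} (hs : tr s ∈ Γ)
    (d : Der P S a r (insert (sentF P s) Γ) Δ) : Der P S a r Γ Δ := by
  refine .cut _ (sentF_arith P s) d ?_
  have := Der.init (a := a) (r := r) (Init.tr_sent (P := P) (S := S) (Γ := Γ) (Δ := Δ) s)
  rwa [Finset.insert_eq_of_mem hs] at this

variable (hS : ∀ φ ∈ S, φ.Arith ∧ φ.Closed) (hI : ∀ φ, IDexp E φ → Provable S φ)
include hS hI

theorem Valid.star {Γ Δ : Finset (Fml E)} (h : Valid Γ Δ) : Star P S Γ Δ :=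
  (h.derivable P hS hI).mono fun _ _ => .base

theorem Valid.der {Γ Δ : Finset (Fml E)} (h : Valid Γ Δ) (a r : ℕ) : Der P S a r Γ Δ :=
  (h.star hS hI).der a r

theorem Valid.der_of_empty {Γ Δ : Finset (Fml E)} (h : Valid Γ ∅) (a r : ℕ) : Der P S a r Γ Δ :=
  (h.der hS hI a r).weaken subset_rfl (Finset.empty_subset _)

theorem Der.cut_entails {a r : ℕ} {Γ Δ : Finset (Fml E)} {α : Fml E} (h : Entails Γ α)
    (d : Der P S a r (insert α Γ) Δ) : Der P S a r Γ Δ :=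
  .cut α h.1 d ((h.valid (Finset.mem_insert_self α Δ)).der hS hI a r)

/-! The rules with side formulas that are merely entailed. -/

theorem Der.tr_of_eq {a r : ℕ} {Γ Δ : Finset (Fml E)} {s t : Tm E} (h : Entails Γ (eq s t))
    (hs : tr s ∈ Γ) (ht : tr t ∈ Δ) : Der P S a r Γ Δ := by
  refine .cut_entails hS hI h ((Der.init (.tr_repl (Γ := Γ) (Δ := Δ) s t)).weaken ?_ ?_)
  · rw [Finset.insert_eq_of_mem hs]
  · rw [Finset.insert_eq_of_mem ht]

theorem Der.or_right {a r : ℕ} {Γ Δ : Finset (Fml E)} {ψ ψ₀ ψ₁ : Tm E}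
    (hs : Entails Γ (sentF P ψ)) (he : Entails Γ (eq ψ (cOr ψ₀ ψ₁))) (ht : tr ψ ∈ Δ)
    (d : Der P S a r Γ (insert (tr ψ₀) (insert (tr ψ₁) Δ))) : Der P S (a + 1) r Γ Δ := by
  refine .cut_entails hS hI he (.cut_entails hS hI (hs.insert _) ?_)
  have := Der.trOrR ψ ψ₀ ψ₁ d
  rwa [Finset.insert_eq_of_mem ht] at this

theorem Der.or_left {a r : ℕ} {Γ Δ : Finset (Fml E)} {ψ ψ₀ ψ₁ : Tm E}
    (he : Entails Γ (eq ψ (cOr ψ₀ ψ₁))) (ht : tr ψ ∈ Γ)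
    (d : Der P S a r (insert (tr ψ₀) Γ) Δ) (d' : Der P S a r (insert (tr ψ₁) Γ) Δ) :
    Der P S (a + 1) r Γ Δ := by
  refine .cut_entails hS hI he ?_
  have := Der.trOrL ψ ψ₀ ψ₁ d d'
  rwa [Finset.insert_eq_of_mem ht] at this

theorem Der.all_right {a r : ℕ} {Γ Δ : Finset (Fml E)} {ψ ψ₀ s : Tm E}
    (hs : Entails Γ (sentF P ψ)) (he : Entails Γ (eq ψ (cAll s ψ₀))) (ht : tr ψ ∈ Δ)
    (d : Der P S a r (insert (subF P (ψ₀.lift 2) (s.lift 2) (var 1) (var 0)) (liftS 2 Γ))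
      (insert (tr (var 0)) (liftS 2 Δ))) : Der P S (a + 1) r Γ Δ := by
  refine .cut_entails hS hI he (.cut_entails hS hI (hs.insert _) ?_)
  have := Der.trAllR ψ ψ₀ s d
  rwa [Finset.insert_eq_of_mem ht] at this

theorem Der.all_left {a r : ℕ} {Γ Δ : Finset (Fml E)} {ψ ψ₀ s t u : Tm E}
    (hs : Entails Γ (subF P ψ₀ s t u)) (he : Entails Γ (eq ψ (cAll s ψ₀))) (ht : tr ψ ∈ Γ)
    (d : Der P S a r (insert (tr u) Γ) Δ) : Der P S (a + 1) r Γ Δ := by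
  refine .cut_entails hS hI he (.cut_entails hS hI (hs.insert _) ?_)
  have := Der.trAllL ψ ψ₀ s t u d
  rwa [Finset.insert_eq_of_mem ht] at this

theorem Der.neg_right {a r : ℕ} {Γ Δ : Finset (Fml E)} {ψ ψ₀ : Tm E}
    (hs : Entails Γ (sentF P ψ)) (he : Entails Γ (eq ψ (cNeg ψ₀))) (ht : tr ψ ∈ Δ)
    (d : Der P S a r (insert (tr ψ₀) Γ) Δ) : Der P S (a + 1) r Γ Δ := by
  refine .cut_entails hS hI he (.cut_entails hS hI (hs.insert _) ?_)
  have := Der.trNegR ψ ψ₀ d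
  rwa [Finset.insert_eq_of_mem ht] at this

theorem Der.neg_left {a r : ℕ} {Γ Δ : Finset (Fml E)} {ψ ψ₀ : Tm E}
    (he : Entails Γ (eq ψ (cNeg ψ₀))) (ht : tr ψ ∈ Γ)
    (d : Der P S a r Γ (insert (tr ψ₀) Δ)) : Der P S (a + 1) r Γ Δ := by
  refine .cut_sentF ht (.cut_entails hS hI (he.insert _) ?_)
  have := Der.trNegL ψ ψ₀ d
  rwa [Finset.insert_eq_of_mem ht, Finset.insert_comm] at this

theorem Der.eq_right {a r : ℕ} {Γ Δ : Finset (Fml E)} {ψ s t : Tm E}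
    (hs : Entails Γ (sentF P ψ)) (he : Entails Γ (eq ψ (cEq s t))) (ht : tr ψ ∈ Δ)
    (d : Der P S a r Γ (insert (eqF P s t) Δ)) : Der P S (a + 1) r Γ Δ := by
  refine .cut_entails hS hI he (.cut_entails hS hI (hs.insert _) ?_)
  have := Der.trEqR ψ s t d
  rwa [Finset.insert_eq_of_mem ht] at this

theorem Der.eq_left {a r : ℕ} {Γ Δ : Finset (Fml E)} {ψ s t : Tm E}
    (he : Entails Γ (eq ψ (cEq s t))) (ht : tr ψ ∈ Γ)
    (d : Der P S a r (insert (eqF P s t) Γ) Δ) : Der P S (a + 1) r Γ Δ := by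
  refine .cut_entails hS hI he ?_
  have := Der.trEqL ψ s t d
  rwa [Finset.insert_eq_of_mem ht] at this

/-- A `T`-cut is admitted as soon as the depth of the cut formula is bounded in all models of
`IΔ₀ + exp`. -/
theorem Der.cut_tr {a r k : ℕ} {Γ Δ : Finset (Fml E)} {φ : Tm E} (hk : k < r)
    (hd : Entails Γ (depthLe φ (num k))) (d : Der P S a r (insert (tr φ) Γ) Δ)
    (d' : Der P S a r Γ (insert (tr φ) Δ)) : Der P S (a + 1) r Γ Δ :=
  .trCut k φ hk d d' (((hd.insert _).valid (Finset.mem_singleton_self _)).star hS hI)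

end Calculus

/-! ### Removal of a truth atom from the right -/

section Removal

variable {E : FirstOrder.Language.{u, v}} {P : Coding E} {S : Set (Fml E)}

/-- An initial sequent of first-order logic remains one if formulas outside `L` are removed. -/
theorem BaseInit.restrict (hS : ∀ φ ∈ S, φ.Arith ∧ φ.Closed) {Γ Δ Γ' Δ' : Finset (Fml E)}
    (h : BaseInit S Γ' Δ') (hΓ : ∀ φ ∈ Γ', φ.Arith → φ ∈ Γ) (hΔ : ∀ φ ∈ Δ', φ.Arith → φ ∈ Δ) :
    BaseInit S Γ Δ := by
  cases h with
  | ax φ hφ =>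
    rw [← Finset.insert_eq_of_mem (hΔ φ (by simp) (hS φ hφ).1)]
    exact .ax φ hφ
  | id α hα =>
    rw [← Finset.insert_eq_of_mem (hΔ α (by simp) hα),
      ← Finset.insert_eq_of_mem (hΓ α (by simp) hα)]
    exact .id α hα
  | refl t =>
    rw [← Finset.insert_eq_of_mem (hΔ (Fml.eq t t) (by simp) trivial)]
    exact .refl t
  | repl α r s hα =>
    have h1 : α.inst r ∈ Γ := hΓ _ (by simp) ((subst_arith _).2 hα)
    have h2 : Fml.eq r s ∈ Γ := hΓ _ (by simp) trivial
    rw [← Finset.insert_eq_of_mem (hΔ (α.inst s) (by simp) ((subst_arith _).2 hα)),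
      ← Finset.insert_eq_of_mem h2, ← Finset.insert_eq_of_mem h1]
    exact .repl α r s hα

theorem mem_of_mem_insert_tr {φ : Fml E} {t : Tm E} {Γ : Finset (Fml E)} (hφ : φ.Arith)
    (h : φ ∈ insert (tr t) Γ) : φ ∈ Γ :=
  (Finset.mem_insert.1 h).resolve_left fun h => by subst h; exact hφ

theorem insert_subset_insert_comm {φ ψ : Fml E} {Γ Γ' : Finset (Fml E)} (h : Γ' ⊆ insert φ Γ) :
    insert ψ Γ' ⊆ insert φ (insert ψ Γ) := by
  rw [Finset.insert_comm]
  exact Finset.insert_subset_insert _ h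

theorem liftS_subset_insert_tr {k : ℕ} {t : Tm E} {Γ Γ' : Finset (Fml E)}
    (h : Γ' ⊆ insert (tr t) Γ) : liftS k Γ' ⊆ insert (tr (t.lift k)) (liftS k Γ) := by
  have := liftS_mono (k := k) h
  rwa [liftS_insert] at this

theorem lift_mem_liftS {φ : Fml E} {Γ : Finset (Fml E)} (k : ℕ) (h : φ ∈ Γ) :
    φ.lift k ∈ liftS k Γ := Finset.mem_image_of_mem _ h

/-- What is needed to remove `T φ` from the right of all sequents of a derivation, in contexts
satisfying `C φ`: the sequents `Γ ⇒ Δ` in the conclusions say how to replace the initial sequents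
and rules whose main formula on the right is `T φ`. Here `f` is the effect on the rank. -/
structure RightRemoval (P : Coding E) (S : Set (Fml E)) (r : ℕ)
    (C : Tm E → Finset (Fml E) → Finset (Fml E) → Prop) (f : ℕ → ℕ) : Prop where
  succ_le (a) : f a + 1 ≤ f (a + 1)
  mono {φ Γ Δ Γ' Δ'} : C φ Γ Δ → Γ ⊆ Γ' → Δ ⊆ Δ' → C φ Γ' Δ'
  lift {φ Γ Δ} (k : ℕ) : C φ Γ Δ → C (φ.lift k) (liftS k Γ) (liftS k Δ)
  repl {a φ Γ Δ} (s : Tm E) : C φ Γ Δ → eq s φ ∈ Γ → tr s ∈ Γ → Der P S (f a) r Γ Δ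
  or {a φ Γ Δ} (ψ₀ ψ₁ : Tm E) : C φ Γ Δ → sentF P φ ∈ Γ → eq φ (cOr ψ₀ ψ₁) ∈ Γ →
    Der P S (f a) r Γ (insert (tr ψ₀) (insert (tr ψ₁) Δ)) → Der P S (f (a + 1)) r Γ Δ
  all {a φ Γ Δ} (ψ₀ s : Tm E) : C φ Γ Δ → sentF P φ ∈ Γ → eq φ (cAll s ψ₀) ∈ Γ →
    Der P S (f a) r (insert (subF P (ψ₀.lift 2) (s.lift 2) (var 1) (var 0)) (liftS 2 Γ))
      (insert (tr (var 0)) (liftS 2 Δ)) → Der P S (f (a + 1)) r Γ Δ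
  neg {a φ Γ Δ} (ψ₀ : Tm E) : C φ Γ Δ → sentF P φ ∈ Γ → eq φ (cNeg ψ₀) ∈ Γ →
    Der P S (f a) r (insert (tr ψ₀) Γ) Δ → Der P S (f (a + 1)) r Γ Δ
  eq {a φ Γ Δ} (s t : Tm E) : C φ Γ Δ → sentF P φ ∈ Γ → eq φ (cEq s t) ∈ Γ →
    Der P S (f a) r Γ (insert (eqF P s t) Δ) → Der P S (f (a + 1)) r Γ Δ

variable (hS : ∀ φ ∈ S, φ.Arith ∧ φ.Closed) (hI : ∀ φ, IDexp E φ → Provable S φ)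
include hS hI

/-- Induction on the derivation. The two sides of the given derivation may be thinner than `Γ` and
`Δ, T φ`, so that `C` may put additional formulas into the sequents. -/
theorem RightRemoval.der {r : ℕ} {C : Tm E → Finset (Fml E) → Finset (Fml E) → Prop} {f : ℕ → ℕ}
    (H : RightRemoval P S r C f) {a r' : ℕ} {Γ' Δ' : Finset (Fml E)} (d : Der P S a r' Γ' Δ')
    (hr : r' ≤ r) {φ : Tm E} {Γ Δ : Finset (Fml E)} (hΓ : Γ' ⊆ Γ) (hΔ : Δ' ⊆ insert (tr φ) Δ)
    (hC : C φ Γ Δ) : Der P S (f a) r Γ Δ := by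
  have ins : ∀ {Θ Θ' : Finset (Fml E)} (φ : Fml E), Θ ⊆ Θ' → insert φ Θ ⊆ insert φ Θ' :=
    fun φ h => Finset.insert_subset_insert φ h
  have sub : ∀ (Θ : Finset (Fml E)) (φ : Fml E), Θ ⊆ insert φ Θ :=
    fun Θ φ => Finset.subset_insert φ Θ
  induction d generalizing φ Γ Δ with
  | init hi =>
    cases hi with
    | base hb =>
      exact .init (.base (hb.restrict hS (fun ψ hψ _ => hΓ hψ) fun ψ hψ ha =>
        mem_of_mem_insert_tr ha (hΔ hψ)))
    | tr_repl s t =>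
      simp only [Finset.insert_subset_iff] at hΓ hΔ
      rcases Finset.mem_insert.1 hΔ.1 with h | h
      · obtain rfl := Fml.tr.inj h
        exact H.repl s hC hΓ.1 hΓ.2.1
      · exact .tr_of_eq hS hI (.eq_of_mem hΓ.1) hΓ.2.1 h
    | tr_sent s =>
      simp only [Finset.insert_subset_iff] at hΓ hΔ
      have hs := sentF_arith P s
      exact .cut_sentF hΓ.1 (((Entails.of_mem hs (Finset.mem_insert_self _ _)).valid
        (mem_of_mem_insert_tr hs hΔ.1)).der hS hI _ _)
  | allR α _ ih =>
    obtain ⟨hm, hΔ⟩ := Finset.insert_subset_iff.1 hΔ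
    rw [← Finset.insert_eq_of_mem ((Finset.mem_insert.1 hm).resolve_left (by simp))]
    exact .allR α (ih hr (liftS_mono hΓ) (insert_subset_insert_comm (liftS_subset_insert_tr hΔ))
      (H.mono (H.lift 1 hC) subset_rfl (sub _ _)))
  | allL α s _ ih =>
    obtain ⟨hm, hΓ⟩ := Finset.insert_subset_iff.1 hΓ
    rw [← Finset.insert_eq_of_mem hm]
    exact .allL α s (ih hr (ins _ hΓ) hΔ (H.mono hC (sub _ _) subset_rfl))
  | orR α β _ ih =>
    obtain ⟨hm, hΔ⟩ := Finset.insert_subset_iff.1 hΔ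
    rw [← Finset.insert_eq_of_mem ((Finset.mem_insert.1 hm).resolve_left (by simp))]
    exact .orR α β (ih hr hΓ (insert_subset_insert_comm (insert_subset_insert_comm hΔ))
      (H.mono hC subset_rfl ((sub _ _).trans (sub _ _))))
  | orL α β _ _ ih ih' =>
    obtain ⟨hm, hΓ⟩ := Finset.insert_subset_iff.1 hΓ
    rw [← Finset.insert_eq_of_mem hm]
    exact .orL α β (ih hr (ins _ hΓ) hΔ (H.mono hC (sub _ _) subset_rfl))
      (ih' hr (ins _ hΓ) hΔ (H.mono hC (sub _ _) subset_rfl))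
  | negR α _ ih =>
    obtain ⟨hm, hΔ⟩ := Finset.insert_subset_iff.1 hΔ
    rw [← Finset.insert_eq_of_mem ((Finset.mem_insert.1 hm).resolve_left (by simp))]
    exact .negR α (ih hr (ins _ hΓ) hΔ (H.mono hC (sub _ _) subset_rfl))
  | negL α _ ih =>
    obtain ⟨hm, hΓ⟩ := Finset.insert_subset_iff.1 hΓ
    rw [← Finset.insert_eq_of_mem hm]
    exact .negL α (ih hr hΓ (insert_subset_insert_comm hΔ) (H.mono hC subset_rfl (sub _ _)))
  | cut α hα _ _ ih ih' =>
    exact .cut α hα (ih hr (ins _ hΓ) hΔ (H.mono hC (sub _ _) subset_rfl))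
      (ih' hr hΓ (insert_subset_insert_comm hΔ) (H.mono hC subset_rfl (sub _ _)))
  | trOrR ψ ψ₀ ψ₁ _ ih =>
    simp only [Finset.insert_subset_iff] at hΓ hΔ
    have d := ih hr hΓ.2.2 (insert_subset_insert_comm (insert_subset_insert_comm hΔ.2))
      (H.mono hC subset_rfl ((sub _ _).trans (sub _ _)))
    rcases Finset.mem_insert.1 hΔ.1 with h | h
    · obtain rfl := Fml.tr.inj h
      exact H.or ψ₀ ψ₁ hC hΓ.1 hΓ.2.1 d
    · exact (Der.or_right hS hI (.of_mem (sentF_arith P ψ) hΓ.1) (.eq_of_mem hΓ.2.1) h d).mono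
        (H.succ_le _) le_rfl
  | trOrL ψ ψ₀ ψ₁ _ _ ih ih' =>
    simp only [Finset.insert_subset_iff] at hΓ
    exact (Der.or_left hS hI (.eq_of_mem hΓ.1) hΓ.2.1
      (ih hr (ins _ hΓ.2.2) hΔ (H.mono hC (sub _ _) subset_rfl))
      (ih' hr (ins _ hΓ.2.2) hΔ (H.mono hC (sub _ _) subset_rfl))).mono (H.succ_le _) le_rfl
  | trAllR ψ ψ₀ s _ ih =>
    simp only [Finset.insert_subset_iff] at hΓ hΔ
    have d := ih hr (ins _ (liftS_mono hΓ.2.2))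
      (insert_subset_insert_comm (liftS_subset_insert_tr hΔ.2))
      (H.mono (H.lift 2 hC) (sub _ _) (sub _ _))
    rcases Finset.mem_insert.1 hΔ.1 with h | h
    · obtain rfl := Fml.tr.inj h
      exact H.all ψ₀ s hC hΓ.1 hΓ.2.1 d
    · exact (Der.all_right hS hI (.of_mem (sentF_arith P ψ) hΓ.1) (.eq_of_mem hΓ.2.1) h d).mono
        (H.succ_le _) le_rfl
  | trAllL ψ ψ₀ s t u _ ih =>
    simp only [Finset.insert_subset_iff] at hΓ
    exact (Der.all_left hS hI (.of_mem (subF_arith P _ _ _ _) hΓ.1) (.eq_of_mem hΓ.2.1) hΓ.2.2.1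
      (ih hr (ins _ hΓ.2.2.2) hΔ (H.mono hC (sub _ _) subset_rfl))).mono (H.succ_le _) le_rfl
  | trNegR ψ ψ₀ _ ih =>
    simp only [Finset.insert_subset_iff] at hΓ hΔ
    have d := ih hr (ins _ hΓ.2.2) hΔ.2 (H.mono hC (sub _ _) subset_rfl)
    rcases Finset.mem_insert.1 hΔ.1 with h | h
    · obtain rfl := Fml.tr.inj h
      exact H.neg ψ₀ hC hΓ.1 hΓ.2.1 d
    · exact (Der.neg_right hS hI (.of_mem (sentF_arith P ψ) hΓ.1) (.eq_of_mem hΓ.2.1) h d).mono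
        (H.succ_le _) le_rfl
  | trNegL ψ ψ₀ _ ih =>
    simp only [Finset.insert_subset_iff] at hΓ
    exact (Der.neg_left hS hI (.eq_of_mem hΓ.2.1) hΓ.2.2.1
      (ih hr hΓ.2.2.2 (insert_subset_insert_comm hΔ) (H.mono hC subset_rfl (sub _ _)))).mono
        (H.succ_le _) le_rfl
  | trEqR ψ s t _ ih =>
    simp only [Finset.insert_subset_iff] at hΓ hΔ
    have d := ih hr hΓ.2.2 (insert_subset_insert_comm hΔ.2) (H.mono hC subset_rfl (sub _ _))
    rcases Finset.mem_insert.1 hΔ.1 with h | h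
    · obtain rfl := Fml.tr.inj h
      exact H.eq s t hC hΓ.1 hΓ.2.1 d
    · exact (Der.eq_right hS hI (.of_mem (sentF_arith P ψ) hΓ.1) (.eq_of_mem hΓ.2.1) h d).mono
        (H.succ_le _) le_rfl
  | trEqL ψ s t _ ih =>
    simp only [Finset.insert_subset_iff] at hΓ
    exact (Der.eq_left hS hI (.eq_of_mem hΓ.1) hΓ.2.1
      (ih hr (ins _ hΓ.2.2) hΔ (H.mono hC (sub _ _) subset_rfl))).mono (H.succ_le _) le_rfl
  | trCut k χ hk _ _ hs ih ih' =>
    exact (Der.trCut k χ (hk.trans_le hr) (ih hr (ins _ hΓ) hΔ (H.mono hC (sub _ _) subset_rfl))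
      (ih' hr hΓ (insert_subset_insert_comm hΔ) (H.mono hC subset_rfl (sub _ _)))
      (hs.weaken (ins _ hΓ) subset_rfl)).mono (H.succ_le _) le_rfl

/-- A provably true sentence is provably a sentence. -/
theorem Der.sentF_right {a r : ℕ} {Γ Δ : Finset (Fml E)} {φ : Tm E}
    (d : Der P S a r Γ (insert (tr φ) Δ)) : Der P S a r Γ (insert (sentF P φ) Δ) := by
  have done : ∀ {a φ Γ Δ}, sentF P φ ∈ Δ → sentF P φ ∈ Γ → Der P S a r Γ Δ :=
    fun h h' => ((Entails.of_mem (sentF_arith P _) h').valid h).der hS hI _ _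
  have H : RightRemoval P S r (fun φ _ Δ => sentF P φ ∈ Δ) id :=
    { succ_le := fun _ => le_rfl
      mono := fun h _ h' => h' h
      lift := fun {φ _ _} k h => by
        have := lift_mem_liftS k h
        rwa [Fml.lift, sentF_subst] at this
      repl := fun {a φ Γ Δ} s h he ht => by
        have hs := Entails.of_mem (sentF_arith P s) (Finset.mem_insert_self _ Γ)
        exact .cut_sentF ht (((((Entails.eq_of_mem he).insert _).sentF hs).valid h).der hS hI _ _)
      or := fun _ _ h h' _ _ => done h h'
      all := fun _ _ h h' _ _ => done h h'
      neg := fun _ h h' _ _ => done h h'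
      eq := fun _ _ h h' _ _ => done h h' }
  exact H.der hS hI d le_rfl subset_rfl (Finset.insert_subset_insert _ (Finset.subset_insert _ _))
    (Finset.mem_insert_self _ _)

/-- Replacement of equals below `T` on the right. -/
theorem Der.replace_right {a r : ℕ} {Γ Δ : Finset (Fml E)} {φ χ : Tm E}
    (he : Entails Γ (eq φ χ)) (hχ : tr χ ∈ Δ) (d : Der P S a r Γ (insert (tr φ) Δ)) :
    Der P S a r Γ Δ := by
  have H : RightRemoval P S r (fun φ Γ Δ => ∃ χ, eq φ χ ∈ Γ ∧ tr χ ∈ Δ) id :=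
    { succ_le := fun _ => le_rfl
      mono := fun ⟨χ, h1, h2⟩ hΓ hΔ => ⟨χ, hΓ h1, hΔ h2⟩
      lift := fun k ⟨χ, h1, h2⟩ => ⟨χ.lift k, lift_mem_liftS k h1, lift_mem_liftS k h2⟩
      repl := fun s ⟨χ, h1, h2⟩ he ht =>
        .tr_of_eq hS hI ((Entails.eq_of_mem he).eq_trans (.eq_of_mem h1)) ht h2
      or := fun _ _ ⟨χ, h1, h2⟩ hs he d => by
        have h := Entails.eq_of_mem h1
        exact .or_right hS hI (h.sentF (.of_mem (sentF_arith P _) hs))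
          (h.eq_symm.eq_trans (.eq_of_mem he)) h2 d
      all := fun _ _ ⟨χ, h1, h2⟩ hs he d => by
        have h := Entails.eq_of_mem h1
        exact .all_right hS hI (h.sentF (.of_mem (sentF_arith P _) hs))
          (h.eq_symm.eq_trans (.eq_of_mem he)) h2 d
      neg := fun _ ⟨χ, h1, h2⟩ hs he d => by
        have h := Entails.eq_of_mem h1
        exact .neg_right hS hI (h.sentF (.of_mem (sentF_arith P _) hs))
          (h.eq_symm.eq_trans (.eq_of_mem he)) h2 d
      eq := fun _ _ ⟨χ, h1, h2⟩ hs he d => by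
        have h := Entails.eq_of_mem h1
        exact .eq_right hS hI (h.sentF (.of_mem (sentF_arith P _) hs))
          (h.eq_symm.eq_trans (.eq_of_mem he)) h2 d }
  exact .cut_entails hS hI he (H.der hS hI d le_rfl (Finset.subset_insert _ _) subset_rfl
    ⟨χ, Finset.mem_insert_self _ _, hχ⟩)

end Removal

/-! ### Removal of a truth atom from the left -/

section RemovalLeft

variable {E : FirstOrder.Language.{u, v}} {P : Coding E} {S : Set (Fml E)}

/-- What is needed to remove `T φ` from the left of all sequents of a derivation, in contexts
satisfying `C φ`, with the effect `f` on the rank. -/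
structure LeftRemoval (P : Coding E) (S : Set (Fml E)) (r : ℕ)
    (C : Tm E → Finset (Fml E) → Finset (Fml E) → Prop) (f : ℕ → ℕ) : Prop where
  succ_le (a) : f a + 1 ≤ f (a + 1)
  mono {φ Γ Δ Γ' Δ'} : C φ Γ Δ → Γ ⊆ Γ' → Δ ⊆ Δ' → C φ Γ' Δ'
  lift {φ Γ Δ} (k : ℕ) : C φ Γ Δ → C (φ.lift k) (liftS k Γ) (liftS k Δ)
  repl {a φ Γ Δ} (s : Tm E) : C φ Γ Δ → eq φ s ∈ Γ → tr s ∈ Δ → Der P S (f a) r Γ Δ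
  sent {a φ Γ Δ} : C φ Γ Δ → sentF P φ ∈ Δ → Der P S (f a) r Γ Δ
  or {a φ Γ Δ} (ψ₀ ψ₁ : Tm E) : C φ Γ Δ → eq φ (cOr ψ₀ ψ₁) ∈ Γ →
    Der P S (f a) r (insert (tr ψ₀) Γ) Δ → Der P S (f a) r (insert (tr ψ₁) Γ) Δ →
    Der P S (f (a + 1)) r Γ Δ
  all {a φ Γ Δ} (ψ₀ s t u : Tm E) : C φ Γ Δ → subF P ψ₀ s t u ∈ Γ → eq φ (cAll s ψ₀) ∈ Γ →
    Der P S (f a) r (insert (tr u) Γ) Δ → Der P S (f (a + 1)) r Γ Δ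
  neg {a φ Γ Δ} (ψ₀ : Tm E) : C φ Γ Δ → eq φ (cNeg ψ₀) ∈ Γ →
    Der P S (f a) r Γ (insert (tr ψ₀) Δ) → Der P S (f (a + 1)) r Γ Δ
  eq {a φ Γ Δ} (s t : Tm E) : C φ Γ Δ → eq φ (cEq s t) ∈ Γ →
    Der P S (f a) r (insert (eqF P s t) Γ) Δ → Der P S (f (a + 1)) r Γ Δ

/-- The same for the `T`-cuts of the derivation: their arithmetical premise may depend on `T φ`. -/
def LeftRemoval.Cuts (P : Coding E) (S : Set (Fml E)) (r : ℕ)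
    (C : Tm E → Finset (Fml E) → Finset (Fml E) → Prop) (f : ℕ → ℕ) : Prop :=
  ∀ {a φ Γ Δ Γ'} (k : ℕ) (χ : Tm E), k < r → Γ' ⊆ insert (tr φ) Γ → C φ Γ Δ →
    Der P S (f a) r (insert (tr χ) Γ) Δ → Der P S (f a) r Γ (insert (tr χ) Δ) →
    Star P S (insert (sentF P χ) Γ') {depthLe χ (num k)} → Der P S (f (a + 1)) r Γ Δ

variable (hS : ∀ φ ∈ S, φ.Arith ∧ φ.Closed) (hI : ∀ φ, IDexp E φ → Provable S φ)
include hS hI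

/-- Induction on the derivation, where `Cuts` is needed only if the derivation may contain
`T`-cuts. -/
theorem LeftRemoval.der_of_cuts {r : ℕ} {C : Tm E → Finset (Fml E) → Finset (Fml E) → Prop}
    {f : ℕ → ℕ} (H : LeftRemoval P S r C f) {a r' : ℕ} {Γ' Δ' : Finset (Fml E)}
    (d : Der P S a r' Γ' Δ') (hr : r' = 0 ∨ r' ≤ r ∧ LeftRemoval.Cuts P S r C f) {φ : Tm E}
    {Γ Δ : Finset (Fml E)} (hΓ : Γ' ⊆ insert (tr φ) Γ) (hΔ : Δ' ⊆ Δ) (hC : C φ Γ Δ) :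
    Der P S (f a) r Γ Δ := by
  have ins : ∀ {Θ Θ' : Finset (Fml E)} (φ : Fml E), Θ ⊆ Θ' → insert φ Θ ⊆ insert φ Θ' :=
    fun φ h => Finset.insert_subset_insert φ h
  have sub : ∀ (Θ : Finset (Fml E)) (φ : Fml E), Θ ⊆ insert φ Θ :=
    fun Θ φ => Finset.subset_insert φ Θ
  have eqm : ∀ {s t χ : Tm E} {Θ : Finset (Fml E)}, Fml.eq s t ∈ insert (tr χ) Θ → Fml.eq s t ∈ Θ :=
    fun h => mem_of_mem_insert_tr trivial h
  induction d generalizing φ Γ Δ with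
  | init hi =>
    cases hi with
    | base hb =>
      exact .init (.base (hb.restrict hS
        (fun ψ hψ ha => mem_of_mem_insert_tr ha (hΓ hψ)) fun ψ hψ _ => hΔ hψ))
    | tr_repl s t =>
      simp only [Finset.insert_subset_iff] at hΓ hΔ
      rcases Finset.mem_insert.1 hΓ.2.1 with h | h
      · obtain rfl := Fml.tr.inj h
        exact H.repl t hC (eqm hΓ.1) hΔ.1
      · exact .tr_of_eq hS hI (.eq_of_mem (eqm hΓ.1)) h hΔ.1
    | tr_sent s =>
      simp only [Finset.insert_subset_iff] at hΓ hΔ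
      rcases Finset.mem_insert.1 hΓ.1 with h | h
      · obtain rfl := Fml.tr.inj h
        exact H.sent hC hΔ.1
      · exact .cut_sentF h (((Entails.of_mem (sentF_arith P s) (Finset.mem_insert_self _ _)).valid
          hΔ.1).der hS hI _ _)
  | allR α _ ih =>
    obtain ⟨hm, hΔ⟩ := Finset.insert_subset_iff.1 hΔ
    rw [← Finset.insert_eq_of_mem hm]
    exact .allR α (ih hr (liftS_subset_insert_tr hΓ) (ins _ (liftS_mono hΔ))
      (H.mono (H.lift 1 hC) subset_rfl (sub _ _)))
  | allL α s _ ih =>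
    obtain ⟨hm, hΓ⟩ := Finset.insert_subset_iff.1 hΓ
    rw [← Finset.insert_eq_of_mem ((Finset.mem_insert.1 hm).resolve_left (by simp))]
    exact .allL α s (ih hr (insert_subset_insert_comm hΓ) hΔ (H.mono hC (sub _ _) subset_rfl))
  | orR α β _ ih =>
    obtain ⟨hm, hΔ⟩ := Finset.insert_subset_iff.1 hΔ
    rw [← Finset.insert_eq_of_mem hm]
    exact .orR α β (ih hr hΓ (ins _ (ins _ hΔ)) (H.mono hC subset_rfl ((sub _ _).trans (sub _ _))))
  | orL α β _ _ ih ih' =>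
    obtain ⟨hm, hΓ⟩ := Finset.insert_subset_iff.1 hΓ
    rw [← Finset.insert_eq_of_mem ((Finset.mem_insert.1 hm).resolve_left (by simp))]
    exact .orL α β (ih hr (insert_subset_insert_comm hΓ) hΔ (H.mono hC (sub _ _) subset_rfl))
      (ih' hr (insert_subset_insert_comm hΓ) hΔ (H.mono hC (sub _ _) subset_rfl))
  | negR α _ ih =>
    obtain ⟨hm, hΔ⟩ := Finset.insert_subset_iff.1 hΔ
    rw [← Finset.insert_eq_of_mem hm]
    exact .negR α (ih hr (insert_subset_insert_comm hΓ) hΔ (H.mono hC (sub _ _) subset_rfl))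
  | negL α _ ih =>
    obtain ⟨hm, hΓ⟩ := Finset.insert_subset_iff.1 hΓ
    rw [← Finset.insert_eq_of_mem ((Finset.mem_insert.1 hm).resolve_left (by simp))]
    exact .negL α (ih hr hΓ (ins _ hΔ) (H.mono hC subset_rfl (sub _ _)))
  | cut α hα _ _ ih ih' =>
    exact .cut α hα
      (ih hr (insert_subset_insert_comm hΓ) hΔ (H.mono hC (sub _ _) subset_rfl))
      (ih' hr hΓ (ins _ hΔ) (H.mono hC subset_rfl (sub _ _)))
  | trOrR ψ ψ₀ ψ₁ _ ih =>
    simp only [Finset.insert_subset_iff] at hΓ hΔ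
    have hs := mem_of_mem_insert_tr (sentF_arith P ψ) hΓ.1
    exact (Der.or_right hS hI (.of_mem (sentF_arith P ψ) hs) (.eq_of_mem (eqm hΓ.2.1)) hΔ.1
      (ih hr hΓ.2.2 (ins _ (ins _ hΔ.2))
        (H.mono hC subset_rfl ((sub _ _).trans (sub _ _))))).mono (H.succ_le _) le_rfl
  | trOrL ψ ψ₀ ψ₁ _ _ ih ih' =>
    simp only [Finset.insert_subset_iff] at hΓ
    have d := ih hr (insert_subset_insert_comm hΓ.2.2) hΔ (H.mono hC (sub _ _) subset_rfl)
    have d' := ih' hr (insert_subset_insert_comm hΓ.2.2) hΔ (H.mono hC (sub _ _) subset_rfl)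
    rcases Finset.mem_insert.1 hΓ.2.1 with h | h
    · obtain rfl := Fml.tr.inj h
      exact H.or ψ₀ ψ₁ hC (eqm hΓ.1) d d'
    · exact (Der.or_left hS hI (.eq_of_mem (eqm hΓ.1)) h d d').mono (H.succ_le _) le_rfl
  | trAllR ψ ψ₀ s _ ih =>
    simp only [Finset.insert_subset_iff] at hΓ hΔ
    have hs := mem_of_mem_insert_tr (sentF_arith P ψ) hΓ.1
    exact (Der.all_right hS hI (.of_mem (sentF_arith P ψ) hs) (.eq_of_mem (eqm hΓ.2.1)) hΔ.1
      (ih hr (insert_subset_insert_comm (liftS_subset_insert_tr hΓ.2.2))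
        (ins _ (liftS_mono hΔ.2)) (H.mono (H.lift 2 hC) (sub _ _) (sub _ _)))).mono
          (H.succ_le _) le_rfl
  | trAllL ψ ψ₀ s t u _ ih =>
    simp only [Finset.insert_subset_iff] at hΓ
    have hs := mem_of_mem_insert_tr (subF_arith P _ _ _ _) hΓ.1
    have d := ih hr (insert_subset_insert_comm hΓ.2.2.2) hΔ (H.mono hC (sub _ _) subset_rfl)
    rcases Finset.mem_insert.1 hΓ.2.2.1 with h | h
    · obtain rfl := Fml.tr.inj h
      exact H.all ψ₀ s t u hC hs (eqm hΓ.2.1) d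
    · exact (Der.all_left hS hI (.of_mem (subF_arith P _ _ _ _) hs) (.eq_of_mem (eqm hΓ.2.1)) h
        d).mono (H.succ_le _) le_rfl
  | trNegR ψ ψ₀ _ ih =>
    simp only [Finset.insert_subset_iff] at hΓ hΔ
    have hs := mem_of_mem_insert_tr (sentF_arith P ψ) hΓ.1
    exact (Der.neg_right hS hI (.of_mem (sentF_arith P ψ) hs) (.eq_of_mem (eqm hΓ.2.1)) hΔ.1
      (ih hr (insert_subset_insert_comm hΓ.2.2) hΔ.2 (H.mono hC (sub _ _) subset_rfl))).mono
        (H.succ_le _) le_rfl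
  | trNegL ψ ψ₀ _ ih =>
    simp only [Finset.insert_subset_iff] at hΓ
    have d := ih hr hΓ.2.2.2 (ins _ hΔ) (H.mono hC subset_rfl (sub _ _))
    rcases Finset.mem_insert.1 hΓ.2.2.1 with h | h
    · obtain rfl := Fml.tr.inj h
      exact H.neg ψ₀ hC (eqm hΓ.2.1) d
    · exact (Der.neg_left hS hI (.eq_of_mem (eqm hΓ.2.1)) h d).mono (H.succ_le _) le_rfl
  | trEqR ψ s t _ ih =>
    simp only [Finset.insert_subset_iff] at hΓ hΔ
    have hs := mem_of_mem_insert_tr (sentF_arith P ψ) hΓ.1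
    exact (Der.eq_right hS hI (.of_mem (sentF_arith P ψ) hs) (.eq_of_mem (eqm hΓ.2.1)) hΔ.1
      (ih hr hΓ.2.2 (ins _ hΔ.2) (H.mono hC subset_rfl (sub _ _)))).mono (H.succ_le _) le_rfl
  | trEqL ψ s t _ ih =>
    simp only [Finset.insert_subset_iff] at hΓ
    have d := ih hr (insert_subset_insert_comm hΓ.2.2) hΔ (H.mono hC (sub _ _) subset_rfl)
    rcases Finset.mem_insert.1 hΓ.2.1 with h | h
    · obtain rfl := Fml.tr.inj h
      exact H.eq s t hC (eqm hΓ.1) d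
    · exact (Der.eq_left hS hI (.eq_of_mem (eqm hΓ.1)) h d).mono (H.succ_le _) le_rfl
  | trCut k χ hk _ _ hs ih ih' =>
    have d := ih hr (insert_subset_insert_comm hΓ) hΔ (H.mono hC (sub _ _) subset_rfl)
    have d' := ih' hr hΓ (ins _ hΔ) (H.mono hC subset_rfl (sub _ _))
    rcases hr with rfl | ⟨hr, hcut⟩
    · exact (Nat.not_lt_zero k hk).elim
    · exact hcut k χ (hk.trans_le hr) hΓ hC d d' hs

/-- The arithmetical premise of a `T`-cut of index `k` on `χ` becomes a derivation of
`ḋ(χ) ≤ k` that need no longer be arithmetical. An arithmetical cut with this formula turns it into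
a hypothesis, under which the `T`-cut on `χ` is admitted for a trivial reason. -/
theorem LeftRemoval.der {r : ℕ} {C : Tm E → Finset (Fml E) → Finset (Fml E) → Prop}
    {f : ℕ → ℕ} (H : LeftRemoval P S r C f) {a : ℕ} {φ : Tm E} {Γ Δ : Finset (Fml E)}
    (d : Der P S a r (insert (tr φ) Γ) Δ) (hC : C φ Γ Δ) : Der P S (f a) r Γ Δ := by
  refine H.der_of_cuts hS hI d (.inr ⟨le_rfl, fun {a φ Γ Δ Γ'} k χ hk hΓ hC d d' hs => ?_⟩)
    subset_rfl subset_rfl hC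
  have hd := depthLe_arith χ (num k)
  have h0 : f 0 ≤ f a :=
    monotone_nat_of_le_succ (fun a => (Nat.le_succ _).trans (H.succ_le a)) (Nat.zero_le a)
  have sub : ∀ {Θ : Finset (Fml E)} (φ : Fml E), Θ ⊆ insert φ Θ :=
    fun φ => Finset.subset_insert φ _
  -- the derivation of `ḋ(χ) ≤ k` from `T φ` comes from an arithmetical one, without `T`-cuts, so
  -- `T φ` can be removed from it without circularity
  refine .mono ?_ (H.succ_le a) le_rfl
  refine .cut _ hd (.cut_tr hS hI hk (.of_mem hd (Finset.mem_insert_self _ _))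
    (d.weaken (Finset.insert_subset_insert _ (sub _)) subset_rfl) (d'.weaken (sub _) subset_rfl)) ?_
  refine .cut _ (sentF_arith P χ) ?_ (((d'.sentF_right hS hI).weaken subset_rfl
    (Finset.insert_subset_insert _ (sub _))).mono (Nat.le_succ _) le_rfl)
  exact (H.der_of_cuts hS hI (hs.der 0 0) (.inl rfl) (insert_subset_insert_comm hΓ)
    (Finset.singleton_subset_iff.2 (Finset.mem_insert_self _ _))
    (H.mono hC (sub _) (sub _))).mono (h0.trans (Nat.le_succ _)) le_rfl

/-- Replacement of equals below `T` on the left. -/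
theorem Der.replace_left {a r : ℕ} {Γ Δ : Finset (Fml E)} {φ χ : Tm E}
    (he : Entails Γ (eq φ χ)) (hχ : tr χ ∈ Γ) (d : Der P S a r (insert (tr φ) Γ) Δ) :
    Der P S a r Γ Δ := by
  have H : LeftRemoval P S r (fun φ Γ _ => ∃ χ, Fml.eq φ χ ∈ Γ ∧ tr χ ∈ Γ) id :=
    { succ_le := fun _ => le_rfl
      mono := fun ⟨χ, h1, h2⟩ hΓ _ => ⟨χ, hΓ h1, hΓ h2⟩
      lift := fun k ⟨χ, h1, h2⟩ => ⟨χ.lift k, lift_mem_liftS k h1, lift_mem_liftS k h2⟩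
      repl := fun s ⟨χ, h1, h2⟩ he ht =>
        .tr_of_eq hS hI ((Entails.eq_of_mem h1).eq_symm.eq_trans (.eq_of_mem he)) h2 ht
      sent := fun {_ _ Γ _} ⟨χ, h1, h2⟩ hs => .cut_sentF h2
        (((((Entails.eq_of_mem h1).eq_symm.insert (sentF P χ)).sentF
          (.of_mem (sentF_arith P χ) (Finset.mem_insert_self _ Γ))).valid hs).der hS hI _ _)
      or := fun _ _ ⟨χ, h1, h2⟩ he d d' => .or_left hS hI
        ((Entails.eq_of_mem h1).eq_symm.eq_trans (.eq_of_mem he)) h2 d d'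
      all := fun _ _ _ _ ⟨χ, h1, h2⟩ hs he d => .all_left hS hI (.of_mem (subF_arith P _ _ _ _) hs)
        ((Entails.eq_of_mem h1).eq_symm.eq_trans (.eq_of_mem he)) h2 d
      neg := fun _ ⟨χ, h1, h2⟩ he d => .neg_left hS hI
        ((Entails.eq_of_mem h1).eq_symm.eq_trans (.eq_of_mem he)) h2 d
      eq := fun _ _ ⟨χ, h1, h2⟩ he d => .eq_left hS hI
        ((Entails.eq_of_mem h1).eq_symm.eq_trans (.eq_of_mem he)) h2 d }
  refine .cut_entails hS hI he (H.der hS hI (d.weaken ?_ subset_rfl)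
    ⟨χ, Finset.mem_insert_self _ _, Finset.mem_insert_of_mem hχ⟩)
  exact Finset.insert_subset_insert _ (Finset.subset_insert _ _)

end RemovalLeft

/-! ### Inversion of the right truth rules -/

section Inversion

variable {E : FirstOrder.Language.{u, v}} {P : Coding E} {S : Set (Fml E)}

theorem eq_lift (s t : Tm E) (k : ℕ) : (eq s t).lift k = eq (s.lift k) (t.lift k) := rfl

theorem cOr_lift (s t : Tm E) (k : ℕ) : (cOr s t).lift k = cOr (s.lift k) (t.lift k) :=
  cOr_subst _ _ _

theorem cNeg_lift (s : Tm E) (k : ℕ) : (cNeg s).lift k = cNeg (s.lift k) := cNeg_subst _ _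

theorem cAll_lift (s t : Tm E) (k : ℕ) : (cAll s t).lift k = cAll (s.lift k) (t.lift k) :=
  cAll_subst _ _ _

theorem cEq_lift (s t : Tm E) (k : ℕ) : (cEq s t).lift k = cEq (s.lift k) (t.lift k) :=
  cEq_subst _ _ _

theorem subF_lift (x y z w : Tm E) (k : ℕ) : (subF P x y z w).lift k =
    subF P (x.lift k) (y.lift k) (z.lift k) (w.lift k) := subF_subst _ _ _ _ _ _

theorem eqF_lift (s t : Tm E) (k : ℕ) : (eqF P s t).lift k = eqF P (s.lift k) (t.lift k) :=
  eqF_subst _ _ _ _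

variable (hS : ∀ φ ∈ S, φ.Arith ∧ φ.Closed) (hI : ∀ φ, IDexp E φ → Provable S φ)
include hS hI

/-- Inversion of the rule for `∨̇` on the right. The bound on the truth rules grows by one: where the
other side has `T ψ` for some `ψ = φ`, an initial sequent turns into a left rule for `∨̇`. The same
happens in the other inversions. -/
theorem Der.inv_or {a r : ℕ} {Γ Δ : Finset (Fml E)} {φ ψ₀ ψ₁ : Tm E}
    (he : eq φ (cOr ψ₀ ψ₁) ∈ Γ) (d : Der P S a r Γ (insert (tr φ) Δ)) :
    Der P S (a + 1) r Γ (insert (tr ψ₀) (insert (tr ψ₁) Δ)) := by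
  have H : RightRemoval P S r
      (fun φ Γ Δ => ∃ ψ₀ ψ₁, eq φ (cOr ψ₀ ψ₁) ∈ Γ ∧ tr ψ₀ ∈ Δ ∧ tr ψ₁ ∈ Δ) (· + 1) :=
    { succ_le := fun _ => le_rfl
      mono := fun ⟨ψ₀, ψ₁, h, h0, h1⟩ hΓ hΔ => ⟨ψ₀, ψ₁, hΓ h, hΔ h0, hΔ h1⟩
      lift := fun k ⟨ψ₀, ψ₁, h, h0, h1⟩ => ⟨ψ₀.lift k, ψ₁.lift k, by
        simpa only [eq_lift, cOr_lift] using lift_mem_liftS k h, lift_mem_liftS k h0,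
        lift_mem_liftS k h1⟩
      repl := fun {a _ Γ Δ} s ⟨ψ₀, ψ₁, h, h0, h1⟩ he ht => by
        have id : ∀ ψ, tr ψ ∈ Δ → Der P S a r (insert (tr ψ) Γ) Δ := fun ψ hψ =>
          .tr_of_eq hS hI (.eq_refl _ ψ) (Finset.mem_insert_self _ _) hψ
        exact .or_left hS hI ((Entails.eq_of_mem he).eq_trans (.eq_of_mem h)) ht
          (id ψ₀ h0) (id ψ₁ h1)
      or := fun {a _ Γ Δ} χ₀ χ₁ ⟨ψ₀, ψ₁, h, h0, h1⟩ _ he d => by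
        obtain ⟨e0, e1⟩ := (Entails.eq_of_mem he).cOr_inj (.eq_of_mem h)
        exact ((d.replace_right hS hI e0 (Finset.mem_insert_of_mem h0)).replace_right hS hI e1
          h1).mono (Nat.le_succ _) le_rfl
      all := fun _ _ ⟨ψ₀, ψ₁, h, _, _⟩ _ he _ =>
        ((Entails.eq_of_mem h).cOr_cAll (.eq_of_mem he)).der_of_empty hS hI _ _
      neg := fun _ ⟨ψ₀, ψ₁, h, _, _⟩ _ he _ =>
        ((Entails.eq_of_mem he).cNeg_cOr (.eq_of_mem h)).der_of_empty hS hI _ _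
      eq := fun _ _ ⟨ψ₀, ψ₁, h, _, _⟩ _ he _ =>
        ((Entails.eq_of_mem he).cEq_cOr (.eq_of_mem h)).der_of_empty hS hI _ _ }
  exact H.der hS hI d le_rfl subset_rfl (Finset.insert_subset_insert _
    ((Finset.subset_insert _ _).trans (Finset.subset_insert _ _))) ⟨ψ₀, ψ₁, he, by simp, by simp⟩

theorem Der.inv_neg {a r : ℕ} {Γ Δ : Finset (Fml E)} {φ ψ₀ : Tm E}
    (he : eq φ (cNeg ψ₀) ∈ Γ) (d : Der P S a r Γ (insert (tr φ) Δ)) :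
    Der P S (a + 1) r (insert (tr ψ₀) Γ) Δ := by
  have H : RightRemoval P S r
      (fun φ Γ _ => ∃ ψ₀, eq φ (cNeg ψ₀) ∈ Γ ∧ tr ψ₀ ∈ Γ) (· + 1) :=
    { succ_le := fun _ => le_rfl
      mono := fun ⟨ψ₀, h, h0⟩ hΓ _ => ⟨ψ₀, hΓ h, hΓ h0⟩
      lift := fun k ⟨ψ₀, h, h0⟩ => ⟨ψ₀.lift k, by
        simpa only [eq_lift, cNeg_lift] using lift_mem_liftS k h, lift_mem_liftS k h0⟩
      repl := fun s ⟨ψ₀, h, h0⟩ he ht =>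
        .neg_left hS hI ((Entails.eq_of_mem he).eq_trans (.eq_of_mem h)) ht
          (.tr_of_eq hS hI (.eq_refl _ ψ₀) h0 (Finset.mem_insert_self _ _))
      or := fun _ _ ⟨ψ₀, h, _⟩ _ he _ =>
        ((Entails.eq_of_mem h).cNeg_cOr (.eq_of_mem he)).der_of_empty hS hI _ _
      all := fun _ _ ⟨ψ₀, h, _⟩ _ he _ =>
        ((Entails.eq_of_mem h).cNeg_cAll (.eq_of_mem he)).der_of_empty hS hI _ _
      neg := fun _ ⟨ψ₀, h, h0⟩ _ he d =>
        (d.replace_left hS hI ((Entails.eq_of_mem he).cNeg_inj (.eq_of_mem h)) h0).mono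
          (Nat.le_succ _) le_rfl
      eq := fun _ _ ⟨ψ₀, h, _⟩ _ he _ =>
        ((Entails.eq_of_mem he).cEq_cNeg (.eq_of_mem h)).der_of_empty hS hI _ _ }
  exact H.der hS hI d le_rfl (Finset.subset_insert _ _) subset_rfl
    ⟨ψ₀, Finset.mem_insert_of_mem he, Finset.mem_insert_self _ _⟩

theorem Der.inv_all {a r : ℕ} {Γ Δ : Finset (Fml E)} {φ ψ₀ s t u : Tm E}
    (he : eq φ (cAll s ψ₀) ∈ Γ) (hs : subF P ψ₀ s t u ∈ Γ)
    (d : Der P S a r Γ (insert (tr φ) Δ)) : Der P S (a + 1) r Γ (insert (tr u) Δ) := by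
  have H : RightRemoval P S r (fun φ Γ Δ => ∃ ψ₀ s t u, eq φ (cAll s ψ₀) ∈ Γ ∧
      subF P ψ₀ s t u ∈ Γ ∧ tr u ∈ Δ) (· + 1) :=
    { succ_le := fun _ => le_rfl
      mono := fun ⟨ψ₀, s, t, u, h, hs, hu⟩ hΓ hΔ => ⟨ψ₀, s, t, u, hΓ h, hΓ hs, hΔ hu⟩
      lift := fun k ⟨ψ₀, s, t, u, h, hs, hu⟩ => ⟨ψ₀.lift k, s.lift k, t.lift k, u.lift k, by
        simpa only [eq_lift, cAll_lift] using lift_mem_liftS k h, by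
        simpa only [subF_lift] using lift_mem_liftS k hs, lift_mem_liftS k hu⟩
      repl := fun _ ⟨ψ₀, s, t, u, h, hs, hu⟩ he ht =>
        .all_left hS hI (.of_mem (subF_arith P _ _ _ _) hs)
          ((Entails.eq_of_mem he).eq_trans (.eq_of_mem h)) ht
          (.tr_of_eq hS hI (.eq_refl _ u) (Finset.mem_insert_self _ _) hu)
      or := fun _ _ ⟨ψ₀, s, t, u, h, _, _⟩ _ he _ =>
        ((Entails.eq_of_mem he).cOr_cAll (.eq_of_mem h)).der_of_empty hS hI _ _
      all := fun {a _ Γ Δ} χ₀ s' ⟨ψ₀, s, t, u, h, hs, hu⟩ _ he d => by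
        obtain ⟨e0, e1⟩ := (Entails.eq_of_mem h).cAll_inj (.eq_of_mem he)
        -- instantiate the eigenvariables by `t` and `u`
        have hl : ∀ Θ : Finset (Fml E),
            substS (cons u (cons t var)) (liftS 2 Θ) = Θ := by
          intro Θ
          rw [liftS_eq_substS, substS_substS]
          exact substS_var Θ
        have hx : ∀ x : Tm E, (x.lift 2).subst (cons u (cons t var)) = x := by
          intro x
          rw [Tm.lift, Tm.subst_subst]
          exact x.subst_var
        have d1 := d.subst hS (cons u (cons t var))
        simp only [substS_insert, subF_subst, hl, hx] at d1
        have d2 : Der P S (a + 1) r (insert (subF P χ₀ s' t u) Γ) (insert (tr u) Δ) := d1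
        rw [Finset.insert_eq_of_mem hu] at d2
        exact (Der.cut_entails hS hI (.subF e1 e0 (.of_mem (subF_arith P _ _ _ _) hs)) d2).mono
          (Nat.le_succ _) le_rfl
      neg := fun _ ⟨ψ₀, s, t, u, h, _, _⟩ _ he _ =>
        ((Entails.eq_of_mem he).cNeg_cAll (.eq_of_mem h)).der_of_empty hS hI _ _
      eq := fun _ _ ⟨ψ₀, s, t, u, h, _, _⟩ _ he _ =>
        ((Entails.eq_of_mem he).cEq_cAll (.eq_of_mem h)).der_of_empty hS hI _ _ }
  exact H.der hS hI d le_rfl subset_rfl (Finset.insert_subset_insert _ (Finset.subset_insert _ _))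
    ⟨ψ₀, s, t, u, he, hs, Finset.mem_insert_self _ _⟩

theorem Der.inv_eq {a r : ℕ} {Γ Δ : Finset (Fml E)} {φ s t : Tm E}
    (he : eq φ (cEq s t) ∈ Γ) (d : Der P S a r Γ (insert (tr φ) Δ)) :
    Der P S (a + 1) r Γ (insert (eqF P s t) Δ) := by
  have H : RightRemoval P S r
      (fun φ Γ Δ => ∃ s t, eq φ (cEq s t) ∈ Γ ∧ eqF P s t ∈ Δ) (· + 1) :=
    { succ_le := fun _ => le_rfl
      mono := fun ⟨s, t, h, h0⟩ hΓ hΔ => ⟨s, t, hΓ h, hΔ h0⟩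
      lift := fun k ⟨s, t, h, h0⟩ => ⟨s.lift k, t.lift k, by
        simpa only [eq_lift, cEq_lift] using lift_mem_liftS k h, by
        simpa only [eqF_lift] using lift_mem_liftS k h0⟩
      repl := fun _ ⟨s, t, h, h0⟩ he ht =>
        .eq_left hS hI ((Entails.eq_of_mem he).eq_trans (.eq_of_mem h)) ht
          (((Entails.of_mem (eqF_arith P s t) (Finset.mem_insert_self _ _)).valid h0).der hS hI _ _)
      or := fun _ _ ⟨s, t, h, _⟩ _ he _ =>
        ((Entails.eq_of_mem h).cEq_cOr (.eq_of_mem he)).der_of_empty hS hI _ _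
      all := fun _ _ ⟨s, t, h, _⟩ _ he _ =>
        ((Entails.eq_of_mem h).cEq_cAll (.eq_of_mem he)).der_of_empty hS hI _ _
      neg := fun _ ⟨s, t, h, _⟩ _ he _ =>
        ((Entails.eq_of_mem h).cEq_cNeg (.eq_of_mem he)).der_of_empty hS hI _ _
      eq := fun {_ _ Γ _} s' t' ⟨s, t, h, h0⟩ _ he d => by
        obtain ⟨e0, e1⟩ := (Entails.eq_of_mem he).cEq_inj (.eq_of_mem h)
        refine .mono (.cut _ (eqF_arith P s' t') (((Entails.eqF (e0.insert _) (e1.insert _)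
          (.of_mem (eqF_arith P s' t') (Finset.mem_insert_self _ Γ))).valid h0).der hS hI _ _) d)
          (Nat.le_succ _) le_rfl }
  exact H.der hS hI d le_rfl subset_rfl (Finset.insert_subset_insert _ (Finset.subset_insert _ _))
    ⟨s, t, he, Finset.mem_insert_self _ _⟩

end Inversion

/-! ### Elimination of the truth cuts -/

section Elimination

variable {E : FirstOrder.Language.{u, v}} {P : Coding E} {S : Set (Fml E)}
  (hS : ∀ φ ∈ S, φ.Arith ∧ φ.Closed) (hI : ∀ φ, IDexp E φ → Provable S φ)

theorem depthLe_lift (x : Tm E) (j k : ℕ) :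
    (depthLe x (num j)).lift k = depthLe (x.lift k) (num j) := by
  rw [Fml.lift, depthLe_subst, Tm.num_subst]
  rfl

theorem arith_of_mem_liftS {Γ : Finset (Fml E)} {k : ℕ} (h : ∀ φ ∈ Γ, φ.Arith) :
    ∀ φ ∈ liftS k Γ, φ.Arith := by
  intro φ hφ
  obtain ⟨ψ, hψ, rfl⟩ := Finset.mem_image.1 hφ
  exact (subst_arith _).2 (h ψ hψ)

/-- A derivation without `T`-cuts of a sequent in `L` is a derivation in `L`: a truth rule puts a
formula `T ψ` into its conclusion, and no rule but the `T`-cut removes it further down. -/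
theorem Der.lk_of_arith {a r : ℕ} {Γ Δ : Finset (Fml E)} (d : Der P S a r Γ Δ) (hr : r = 0)
    (hΓ : ∀ φ ∈ Γ, φ.Arith) (hΔ : ∀ φ ∈ Δ, φ.Arith) :
    LK (fun Γ Δ => BaseInit S Γ Δ ∧ (∀ φ ∈ Γ, φ.Arith) ∧ ∀ φ ∈ Δ, φ.Arith) Γ Δ := by
  have ins {Θ : Finset (Fml E)} {α : Fml E} (hα : α.Arith) (h : ∀ φ ∈ Θ, φ.Arith) :
      ∀ φ ∈ insert α Θ, φ.Arith := (Finset.forall_mem_insert _ _ _).2 ⟨hα, h⟩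
  induction d with
  | init h =>
    cases h with
    | base hb => exact .init ⟨hb, hΓ, hΔ⟩
    | tr_repl s t => exact (hΔ (tr t) (by simp)).elim
    | tr_sent s => exact (hΓ (tr s) (by simp)).elim
  | allR α _ ih =>
    obtain ⟨h, hΔ⟩ := (Finset.forall_mem_insert _ _ _).1 hΔ
    exact .allR α (ih hr (arith_of_mem_liftS hΓ) (ins h (arith_of_mem_liftS hΔ)))
  | allL α s _ ih =>
    obtain ⟨h, hΓ⟩ := (Finset.forall_mem_insert _ _ _).1 hΓ
    exact .allL α s (ih hr (ins ((subst_arith _).2 h) hΓ) hΔ)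
  | orR α β _ ih =>
    obtain ⟨h, hΔ⟩ := (Finset.forall_mem_insert _ _ _).1 hΔ
    exact .orR α β (ih hr hΓ (ins h.1 (ins h.2 hΔ)))
  | orL α β _ _ ih ih' =>
    obtain ⟨h, hΓ⟩ := (Finset.forall_mem_insert _ _ _).1 hΓ
    exact .orL α β (ih hr (ins h.1 hΓ) hΔ) (ih' hr (ins h.2 hΓ) hΔ)
  | negR α _ ih =>
    obtain ⟨h, hΔ⟩ := (Finset.forall_mem_insert _ _ _).1 hΔ
    exact .negR α (ih hr (ins h hΓ) hΔ)
  | negL α _ ih =>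
    obtain ⟨h, hΓ⟩ := (Finset.forall_mem_insert _ _ _).1 hΓ
    exact .negL α (ih hr hΓ (ins h hΔ))
  | cut α hα _ _ ih ih' => exact .cut α hα (ih hr (ins hα hΓ) hΔ) (ih' hr hΓ (ins hα hΔ))
  | trOrR ψ => exact (hΔ (tr ψ) (by simp)).elim
  | trOrL ψ => exact (hΓ (tr ψ) (by simp)).elim
  | trAllR ψ => exact (hΔ (tr ψ) (by simp)).elim
  | trAllL ψ => exact (hΓ (tr ψ) (by simp)).elim
  | trNegR ψ => exact (hΔ (tr ψ) (by simp)).elim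
  | trNegL ψ => exact (hΓ (tr ψ) (by simp)).elim
  | trEqR ψ => exact (hΔ (tr ψ) (by simp)).elim
  | trEqL ψ => exact (hΓ (tr ψ) (by simp)).elim
  | trCut k φ hk => omega

theorem Der.of_provable {α : Fml E} (h : Provable S α) : Der P S 0 0 ∅ {α} :=
  Star.der (P := P) (LK.mono (fun _ _ h => .base h.1) h) 0 0

include hS hI

/-- A `T`-cut on a formula of depth at most `r` is replaced by `T`-cuts of smaller index. The
derivation of `Γ ⇒ Δ, T φ` is inverted where the other one introduces `T φ`; this costs the `b + 1`
in the bound. Each truth rule on `T φ` becomes at most two `T`-cuts, for the two disjuncts. -/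
theorem Der.reduce {a b r : ℕ} {Γ Δ : Finset (Fml E)} {φ : Tm E} (hs : sentF P φ ∈ Γ)
    (hd : depthLe φ (num r) ∈ Γ) (d : Der P S a r (insert (tr φ) Γ) Δ)
    (d' : Der P S b r Γ (insert (tr φ) Δ)) : Der P S (b + 1 + 2 * a) r Γ Δ := by
  have sub : ∀ {Θ : Finset (Fml E)} (φ : Fml E), Θ ⊆ insert φ Θ :=
    fun φ => Finset.subset_insert φ _
  have H : LeftRemoval P S r (fun φ Γ Δ => sentF P φ ∈ Γ ∧ depthLe φ (num r) ∈ Γ ∧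
      Der P S b r Γ (insert (tr φ) Δ)) (fun a => b + 1 + 2 * a) :=
    { succ_le := fun a => by omega
      mono := fun ⟨h1, h2, h3⟩ hΓ hΔ =>
        ⟨hΓ h1, hΓ h2, h3.weaken hΓ (Finset.insert_subset_insert _ hΔ)⟩
      lift := fun {φ Γ Δ} k ⟨h1, h2, h3⟩ => by
        refine ⟨?_, ?_, ?_⟩
        · have := lift_mem_liftS k h1
          rwa [Fml.lift, sentF_subst] at this
        · have := lift_mem_liftS k h2
          rwa [depthLe_lift] at this
        · have := h3.subst hS fun i => var (i + k)
          rwa [substS_insert] at this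
      repl := fun s ⟨_, _, h3⟩ he ht =>
        ((h3.replace_right hS hI (.eq_of_mem he) ht)).mono (by omega) le_rfl
      sent := fun ⟨h1, _, _⟩ h => ((Entails.of_mem (sentF_arith P _) h1).valid h).der hS hI _ _
      or := fun {a φ Γ Δ} ψ₀ ψ₁ ⟨_, h2, h3⟩ he d d' => by
        rcases (Entails.eq_of_mem he).depth_cOr (.of_mem (depthLe_arith _ _) h2) with
          h | ⟨j, hj, h0, h1⟩
        · exact h.der_of_empty hS hI _ _
        have hi := (h3.inv_or hS hI he).mono (Nat.le_add_right (b + 1) (2 * a)) le_rfl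
        exact .cut_tr hS hI hj h1 (d'.mono (Nat.le_succ _) le_rfl)
          (.cut_tr hS hI hj h0 (d.weaken subset_rfl (sub _)) hi)
      all := fun {a φ Γ Δ} ψ₀ s t u ⟨_, h2, h3⟩ hs he d => by
        rcases (Entails.eq_of_mem he).depth_cAll (.of_mem (subF_arith P _ _ _ _) hs)
          (.of_mem (depthLe_arith _ _) h2) with h | ⟨j, hj, h0⟩
        · exact h.der_of_empty hS hI _ _
        have hi := (h3.inv_all hS hI he hs).mono (Nat.le_add_right (b + 1) (2 * a)) le_rfl
        exact (Der.cut_tr hS hI hj h0 d hi).mono (by omega) le_rfl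
      neg := fun {a φ Γ Δ} ψ₀ ⟨_, h2, h3⟩ he d => by
        rcases (Entails.eq_of_mem he).depth_cNeg (.of_mem (depthLe_arith _ _) h2) with
          h | ⟨j, hj, h0⟩
        · exact h.der_of_empty hS hI _ _
        have hi := (h3.inv_neg hS hI he).mono (Nat.le_add_right (b + 1) (2 * a)) le_rfl
        exact (Der.cut_tr hS hI hj h0 hi d).mono (by omega) le_rfl
      eq := fun {a φ Γ Δ} s t ⟨_, _, h3⟩ he d => by
        have hi := (h3.inv_eq hS hI he).mono (Nat.le_add_right (b + 1) (2 * a)) le_rfl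
        exact (Der.cut _ (eqF_arith P s t) d hi).mono (by omega) le_rfl }
  exact H.der hS hI d ⟨hs, hd, d'⟩

/-- All `T`-cuts of the largest index are removed. The bound `g a = (3 ^ a - 1) / 2` satisfies
`g 0 = 0` and `g (a + 1) = 3 * g a + 1`, and `Der.reduce` yields `g a + 1 + 2 * g a` for a `T`-cut
both of whose premises have the bound `g a`. -/
theorem Der.eliminate {a r' r : ℕ} {Γ Δ : Finset (Fml E)} (d : Der P S a r' Γ Δ)
    (hr : r' = r + 1) : Der P S ((3 ^ a - 1) / 2) r Γ Δ := by
  have hg : ∀ a : ℕ, (3 ^ (a + 1) - 1) / 2 = 3 * ((3 ^ a - 1) / 2) + 1 := by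
    intro a
    have h1 : 3 ^ a % 2 = 1 := Nat.odd_iff.1 (Odd.pow (by decide))
    rw [pow_succ]
    omega
  have hle : ∀ a : ℕ, (3 ^ a - 1) / 2 + 1 ≤ (3 ^ (a + 1) - 1) / 2 := by
    intro a
    rw [hg]
    omega
  induction d with
  | init h => exact .init h
  | allR α _ ih => exact .allR α (ih hr)
  | allL α s _ ih => exact .allL α s (ih hr)
  | orR α β _ ih => exact .orR α β (ih hr)
  | orL α β _ _ ih ih' => exact .orL α β (ih hr) (ih' hr)
  | negR α _ ih => exact .negR α (ih hr)
  | negL α _ ih => exact .negL α (ih hr)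
  | cut α hα _ _ ih ih' => exact .cut α hα (ih hr) (ih' hr)
  | trOrR ψ ψ₀ ψ₁ _ ih => exact (Der.trOrR ψ ψ₀ ψ₁ (ih hr)).mono (hle _) le_rfl
  | trOrL ψ ψ₀ ψ₁ _ _ ih ih' => exact (Der.trOrL ψ ψ₀ ψ₁ (ih hr) (ih' hr)).mono (hle _) le_rfl
  | trAllR ψ ψ₀ s _ ih => exact (Der.trAllR ψ ψ₀ s (ih hr)).mono (hle _) le_rfl
  | trAllL ψ ψ₀ s t u _ ih => exact (Der.trAllL ψ ψ₀ s t u (ih hr)).mono (hle _) le_rfl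
  | trNegR ψ ψ₀ _ ih => exact (Der.trNegR ψ ψ₀ (ih hr)).mono (hle _) le_rfl
  | trNegL ψ ψ₀ _ ih => exact (Der.trNegL ψ ψ₀ (ih hr)).mono (hle _) le_rfl
  | trEqR ψ s t _ ih => exact (Der.trEqR ψ s t (ih hr)).mono (hle _) le_rfl
  | trEqL ψ s t _ ih => exact (Der.trEqL ψ s t (ih hr)).mono (hle _) le_rfl
  | @trCut a r' Γ Δ k φ hk _ _ hs ih ih' =>
    subst hr
    rcases (Nat.lt_succ_iff_lt_or_eq.1 hk) with hk | rfl
    · exact (Der.trCut k φ hk (ih rfl) (ih' rfl) hs).mono (hle _) le_rfl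
    have sub : ∀ {Θ : Finset (Fml E)} (φ : Fml E), Θ ⊆ insert φ Θ :=
      fun φ => Finset.subset_insert φ _
    have hΓ : Γ ⊆ insert (depthLe φ (num k)) (insert (sentF P φ) Γ) := (sub _).trans (sub _)
    -- `Der.reduce` needs the sentence and the depth condition among the hypotheses; both are then
    -- discharged by arithmetical cuts
    have h1 := Der.reduce hS hI (by simp) (by simp)
      ((ih rfl).weaken (Finset.insert_subset_insert _ hΓ) subset_rfl)
      ((ih' rfl).weaken hΓ subset_rfl)
    rw [hg a]
    exact .cut _ (sentF_arith P φ)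
      (.cut _ (depthLe_arith φ (num k)) (h1.mono (by omega) le_rfl)
        ((hs.der _ _).weaken subset_rfl (by simp)))
      (((ih' rfl).sentF_right hS hI).mono (by omega) le_rfl)

end Elimination

end CompTruth

open CompTruth in
theorem mainTheorem4 {E : FirstOrder.Language.{u, v}} (P : Coding E) (S : Set (Fml E))
    (hS : ∀ φ ∈ S, φ.Arith ∧ φ.Closed)
    (hI : ∀ φ, IDexp E φ → Provable S φ) :
    (∀ (a r : ℕ) (Γ Δ : Finset (Fml E)), Der P S a (r + 1) Γ Δ → Der P S (3 ^ a) r Γ Δ) ∧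
    (∀ (a r : ℕ) (Γ Δ : Finset (Fml E)), Der P S a r Γ Δ → ∃ b : ℕ, Der P S b 0 Γ Δ) ∧
    (∀ α : Fml E, α.Arith → ((∃ a r : ℕ, Der P S a r ∅ {α}) ↔ Provable S α)) := by
  have h1 : ∀ (a r : ℕ) (Γ Δ : Finset (Fml E)), Der P S a (r + 1) Γ Δ → Der P S (3 ^ a) r Γ Δ :=
    fun a r Γ Δ d => (d.eliminate hS hI rfl).mono
      ((Nat.div_le_self _ _).trans (Nat.sub_le _ _)) le_rfl
  have h2 : ∀ (r a : ℕ) (Γ Δ : Finset (Fml E)), Der P S a r Γ Δ → ∃ b : ℕ, Der P S b 0 Γ Δ := by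
    intro r
    induction r with
    | zero => exact fun a Γ Δ d => ⟨a, d⟩
    | succ r ih => exact fun a Γ Δ d => ih _ Γ Δ (h1 a r Γ Δ d)
  refine ⟨h1, fun a r => h2 r a, fun α hα => ⟨fun ⟨a, r, d⟩ => ?_, fun h => ⟨0, 0, .of_provable h⟩⟩⟩
  obtain ⟨b, d⟩ := h2 r a _ _ d
  exact d.lk_of_arith rfl (by simp) (by simpa using hα)
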